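/- **Setting.** Let $G=(V,E)$ be a finite bipartite graph with colour classes $W$ (workers) and $F$ (firms), edge capacities $b\in\mathbb Z_+^E$ and quotas $q(w)\in\mathbb Z_+$ $(w\in W)$. For $v\in V$ let $E_v$ be the set of edges at $v$, let $x_v:=x|_{E_v}$, and let $\mathcal B_v:=\{z\in\mathbb Z_+^{E_v}: z\le b|_{E_v}\}$. Write $|z|$ for the sum of the entries of $z\ge 0$, and $\mathbf 1^e$ for the unit vector of $e$. Each $w\in W$ has a linear order $>_w$ on $E_w$; its choice function $C_w$ on $\mathcal B_w$ takes the edges in decreasing preference, each as fully as possible, until the total $q(w)$ is reached, so $C_w(z)(e)=\min\{z(e),\max(0,\,q(w)-\sum_{e'>_w e}z(e'))\}$. Each $f\in F$ has a choice function $C_f:\mathcal B_f\to\mathcal B_f$ with $C_f(z)\le z$ such that, for all $z\ge z'$ in $\mathcal B_f$: $z'\ge C_f(z)$ implies $C_f(z')=C_f(z)$; $C_f(z)\wedge z'\le C_f(z')$; $|C_f(z)|\ge|C_f(z')|$. **Stable g-allocations.** $z\in\mathcal B_v$ is acceptable if $C_v(z)=z$. For acceptable $z,z'$ write $z\preceq_v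 z'$ if $C_v(z\vee z')=z'$, and $z\prec_v z'$ if moreover $z\ne z'$. An edge $e\in E_v$ is interesting for $v$ under $z$ if there is $z'\in\mathcal B_v$ that differs from $z$ only at $e$ and satisfies $z'(e)>z(e)$ and $C_v(z')(e)>z(e)$. A g-allocation is $x\in\mathbb Z_+^E$ with all $x_v$ acceptable. It is stable if no edge $wf$ is interesting both for $w$ under $x_w$ and for $f$ under $x_f$. Let $\mathcal S$ be the set of stable g-allocations, with $x\preceq_F y$ iff $x_f\preceq_f y_f$ for all $f\in F$, and let $x^{\min},x^{\max}$ be its least and greatest elements. **Condition (C).** A pair $(a,c)$ of distinct edges in $E_f$ is a tandem for an acceptable $z\in\mathcal B_f$ if $z(a)<b(a)$, $z(c)>0$ and $C_f(z+\mathbf 1^a)=z+\mathbf 1^a-\mathbf 1^c$. Condition (C) says: for every $f\in F$, if $z^1\prec_f z^2\prec_f z^3$ are acceptable and $(a,c^i)$ is a tandem for $z^i$ $(i=1,2,3)$ with $c^1=c^3$, then $c^1=c^2$. **Rotations.** Let $x\in\mathcal S$. For $w\in W$ with $|x_w|=q(w)$ and $x_w\neq0$, let $\ell_w$ be the least preferred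 edge of the support of $x_w$. The $W$-admissible edge at $w$ is the most preferred edge $a=wf\le_w\ell_w$ that is interesting for $f$ under $x_f$, if there is one. If $(a,c)$ is a tandem for $x_f$ with $a$ $W$-admissible, then $c$ is called $F$-admissible and associated with $a$. Direct the $W$-admissible edges from $W$ to $F$ and the $F$-admissible ones from $F$ to $W$. As long as possible, delete a $W$-admissible edge $a$ that leaves a vertex with no entering $F$-admissible edge, together with its associated edge $c$ if $c$ is associated with no other remaining $W$-admissible edge. The result is the active graph $\Gamma(x)$. A rotation $L\in\mathcal L(x)$ is a directed edge-simple cycle in $\Gamma(x)$ in which each two consecutive edges meeting at a firm form a tandem; $L^+$ (resp. $L^-$) is the set of its edges going from $W$ to $F$ (resp. from $F$ to $W$). Two rotations are the same if they are the same cyclic sequence of edges. A weight $\lambda\in\mathbb Z_{>0}$ is feasible for $L$ at $x$ if $\lambda\le x(e)$ on $L^-$, $\lambda\le b(e)-x(e)$ on $L^+$, and $C_f(x_f+\lambda\mathbf 1^a)=x_f+\lambda\mathbf 1^a-\lambda\mathbf 1^c$ for each tandem $(a,c)$ in $L$ at each firm $f$; then $x+\lambda\chi^{L^+}-\lambda\chi^{L^-}$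 is said to be obtained from $x$ by shifting along $L$ with weight $\lambda$. **Routes.** For $x\preceq_F y$ in $\mathcal S$, a route from $x$ to $y$ is a sequence $x=x^1,\dots,x^N=y$ in $\mathcal S$ in which each $x^{i+1}$ is obtained from $x^i$ by shifting along some $L^i\in\mathcal L(x^i)$ with a feasible weight $\lambda_i$ (for $x=y$, the one-term sequence). It is non-excessive if each $\lambda_i$ is the maximal feasible weight for $L^i$ at $x^i$ for which the shifted g-allocation is still $\preceq_F y$. A full route is a non-excessive route from $x^{\min}$ to $x^{\max}$. **Theorem 5.2.** Assume that condition (C) holds. Then $(\mathcal S,\preceq_F)$ is a lattice, full routes exist, and there are a set $\mathcal R$ of rotations and weights $\tau_L$ $(L\in\mathcal R)$ such that every full route uses each $L\in\mathcal R$ exactly once, with weight $\tau_L$, and uses no other rotation. The relation "$L\triangleleft L'$ iff $L$ is used earlier than $L'$ in all full routes" is a strict partial order on $\mathcal R$. For each $x\in\mathcal S$ there is a non-excessive route from $x^{\min}$ to $x$; every such route uses only rotations in $\mathcal R$, each at most once; and the function $\omega(x):\mathcal R\to\mathbb Z_+$ that takes each rotation used in the route to its weight there, and every other rotation to $0$,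 does not depend on the choice of the route. The map $x\mapsto\omega(x)$ is an isomorphism of the lattice $(\mathcal S,\preceq_F)$ onto the lattice, with the pointwise order, of closed functions for $(\mathcal R,\tau,\triangleleft)$, that is, of the functions $\xi:\mathcal R\to\mathbb Z_+$ such that $\xi(L)\le\tau_L$ for all $L\in\mathcal R$, and $\xi(L)=\tau_L$ whenever $L\triangleleft L'$ and $\xi(L')>0$. -/

import Mathlib

/-! ### Choice functions on an integer box `{z : ι → ℕ | z ≤ b}` -/

/-- A choice function on the box `{z | z ≤ b}` obeying the axioms of consistence,
substitutability and size monotonicity.  Values of `C` outside the box play no role. -/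
structure IsChoiceFunction {ι : Type*} [Fintype ι] (b : ι → ℕ) (C : (ι → ℕ) → (ι → ℕ)) :
    Prop where
  choice_le : ∀ z, z ≤ b → C z ≤ z
  consistence : ∀ z z', z ≤ b → z' ≤ z → C z ≤ z' → C z' = C z
  substitutability : ∀ z z', z ≤ b → z' ≤ z → C z ⊓ z' ≤ C z'
  size_monotonicity : ∀ z z', z ≤ b → z' ≤ z → ∑ e, C z' e ≤ ∑ e, C z e

/-- The choice function generated by a linear order (greater means more preferred) and a
quota `q`: fill the edges from the most preferred one downwards until `q` is exhausted. -/
def linearChoice {ι : Type*} [Fintype ι] (o : LinearOrder ι) (q : ℕ) (z : ι → ℕ) : ι → ℕ :=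
  fun e => min (z e) (q - ∑ e' ∈ Finset.univ.filter (fun e' => o.lt e e'), z e')

/-- `z` is acceptable: it lies in the box and is chosen entirely. -/
def Acceptable {ι : Type*} (b : ι → ℕ) (C : (ι → ℕ) → (ι → ℕ)) (z : ι → ℕ) : Prop :=
  z ≤ b ∧ C z = z

/-- Revealed preference, in its weak form: `z ⪯ z'`. -/
def WeakPref {ι : Type*} (C : (ι → ℕ) → (ι → ℕ)) (z z' : ι → ℕ) : Prop :=
  C (z ⊔ z') = z'

/-- Revealed preference, in its strict form: `z ≺ z'`. -/
def StrictPref {ι : Type*} (C : (ι → ℕ) → (ι → ℕ)) (z z' : ι → ℕ) : Prop :=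
  z ≠ z' ∧ WeakPref C z z'

/-- `e` is interesting under `z`: some increase at `e` alone, within the box, is partly chosen. -/
def Interesting {ι : Type*} (b : ι → ℕ) (C : (ι → ℕ) → (ι → ℕ)) (z : ι → ℕ) (e : ι) : Prop :=
  ∃ z', z' ≤ b ∧ z e < z' e ∧ (∀ e', e' ≠ e → z' e' = z e') ∧ z e < C z' e

/-- `(a, c)` is a tandem for `z`: `C (z + 1ᵃ) = z + 1ᵃ - 1ᶜ` (the subtraction is moved to
the left-hand side). -/
def IsTandem {ι : Type*} [DecidableEq ι] (b : ι → ℕ) (C : (ι → ℕ) → (ι → ℕ)) (z : ι → ℕ)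
    (a c : ι) : Prop :=
  z a < b a ∧ 0 < z c ∧ c ≠ a ∧ C (z + Pi.single a 1) + Pi.single c 1 = z + Pi.single a 1

/-- The gapless condition for one choice function. -/
def GaplessChoice {ι : Type*} [DecidableEq ι] (b : ι → ℕ) (C : (ι → ℕ) → (ι → ℕ)) : Prop :=
  ∀ (z₁ z₂ z₃ : ι → ℕ) (a c₁ c₂ c₃ : ι),
    Acceptable b C z₁ → Acceptable b C z₂ → Acceptable b C z₃ →
    StrictPref C z₁ z₂ → StrictPref C z₂ z₃ →
    IsTandem b C z₁ a c₁ → IsTandem b C z₂ a c₂ → IsTandem b C z₃ a c₃ →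
    c₁ = c₃ → c₁ = c₂

/-! ### The stable g-allocation model -/

/-- An instance of the model: a finite bipartite graph with edge set `E` between workers `W`
and firms `F`, capacities, quotas of the workers, linear orders of the workers (greater
means more preferred) and choice functions of the firms. -/
structure SGAM (W F E : Type*) [Fintype E] [DecidableEq W] [DecidableEq F] where
  worker : E → W
  firm : E → F
  cap : E → ℕ
  quota : W → ℕ
  pref : ∀ w : W, LinearOrder {e : E // worker e = w}
  choice : ∀ f : F, ({e : E // firm e = f} → ℕ) → ({e : E // firm e = f} → ℕ)
  choice_spec : ∀ f : F, IsChoiceFunction (fun e : {e : E // firm e = f} => cap e) (choice f)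

namespace SGAM

section

variable {W F E : Type*} [Fintype E] [DecidableEq W] [DecidableEq F] [DecidableEq E]
  (M : SGAM W F E)

/-- The edges at the worker `w`. -/
abbrev EdgesW (w : W) : Type _ := {e : E // M.worker e = w}

/-- The edges at the firm `f`. -/
abbrev EdgesF (f : F) : Type _ := {e : E // M.firm e = f}

/-- The restriction of `x` to the edges at the worker `w`. -/
def resW (x : E → ℕ) (w : W) : M.EdgesW w → ℕ := fun e => x e

/-- The restriction of `x` to the edges at the firm `f`. -/
def resF (x : E → ℕ) (f : F) : M.EdgesF f → ℕ := fun e => x e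

/-- The choice function of the worker `w`. -/
def choiceW (w : W) : (M.EdgesW w → ℕ) → (M.EdgesW w → ℕ) :=
  linearChoice (M.pref w) (M.quota w)

/-- All choice functions of the firms are gapless. -/
def Gapless : Prop := ∀ f : F, GaplessChoice (M.resF M.cap f) (M.choice f)

/-- `x` is a g-allocation. -/
def IsGAllocation (x : E → ℕ) : Prop :=
  (∀ w, Acceptable (M.resW M.cap w) (M.choiceW w) (M.resW x w)) ∧
  (∀ f, Acceptable (M.resF M.cap f) (M.choice f) (M.resF x f))

/-- The edge `e` is interesting for its worker under `x`. -/
def InterestingW (x : E → ℕ) (e : E) : Prop :=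
  Interesting (M.resW M.cap (M.worker e)) (M.choiceW (M.worker e)) (M.resW x (M.worker e))
    ⟨e, rfl⟩

/-- The edge `e` is interesting for its firm under `x`. -/
def InterestingF (x : E → ℕ) (e : E) : Prop :=
  Interesting (M.resF M.cap (M.firm e)) (M.choice (M.firm e)) (M.resF x (M.firm e)) ⟨e, rfl⟩

/-- `x` is a stable g-allocation: no edge is blocking. -/
def IsStable (x : E → ℕ) : Prop :=
  M.IsGAllocation x ∧ ∀ e, ¬ (M.InterestingW x e ∧ M.InterestingF x e)

/-- The set `𝒮` of stable g-allocations (as a type that carries no order of its own). -/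
structure Stable where
  val : E → ℕ
  isStable : M.IsStable val

/-- The (weak) common preference `⪯_F` of the firms. -/
def leF (x y : E → ℕ) : Prop := ∀ f, WeakPref (M.choice f) (M.resF x f) (M.resF y f)

/-- `x` is `x^min`, the least element of `(𝒮, ⪯_F)`. -/
def IsXMin (x : M.Stable) : Prop := ∀ y : M.Stable, M.leF x.val y.val

/-- `x` is `x^max`, the greatest element of `(𝒮, ⪯_F)`. -/
def IsXMax (x : M.Stable) : Prop := ∀ y : M.Stable, M.leF y.val x.val

/-! ### Active graph and rotations -/

/-- The worker `w` is fully filled by `x`. -/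
def FullyFilled (x : E → ℕ) (w : W) : Prop := ∑ e, M.resW x w e = M.quota w

/-- `l` is the last (least preferred by `w`) edge of the support of `x` at `w`. -/
def IsLast (x : E → ℕ) (w : W) (l : M.EdgesW w) : Prop :=
  0 < x l ∧ ∀ e : M.EdgesW w, 0 < x e → (M.pref w).le l e

/-- The edge `e` at `w` is not better for `w` than the last edge of the support, and it is
interesting for its firm. -/
def IsCandidate (x : E → ℕ) (w : W) (e : M.EdgesW w) : Prop :=
  (∃ l, M.IsLast x w l ∧ (M.pref w).le e l) ∧ M.InterestingF x e

/-- The edge `a` is `W`-admissible for `x`: its worker is fully filled and `a` is the most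
preferred candidate at this worker. -/
def WAdmissible (x : E → ℕ) (a : E) : Prop :=
  M.FullyFilled x (M.worker a) ∧ M.IsCandidate x (M.worker a) ⟨a, rfl⟩ ∧
    ∀ e, M.IsCandidate x (M.worker a) e → (M.pref (M.worker a)).le e ⟨a, rfl⟩

/-- `(a, c)` is a tandem for `x`: `a` is `W`-admissible, and `c` is the `F`-admissible edge
associated with it. -/
def Tandem (x : E → ℕ) (a c : E) : Prop :=
  M.WAdmissible x a ∧ ∃ h : M.firm c = M.firm a,
    IsTandem (M.resF M.cap (M.firm a)) (M.choice (M.firm a)) (M.resF x (M.firm a))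
      ⟨a, rfl⟩ ⟨c, h⟩

/-- The `W`-admissible edges deleted by the cleaning procedure.  The edge `a` leaving the
worker `w` is deleted as soon as no `F`-admissible edge `c` entering `w` is left; and `c`
disappears as soon as all `W`-admissible edges `a'` that form a tandem with it are deleted. -/
inductive Deleted (x : E → ℕ) : E → Prop
  | delete (a : E) (ha : M.WAdmissible x a)
      (h : ∀ a' c, M.Tandem x a' c → M.worker c = M.worker a → Deleted x a') : Deleted x a

/-- `(a, c)` is a tandem in the active graph `Γ(x)`.  Its positive edge `a` goes from worker
to firm, its negative edge `c` goes from firm to worker. -/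
def ActiveTandem (x : E → ℕ) (a c : E) : Prop := M.Tandem x a c ∧ ¬ M.Deleted x a

/-- `L` is a rotation generated by `x`, that is `L ∈ ℒ(x)`.  The directed cycle with edges
`a₁, c₁, a₂, c₂, …, a_k, c_k` in the active graph is written as the cyclic sequence
`(a₁, c₁), …, (a_k, c_k)` of its tandems; consecutive tandems meet in a worker. -/
def IsRotation (x : E → ℕ) (L : Cycle (E × E)) : Prop :=
  L ≠ Cycle.nil ∧ L.Nodup ∧ (∀ p ∈ L, M.ActiveTandem x p.1 p.2) ∧
    L.Chain (fun p p' => M.worker p.2 = M.worker p'.1)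

/-- The set `L⁺` of positive edges of a rotation. -/
def posEdges (L : Cycle (E × E)) : Set E := {a | ∃ c, (a, c) ∈ L}

/-- The set `L⁻` of negative edges of a rotation. -/
def negEdges (L : Cycle (E × E)) : Set E := {c | ∃ a, (a, c) ∈ L}

/-- The weight `l > 0` is feasible for the rotation `L` at `x`. -/
def Feasible (x : E → ℕ) (L : Cycle (E × E)) (l : ℕ) : Prop :=
  0 < l ∧ (∀ e ∈ negEdges L, l ≤ x e) ∧ (∀ e ∈ posEdges L, x e + l ≤ M.cap e) ∧
    ∀ a c, (a, c) ∈ L → ∃ h : M.firm c = M.firm a,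
      M.choice (M.firm a) (M.resF x (M.firm a) + Pi.single ⟨a, rfl⟩ l) + Pi.single ⟨c, h⟩ l
        = M.resF x (M.firm a) + Pi.single ⟨a, rfl⟩ l

/-- `y` is obtained from `x` by shifting with the feasible weight `l` along the rotation
`L ∈ ℒ(x)`: `y = x + l χ^{L⁺} - l χ^{L⁻}`. -/
def Shift (x : M.Stable) (L : Cycle (E × E)) (l : ℕ) (y : M.Stable) : Prop :=
  M.IsRotation x.val L ∧ M.Feasible x.val L l ∧
    y.val + (negEdges L).indicator (fun _ => l)
      = x.val + (posEdges L).indicator (fun _ => l)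

/-! ### Routes and the poset of rotations -/

/-- `T`, the list of the pairs (rotation, weight) in the order of use, is a non-excessive
route from `x` to `y`: every rotation is used with the maximal weight among the feasible
ones that do not lead beyond `y`.  The route from `x` to `x` is empty. -/
inductive IsNonExcessiveRoute (y : M.Stable) : M.Stable → List (Cycle (E × E) × ℕ) → Prop
  | nil : IsNonExcessiveRoute y y []
  | cons (x x' : M.Stable) (L : Cycle (E × E)) (l : ℕ) (T : List (Cycle (E × E) × ℕ))
      (hstep : M.Shift x L l x')
      (hmax : ∀ (m : ℕ) (z : M.Stable), M.Shift x L m z → M.leF z.val y.val → m ≤ l)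
      (hT : IsNonExcessiveRoute y x' T) : IsNonExcessiveRoute y x ((L, l) :: T)

/-- A full route: a non-excessive route from `x^min` to `x^max`. -/
def IsFullRoute (T : List (Cycle (E × E) × ℕ)) : Prop :=
  ∃ x y : M.Stable, M.IsXMin x ∧ M.IsXMax y ∧ M.IsNonExcessiveRoute y x T

/-- The set `ℛ` of rotations used in full routes. -/
def rotations : Set (Cycle (E × E)) := {L | ∃ T, M.IsFullRoute T ∧ ∃ l, (L, l) ∈ T}

/-- The weight `τ_L` with which `L` is used in full routes (it does not depend on the route;
this is a part of the theorem). -/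
noncomputable def tau (L : Cycle (E × E)) : ℕ := sSup {l | ∃ T, M.IsFullRoute T ∧ (L, l) ∈ T}

/-- `L ◁ L'`: in all full routes, `L` is used earlier than `L'`. -/
def Precedes (L L' : M.rotations) : Prop :=
  ∀ T, M.IsFullRoute T → List.Sublist [L.1, L'.1] (T.map Prod.fst)

/-- `ξ` is a closed function for `(ℛ, τ, ◁)`. -/
def IsClosedFunction (ξ : M.rotations → ℕ) : Prop :=
  (∀ L, ξ L ≤ M.tau L) ∧ ∀ L L', M.Precedes L L' → 0 < ξ L' → ξ L = M.tau L

/-- The lattice of closed functions, with the pointwise order, join and meet. -/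
def closedFunctions : Sublattice (M.rotations → ℕ) where
  carrier := {ξ | M.IsClosedFunction ξ}
  supClosed' := by
    rintro ξ ⟨h1, h2⟩ η ⟨k1, k2⟩
    refine ⟨fun L => sup_le (h1 L) (k1 L), fun L L' h hpos => ?_⟩
    refine le_antisymm (sup_le (h1 L) (k1 L)) ?_
    rcases lt_sup_iff.mp hpos with hp | hp
    · exact (h2 L L' h hp).symm.le.trans le_sup_left
    · exact (k2 L L' h hp).symm.le.trans le_sup_right
  infClosed' := by
    rintro ξ ⟨h1, h2⟩ η ⟨k1, k2⟩
    refine ⟨fun L => inf_le_left.trans (h1 L), fun L L' h hpos => ?_⟩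
    have hp := lt_inf_iff.mp hpos
    exact le_antisymm (inf_le_left.trans (h1 L))
      (le_inf (h2 L L' h hp.1).symm.le (k2 L L' h hp.2).symm.le)

/-- `ξ` records the weights of the rotations used in `T`: no rotation is used twice, the
used rotations belong to `ℛ`, `ξ L` is the weight of `L` if `L` is used, and `ξ L = 0`
otherwise. -/
def Records (T : List (Cycle (E × E) × ℕ)) (ξ : M.rotations → ℕ) : Prop :=
  (T.map Prod.fst).Nodup ∧ (∀ p ∈ T, p.1 ∈ M.rotations) ∧
    ∀ L : M.rotations, (∀ l, (L.1, l) ∈ T → ξ L = l) ∧ ((∀ l, (L.1, l) ∉ T) → ξ L = 0)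

end

end SGAM

/-!
The choice functions of the firms are glued to one choice function `C` on all of `E → ℕ`, and those
of the workers to another one, `D`. A stable g-allocation is then a vector acceptable for `C` and
`D` without an entry interesting for both (`SGAM.isStable_iff`). For two such vectors,
`C (x ⊔ y) + D (x ⊔ y) = x + y` (`IsStablePair.choice_add_choice`): no entry can gain on both
sides, and size monotonicity excludes a loss. Hence the preferences of the two sides are opposite,
`C (x ⊔ y)` is the join of `x` and `y`, and `D (x ⊔ y)` is their meet.

Under a stable `x` the `W`-admissible edge at a worker is just the best edge there that is
interesting for its firm (`SGAM.wAdmissible_iff`). The cleaning procedure does not affect directed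
cycles, so a rotation is a cycle of tandems (`SGAM.isRotation_iff`). Shifting along it with weight
one gives a stable g-allocation (`SGAM.IsRotation.isStablePair_shift`), and below each stable `y`
above `x ≠ y` there is such a shift (`SGAM.exists_rotation_of_ne`): starting at a worker where the
two differ and following the tandems of the admissible edges, one stays among such workers and
eventually runs into a cycle.

These shifts with weight one are the steps of a lattice with labelled steps
(`SGAM.Gapless.stepSystem`). Its axioms are proved from the following facts.
* Different rotations at `x` have different workers, so their shifts commute, and the double shift
  is the join of the single ones (`SGAM.IsRotation.shift_of_ne`,
  `SGAM.IsRotation.shift_shift_le`).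
* The vectors at which `L` is a rotation are closed under meets (`SGAM.IsRotation.inf`), and by the
  gapless condition they form a convex set (`SGAM.IsRotation.of_between`).
* By the gapless condition again, if `L` is still a rotation after a shift along `L`, then this
  shift has not created any other rotation (`SGAM.IsRotation.of_shift`).

The rest is about such lattices. By the diamond property, each element `x` determines how often
each label is used on the way from `⊥` to `x` (`StepSystem.count`), and `x ≤ y` holds iff the counts
are ordered pointwise (`StepSystem.count_le_count_iff`). Let `p` be the least element from which
`L'` can be used for the first time. A label that is used on the way to `p`, but not completely,
could be moved to the last step before `p`, and then `L'` would be available before that step. So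
at `p` all labels are used completely or not at all (`StepSystem.count_least`). Therefore the counts
are closed functions (`StepSystem.exists_saturated`), and a minimality argument over these
elements `p` shows that all closed functions are counts (`StepSystem.exists_count_eq`).

A shift with weight `l` consists of `l` steps with the same label (`SGAM.Shift.path`). By convexity,
a rotation that a non-excessive route towards `y` has used with the maximal weight is not needed
again on the way to `y` (`SGAM.Gapless.count_eq_of_maximal`). So a non-excessive route from `x` to
`y` uses each rotation at most once, with the difference of its counts as the weight
(`SGAM.Gapless.mem_route_iff`). In particular, the weights `τ` are the counts at the greatest
element, and `ω` is the count function.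
-/

/-! ### Choice functions and revealed preference -/

section ChoiceFunction

variable {ι : Type*} {b : ι → ℕ} {C : (ι → ℕ) → (ι → ℕ)}

theorem eq_of_le_of_sum_le [Fintype ι] {z z' : ι → ℕ} (h : z ≤ z')
    (hs : ∑ e, z' e ≤ ∑ e, z e) : z = z' := by
  have h1 : ∑ e, z e = ∑ e, z' e := le_antisymm (Finset.sum_le_sum fun e _ => h e) hs
  funext e
  exact (Finset.sum_eq_sum_iff_of_le fun e _ => h e).1 h1 e (Finset.mem_univ e)

theorem add_single_le [DecidableEq ι] {z Z : ι → ℕ} {a : ι} {k : ℕ} (h : z ≤ Z)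
    (ha : z a + k ≤ Z a) : z + Pi.single a k ≤ Z := by
  intro e
  by_cases he : e = a
  · subst he; simpa using ha
  · simpa [he] using h e

theorem single_le [DecidableEq ι] {Z : ι → ℕ} {a : ι} {k : ℕ}
    (ha : k ≤ Z a) : Pi.single a k ≤ Z := by
  intro e
  by_cases he : e = a
  · subst he; simpa using ha
  · simp [he]

theorem sum_add_single [Fintype ι] [DecidableEq ι] (z : ι → ℕ) (a : ι) (k : ℕ) :
    ∑ e, (z + Pi.single a k : ι → ℕ) e = ∑ e, z e + k := by
  simp [Finset.sum_add_distrib]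

theorem IsTandem.unique [DecidableEq ι] {z : ι → ℕ} {a c c' : ι} (h : IsTandem b C z a c)
    (h' : IsTandem b C z a c') : c = c' := by
  by_contra hne
  have h1 := congrFun (h.2.2.2.trans h'.2.2.2.symm) c
  simp [hne] at h1

theorem weakPref_refl {x : ι → ℕ} (hx : Acceptable b C x) : WeakPref C x x := by
  simp [WeakPref, hx.2]

theorem weakPref_antisymm {x y : ι → ℕ} (hxy : WeakPref C x y) (hyx : WeakPref C y x) :
    x = y := by
  unfold WeakPref at *
  rw [← hxy, sup_comm, hyx]

theorem eq_of_weakPref_of_le {Z x : ι → ℕ} (hx : x ≤ Z) (hw : WeakPref C Z x) : C Z = x := by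
  unfold WeakPref at hw
  rwa [sup_eq_left.2 hx] at hw

theorem lt_cap_of_interesting {z : ι → ℕ} {e : ι} (hI : Interesting b C z e) : z e < b e := by
  obtain ⟨z', hb, hlt, -, -⟩ := hI
  exact hlt.trans_le (hb e)

theorem interesting_of_apply [DecidableEq ι] {z : ι → ℕ} {e : ι} (he : z e < b e) (hz : z ≤ b)
    (hch : z e < C (z + Pi.single e 1) e) : Interesting b C z e :=
  ⟨z + Pi.single e 1, add_single_le hz he, by simp, fun e' he' => by simp [he'], hch⟩

theorem tandem_interesting [DecidableEq ι] {z : ι → ℕ} (hz : z ≤ b) {a c : ι}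
    (ht : IsTandem b C z a c) :
    Interesting b C z a := by
  refine interesting_of_apply ht.1 hz ?_
  have := congrFun ht.2.2.2 a
  simp [ht.2.2.1.symm] at this
  omega

theorem sum_choice_of_tandem [Fintype ι] [DecidableEq ι] {y : ι → ℕ} {a c : ι}
    (ht : IsTandem b C y a c) :
    ∑ e, C (y + Pi.single a 1) e = ∑ e, y e := by
  have := congrArg (fun z => ∑ e, z e) ht.2.2.2
  simp only [sum_add_single] at this
  omega

namespace IsChoiceFunction

variable [Fintype ι] (h : IsChoiceFunction b C)
include h

theorem le_cap {z : ι → ℕ} (hz : z ≤ b) : C z ≤ b := (h.choice_le z hz).trans hz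

theorem idem {z : ι → ℕ} (hz : z ≤ b) : C (C z) = C z :=
  h.consistence z (C z) hz (h.choice_le z hz) le_rfl

theorem acceptable {z : ι → ℕ} (hz : z ≤ b) : Acceptable b C (C z) :=
  ⟨h.le_cap hz, h.idem hz⟩

theorem choice_apply_le {z Z : ι → ℕ} (hZ : Z ≤ b) (hz : z ≤ Z) {e : ι} (he : Z e ≤ z e) :
    C Z e ≤ C z e := by
  have h1 := h.substitutability Z z hZ hz e
  have h2 : C Z e ≤ Z e := h.choice_le Z hZ e
  simp only [Pi.inf_apply] at h1
  omega

theorem min_le_choice {z Z : ι → ℕ} (hZ : Z ≤ b) (hz : z ≤ Z) (e : ι) :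
    min (C Z e) (z e) ≤ C z e := h.substitutability Z z hZ hz e

/-- Path independence: parts of a family may be replaced by what is chosen from them. -/
theorem choice_sup {z z' : ι → ℕ} (hz : z ≤ b) (hz' : z' ≤ b) :
    C (z ⊔ z') = C (C z ⊔ z') := by
  refine (h.consistence _ _ (sup_le hz hz') (sup_le_sup_right (h.choice_le z hz) _) ?_).symm
  intro e
  have h1 := h.min_le_choice (sup_le hz hz') (le_sup_left : z ≤ z ⊔ z') e
  have h2 := h.choice_le _ (sup_le hz hz') e
  simp only [Pi.sup_apply] at *
  omega

theorem weakPref_of_le {Z Z' x : ι → ℕ} (hZ : Z ≤ b) (hx : x ≤ b) (hle : Z' ≤ Z)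
    (hw : WeakPref C Z x) : WeakPref C Z' x := by
  have : C (Z' ⊔ x) = C (Z ⊔ x) := h.consistence _ _ (sup_le hZ hx)
    (sup_le_sup_right hle _) (by rw [show C (Z ⊔ x) = x from hw]; exact le_sup_right)
  exact this.trans hw

theorem weakPref_sup {Z Z' x : ι → ℕ} (hZ : Z ≤ b) (hZ' : Z' ≤ b) (hx : x ≤ b)
    (hw : WeakPref C Z x) (hw' : WeakPref C Z' x) : WeakPref C (Z ⊔ Z') x := by
  unfold WeakPref at *
  rw [sup_comm Z, sup_assoc, sup_comm, h.choice_sup (sup_le hZ hx) hZ', hw, sup_comm, hw']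

theorem weakPref_trans {Z x y : ι → ℕ} (hZ : Z ≤ b) (hx : x ≤ b) (hy : y ≤ b)
    (hw : WeakPref C Z x) (hw' : WeakPref C x y) : WeakPref C Z y := by
  have h1 : WeakPref C (Z ⊔ x) y := by
    unfold WeakPref at *
    rw [h.choice_sup (sup_le hZ hx) hy, hw, hw']
  exact h.weakPref_of_le (sup_le hZ hx) hy le_sup_left h1

theorem weakPref_choice {Z : ι → ℕ} (hZ : Z ≤ b) : WeakPref C Z (C Z) := by
  unfold WeakPref
  rw [sup_eq_left.2 (h.choice_le Z hZ)]

/-- If every unit of `γ` is rejected already from a part of `u + α`, then it is rejected from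
`u + α`, by substitutability; size monotonicity forbids further rejections. So the
replacements are performed exactly. -/
theorem choice_add_eq {u α γ : ι → ℕ} (hu : Acceptable b C u) (hα : u + α ≤ b)
    (hsum : ∑ e, α e ≤ ∑ e, γ e)
    (hγ : ∀ e, 0 < γ e → ∃ Z, Z ≤ u + α ∧ u e ≤ Z e ∧ C Z e + γ e ≤ u e) :
    C (u + α) + γ = u + α := by
  refine eq_of_le_of_sum_le ?_ ?_
  · intro e
    rcases Nat.eq_zero_or_pos (γ e) with h0 | h0
    · simpa [h0] using h.choice_le _ hα e
    · obtain ⟨Z, hZ, huZ, hC⟩ := hγ e h0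
      have := h.min_le_choice hα hZ e
      simp only [Pi.add_apply]
      omega
  · have := h.size_monotonicity (u + α) u hα (by intro e; simp)
    rw [hu.2] at this
    simp only [Pi.add_apply, Finset.sum_add_distrib] at *
    omega

/-- If the entries of `Y` in the support of `β` are kept entirely, then what `C` rejects from `Y`
can be discarded before `β` is inserted. -/
theorem choice_choice_add {Y β : ι → ℕ} (hY : Y + β ≤ b) (hβ : ∀ e, 0 < β e → C Y e = Y e) :
    C (C Y + β) = C (Y + β) := by
  have hYb : Y ≤ b := le_trans (by intro e; simp) hY
  have hle := h.choice_le Y hYb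
  refine h.consistence _ _ hY (add_le_add_left hle β) ?_
  intro e
  rcases Nat.eq_zero_or_pos (β e) with h0 | h0
  · have := h.choice_apply_le hY (show Y ≤ Y + β by intro e; simp) (e := e) (by simp [h0])
    simpa [h0] using this
  · have := h.choice_le _ hY e
    simp only [Pi.add_apply] at *
    rwa [hβ e h0]

/-- To reject `Z` in favour of an acceptable `x` it suffices to reject each entry of `Z`. -/
theorem weakPref_of_forall [DecidableEq ι] {Z x : ι → ℕ} (hZ : Z ≤ b) (hx : Acceptable b C x)
    (hw : ∀ e, x e < Z e → WeakPref C (Pi.single e (Z e)) x) : WeakPref C Z x := by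
  have hle : C (Z ⊔ x) ≤ x := by
    intro e
    by_cases he : x e < Z e
    · have h0 : Pi.single e (Z e) ≤ Z := single_le le_rfl
      have h1 := h.choice_apply_le (sup_le hZ hx.1) (sup_le_sup_right h0 x) (e := e) (by simp)
      rwa [hw e he] at h1
    · refine (h.choice_le _ (sup_le hZ hx.1) e).trans ?_
      simp only [Pi.sup_apply]; omega
  have h2 := h.consistence _ x (sup_le hZ hx.1) le_sup_right hle
  exact h2.symm.trans hx.2

theorem sum_choice_of_weakPref {Z x : ι → ℕ} (hZ : Z ≤ b) (hx : x ≤ b)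
    (hw : WeakPref C Z x) : ∑ e, C Z e ≤ ∑ e, x e := by
  have := h.size_monotonicity (Z ⊔ x) Z (sup_le hZ hx) le_sup_left
  rwa [hw] at this

/-- The part of `Z` that lies below a vector preferred to `Z` is chosen from `Z`. -/
theorem min_le_choice_of_weakPref {Z x : ι → ℕ} (hZ : Z ≤ b) (hx : x ≤ b)
    (hw : WeakPref C Z x) (e : ι) : min (x e) (Z e) ≤ C Z e := by
  have := h.min_le_choice (sup_le hZ hx) (le_sup_left : Z ≤ Z ⊔ x) e
  rwa [hw] at this

variable [DecidableEq ι]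

theorem interesting_iff {z : ι → ℕ} (hz : Acceptable b C z) {e : ι} :
    Interesting b C z e ↔ ¬ WeakPref C (Pi.single e (b e)) z := by
  have hs : Pi.single e (b e) ≤ b := single_le le_rfl
  constructor
  · rintro ⟨z', hb, hlt, hoff, hch⟩ hw
    have h1 : z' ≤ Pi.single e (b e) ⊔ z := by
      intro e'
      by_cases he : e' = e
      · subst he; simpa using Or.inl (hb e')
      · simp [hoff e' he]
    have h2 : z ≤ z' := by
      intro e'
      by_cases he : e' = e
      · subst he; exact hlt.le
      · exact (hoff e' he).ge
    have h3 := h.consistence _ z' (sup_le hs hz.1) h1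
      (by rw [show C (Pi.single e (b e) ⊔ z) = z from hw]; exact h2)
    rw [h3, show C (Pi.single e (b e) ⊔ z) = z from hw] at hch
    exact lt_irrefl _ hch
  · intro hw
    by_contra hI
    apply hw
    have hle : C (Pi.single e (b e) ⊔ z) ≤ z := by
      intro e'
      by_cases he : e' = e
      · subst he
        by_contra hlt
        refine hI ⟨Pi.single e' (b e') ⊔ z, sup_le hs hz.1, ?_, fun e he => by simp [he], ?_⟩
        · have h1 : _ ≤ (Pi.single e' (b e') ⊔ z : ι → ℕ) e' := h.choice_le _ (sup_le hs hz.1) e'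
          exact (not_le.1 hlt).trans_le h1
        · exact not_le.1 hlt
      · simpa [he] using h.choice_le _ (sup_le hs hz.1) e'
    exact (h.consistence _ z (sup_le hs hz.1) le_sup_right hle).symm.trans hz.2

theorem not_interesting_iff {z : ι → ℕ} (hz : Acceptable b C z) {e : ι} :
    ¬ Interesting b C z e ↔ WeakPref C (Pi.single e (b e)) z := by
  rw [h.interesting_iff hz, not_not]

/-- Fewer edges are interesting under a more preferred vector. -/
theorem interesting_anti {z y : ι → ℕ} (hz : Acceptable b C z) (hy : Acceptable b C y)
    (hzy : WeakPref C z y) {e : ι} (hI : Interesting b C y e) : Interesting b C z e := by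
  rw [h.interesting_iff hz]
  rw [h.interesting_iff hy] at hI
  exact fun hw => hI (h.weakPref_trans (single_le le_rfl) hz.1 hy.1 hw hzy)

theorem interesting_of_lt {z Z : ι → ℕ} (hz : Acceptable b C z) (hZ : Z ≤ b) (hle : z ≤ Z)
    {e : ι} (he : z e < C Z e) : Interesting b C z e := by
  rw [h.interesting_iff hz]
  intro hw
  have h1 : WeakPref C (Pi.single e (Z e)) z :=
    h.weakPref_of_le (single_le le_rfl) hz.1 (single_le (by simpa using hZ e)) hw
  have h2 : Pi.single e (Z e) ⊔ z ≤ Z := sup_le (single_le le_rfl) hle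
  have h3 := h.choice_apply_le hZ h2 (e := e) (by simp)
  rw [h1] at h3
  omega

theorem choice_apply_of_interesting {z : ι → ℕ} {e : ι}
    (hI : Interesting b C z e) : C (z + Pi.single e 1) e = z e + 1 := by
  obtain ⟨z', hb, hlt, hoff, hch⟩ := hI
  have h1 : z + Pi.single e 1 ≤ z' :=
    add_single_le (fun e' => by
      by_cases he : e' = e
      · subst he; exact hlt.le
      · exact (hoff e' he).ge) hlt
  have h2 := h.min_le_choice hb h1 e
  have h3 := h.choice_le _ (h1.trans hb) e
  simp at h2 h3
  omega

/-- An interesting edge whose insertion does not increase the size forms a tandem. -/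
theorem exists_tandem {z : ι → ℕ} (hz : Acceptable b C z) {a : ι} (hI : Interesting b C z a)
    (hs : ∑ e, C (z + Pi.single a 1) e ≤ ∑ e, z e) : ∃ c, IsTandem b C z a c := by
  have hlt := lt_cap_of_interesting hI
  have hZ : z + Pi.single a 1 ≤ b := add_single_le hz.1 hlt
  have hle := h.choice_le _ hZ
  have happ := h.choice_apply_of_interesting hI
  have hge : ∑ e, z e ≤ ∑ e, C (z + Pi.single a 1) e := by
    have := h.size_monotonicity (z + Pi.single a 1) z hZ (by simp)
    rwa [hz.2] at this
  -- the deficiency vector has sum one, hence is a unit vector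
  have hex : ∃ c, C (z + Pi.single a 1) c < (z + Pi.single a 1 : ι → ℕ) c := by
    by_contra hno
    push Not at hno
    have h1 : C (z + Pi.single a 1) = z + Pi.single a 1 := le_antisymm hle hno
    rw [h1, sum_add_single] at hs
    omega
  obtain ⟨c, hc⟩ := hex
  have hca : c ≠ a := by
    rintro rfl
    simp at hc; omega
  have heq : C (z + Pi.single a 1) + Pi.single c 1 = z + Pi.single a 1 := by
    refine eq_of_le_of_sum_le (add_single_le hle hc) ?_
    rw [sum_add_single, sum_add_single]; omega
  refine ⟨c, hlt, ?_, hca, heq⟩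
  simp [hca] at hc
  omega

/-- If `a` has a tandem at `y`, then the result of inserting `a` into `y` is preferred to inserting
`a` into a less preferred `m`. -/
theorem tandem_of_weakPref {m y : ι → ℕ} (hm : Acceptable b C m) (hy : Acceptable b C y)
    (hmy : WeakPref C m y) {a c : ι} (ht : IsTandem b C y a c) :
    m a ≤ y a ∧ WeakPref C (m + Pi.single a 1) (C (y + Pi.single a 1)) := by
  have hI := tandem_interesting hy.1 ht
  have hyb : y + Pi.single a 1 ≤ b := add_single_le hy.1 ht.1
  have hma : m a ≤ y a := by
    by_contra hlt
    have h1 : y + Pi.single a 1 ≤ m ⊔ y := add_single_le le_sup_right (by simp; omega)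
    have h2 := h.consistence _ _ (sup_le hm.1 hy.1) h1 (by
      rw [show C (m ⊔ y) = y from hmy]; intro e; simp)
    have h3 := h.choice_apply_of_interesting hI
    rw [h2, show C (m ⊔ y) = y from hmy] at h3
    omega
  refine ⟨hma, ?_⟩
  have h1 : WeakPref C (y + Pi.single a 1) (C (y + Pi.single a 1)) := h.weakPref_choice hyb
  have h2 : WeakPref C y (C (y + Pi.single a 1)) :=
    h.weakPref_of_le hyb (h.le_cap hyb) (by intro e; simp) h1
  have h3 : WeakPref C (m ⊔ (y + Pi.single a 1)) (C (y + Pi.single a 1)) :=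
    h.weakPref_sup hm.1 hyb (h.le_cap hyb)
      (h.weakPref_trans hm.1 hy.1 (h.le_cap hyb) hmy h2) h1
  exact h.weakPref_of_le (sup_le hm.1 hyb) (h.le_cap hyb)
    (add_single_le le_sup_left (by simp; omega)) h3

/-- An edge that has a tandem at `y` has one at each less preferred `m` of the same size, because
size monotonicity keeps the insertion into `m` from increasing the size. -/
theorem exists_tandem_of_weakPref {m y : ι → ℕ} (hm : Acceptable b C m)
    (hy : Acceptable b C y) (hmy : WeakPref C m y) (hs : ∑ e, y e ≤ ∑ e, m e) {a c : ι}
    (ht : IsTandem b C y a c) : ∃ c', IsTandem b C m a c' := by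
  have hI := h.interesting_anti hm hy hmy (tandem_interesting hy.1 ht)
  have hmb : m + Pi.single a 1 ≤ b := add_single_le hm.1 (lt_cap_of_interesting hI)
  have hyb : y + Pi.single a 1 ≤ b := add_single_le hy.1 ht.1
  refine h.exists_tandem hm hI ?_
  have := h.sum_choice_of_weakPref hmb (h.le_cap hyb) (h.tandem_of_weakPref hm hy hmy ht).2
  rw [sum_choice_of_tandem ht] at this
  exact this.trans hs

/-- Two tandems with distinct entries do not interfere. -/
theorem tandem_tandem {u : ι → ℕ} (hu : Acceptable b C u) {a c a₁ c₁ : ι}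
    (ht : IsTandem b C u a c) (ht₁ : IsTandem b C u a₁ c₁) (ha : a ≠ a₁) (hc : c ≠ c₁) :
    IsTandem b C (C (u + Pi.single a₁ 1)) a c := by
  have hub : u + Pi.single a₁ 1 ≤ b := add_single_le hu.1 ht₁.1
  have hub' : u + (Pi.single a₁ 1 + Pi.single a 1) ≤ b := by
    rw [← add_assoc]
    exact add_single_le hub (by simpa [ha] using ht.1)
  have e1 := ht.2.2.2
  have e2 := ht₁.2.2.2
  have key : C (u + (Pi.single a₁ 1 + Pi.single a 1)) + (Pi.single c₁ 1 + Pi.single c 1)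
      = u + (Pi.single a₁ 1 + Pi.single a 1) := by
    refine h.choice_add_eq hu hub' (by simp [Finset.sum_add_distrib]) ?_
    intro e he
    by_cases h1 : e = c
    · subst h1
      refine ⟨u + Pi.single a 1, ?_, by simp, ?_⟩
      · intro e'; simp only [Pi.add_apply]; omega
      · have := congrFun e1 e
        simp [ht.2.2.1] at this
        simp [hc]; omega
    · by_cases h2 : e = c₁
      · subst h2
        refine ⟨u + Pi.single a₁ 1, ?_, by simp, ?_⟩
        · intro e'; simp only [Pi.add_apply]; omega
        · have := congrFun e2 e
          simp [ht₁.2.2.1] at this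
          simp [h1]; omega
      · simp [h1, h2] at he
  have hca₁ : c ≠ a₁ := by
    intro hca
    have h1 := h.choice_apply_le hub' (z := u + Pi.single a 1)
      (by intro e'; simp only [Pi.add_apply]; omega) (e := c)
    have h2 := h.min_le_choice hub' (z := u + Pi.single a 1)
      (by intro e'; simp only [Pi.add_apply]; omega) c
    have h3 := congrFun key c
    have h4 := congrFun e1 c
    subst hca
    simp [ht.2.2.1, hc] at h2 h3 h4
    omega
  have hac₁ : a ≠ c₁ := by
    intro hac
    have h2 := h.min_le_choice hub' (z := u + Pi.single a₁ 1)
      (by intro e'; simp only [Pi.add_apply]; omega) c₁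
    have h3 := congrFun key c₁
    have h4 := congrFun e2 c₁
    subst hac
    simp [ht₁.2.2.1, hc.symm] at h2 h3 h4
    omega
  have e3 : C (C (u + Pi.single a₁ 1) + Pi.single a 1)
      = C (u + (Pi.single a₁ 1 + Pi.single a 1)) := by
    rw [← add_assoc]
    refine h.choice_choice_add (by rwa [add_assoc]) ?_
    intro e he
    have : e = a := by
      by_contra hne; simp [hne] at he
    subst this
    have := congrFun e2 e
    simpa [hac₁] using this
  refine ⟨?_, ?_, ht.2.2.1, ?_⟩
  · have := congrFun e2 a
    simp [hac₁, ha] at this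
    rw [this]; exact ht.1
  · have := congrFun e2 c
    simp [hc, hca₁] at this
    rw [this]; exact ht.2.1
  · rw [e3]
    have h5 : C (u + (Pi.single a₁ 1 + Pi.single a 1)) + Pi.single c 1 + Pi.single c₁ 1
        = C (u + Pi.single a₁ 1) + Pi.single a 1 + Pi.single c₁ 1 := by
      rw [add_assoc, add_comm (Pi.single c 1), key, add_right_comm, e2, add_assoc]
    exact add_right_cancel h5

end IsChoiceFunction

end ChoiceFunction

/-! ### Stability for a pair of choice functions -/

section StablePair

/-- Stability of `x` for two choice functions on the same box, one for each side of a market: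
`x` is acceptable for both, and no entry is interesting for both. -/
def IsStablePair {ι : Type*} (b : ι → ℕ) (C D : (ι → ℕ) → (ι → ℕ)) (x : ι → ℕ) : Prop :=
  Acceptable b C x ∧ Acceptable b D x ∧ ∀ e, ¬ (Interesting b C x e ∧ Interesting b D x e)

variable {ι : Type*} {b : ι → ℕ} {C D : (ι → ℕ) → (ι → ℕ)}

theorem IsStablePair.symm {x : ι → ℕ} (hx : IsStablePair b C D x) : IsStablePair b D C x :=
  ⟨hx.2.1, hx.1, fun e he => hx.2.2 e he.symm⟩

theorem IsStablePair.sum_le_choice [Fintype ι] (hC : IsChoiceFunction b C) {x y : ι → ℕ}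
    (hx : IsStablePair b C D x) (hy : IsStablePair b C D y) :
    ∑ e, x e ≤ ∑ e, C (x ⊔ y) e ∧ ∑ e, y e ≤ ∑ e, C (x ⊔ y) e := by
  have hb := sup_le hx.1.1 hy.1.1
  have h1 := hC.size_monotonicity _ x hb le_sup_left
  have h2 := hC.size_monotonicity _ y hb le_sup_right
  rw [hx.1.2] at h1
  rw [hy.1.2] at h2
  exact ⟨h1, h2⟩

variable [Fintype ι] [DecidableEq ι]

namespace IsStablePair

variable (hC : IsChoiceFunction b C) (hD : IsChoiceFunction b D) {x y : ι → ℕ}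
  (hx : IsStablePair b C D x) (hy : IsStablePair b C D y)
include hC hD hx hy

/-- An entry at which both sides choose more than the minimum would be blocking. -/
theorem choice_add_choice_le : C (x ⊔ y) + D (x ⊔ y) ≤ x + y := by
  intro e
  have hb := sup_le hx.1.1 hy.1.1
  have h1 : C (x ⊔ y) e ≤ (x ⊔ y) e := hC.choice_le _ hb e
  have h2 : D (x ⊔ y) e ≤ (x ⊔ y) e := hD.choice_le _ hb e
  have h3 : ¬ (x e < C (x ⊔ y) e ∧ x e < D (x ⊔ y) e) := fun hh =>
    hx.2.2 e ⟨hC.interesting_of_lt hx.1 hb le_sup_left hh.1,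
      hD.interesting_of_lt hx.2.1 hb le_sup_left hh.2⟩
  have h4 : ¬ (y e < C (x ⊔ y) e ∧ y e < D (x ⊔ y) e) := fun hh =>
    hy.2.2 e ⟨hC.interesting_of_lt hy.1 hb le_sup_right hh.1,
      hD.interesting_of_lt hy.2.1 hb le_sup_right hh.2⟩
  simp only [Pi.sup_apply, Pi.add_apply] at *
  omega

/-- All stable vectors have the same size. -/
theorem sum_eq : ∑ e, x e = ∑ e, y e := by
  have h1 := Finset.sum_le_sum fun e (_ : e ∈ Finset.univ) =>
    choice_add_choice_le hC hD hx hy e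
  have h2 := sum_le_choice hC hx hy
  have h3 := sum_le_choice hD hx.symm hy.symm
  simp only [Pi.add_apply, Finset.sum_add_distrib] at h1
  omega

theorem choice_add_choice : C (x ⊔ y) + D (x ⊔ y) = x + y := by
  refine eq_of_le_of_sum_le (choice_add_choice_le hC hD hx hy) ?_
  have h2 := sum_le_choice hC hx hy
  have h3 := sum_le_choice hD hx.symm hy.symm
  simp only [Pi.add_apply, Finset.sum_add_distrib]
  omega

theorem sum_choice : ∑ e, D (x ⊔ y) e = ∑ e, x e := by
  have h1 := congrArg (fun z => ∑ e, z e) (choice_add_choice hC hD hx hy)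
  have h2 := sum_le_choice hC hx hy
  have h3 := sum_le_choice hD hx.symm hy.symm
  simp only [Pi.add_apply, Finset.sum_add_distrib] at h1
  omega

theorem choice_apply_eq_or (e : ι) : D (x ⊔ y) e = x e ∨ D (x ⊔ y) e = y e := by
  have hb := sup_le hx.1.1 hy.1.1
  have h1 : C (x ⊔ y) e ≤ (x ⊔ y) e := hC.choice_le _ hb e
  have h2 : D (x ⊔ y) e ≤ (x ⊔ y) e := hD.choice_le _ hb e
  have h3 : ¬ (x e < C (x ⊔ y) e ∧ x e < D (x ⊔ y) e) := fun hh =>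
    hx.2.2 e ⟨hC.interesting_of_lt hx.1 hb le_sup_left hh.1,
      hD.interesting_of_lt hx.2.1 hb le_sup_left hh.2⟩
  have h4 : ¬ (y e < C (x ⊔ y) e ∧ y e < D (x ⊔ y) e) := fun hh =>
    hy.2.2 e ⟨hC.interesting_of_lt hy.1 hb le_sup_right hh.1,
      hD.interesting_of_lt hy.2.1 hb le_sup_right hh.2⟩
  have h5 := congrFun (choice_add_choice hC hD hx hy) e
  simp only [Pi.sup_apply, Pi.add_apply] at *
  omega

/-- The vector chosen by one side from `x ⊔ y` is rejected by the other side in favour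
of `x`: it exceeds `x` only at entries that are interesting for the first side. -/
theorem weakPref_choice_left : WeakPref C (D (x ⊔ y)) x := by
  have hb := sup_le hx.1.1 hy.1.1
  refine hC.weakPref_of_forall (hD.le_cap hb) hx.1 fun e he => ?_
  have h1 := hD.interesting_of_lt hx.2.1 hb le_sup_left he
  have h2 := (hC.not_interesting_iff hx.1).1 fun h => hx.2.2 e ⟨h, h1⟩
  exact hC.weakPref_of_le (single_le le_rfl) hx.1.1
    (single_le (by simpa using hD.le_cap hb e)) h2

theorem weakPref_choice_right : WeakPref C (D (x ⊔ y)) y := by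
  rw [sup_comm]
  exact weakPref_choice_left hC hD hy hx

theorem acceptable_choice : Acceptable b C (D (x ⊔ y)) := by
  have hb := sup_le hx.1.1 hy.1.1
  refine ⟨hD.le_cap hb, le_antisymm (hC.choice_le _ (hD.le_cap hb)) fun e => ?_⟩
  have h1 := hC.min_le_choice_of_weakPref (hD.le_cap hb) hx.1.1
    (weakPref_choice_left hC hD hx hy) e
  have h2 := hC.min_le_choice_of_weakPref (hD.le_cap hb) hy.1.1
    (weakPref_choice_right hC hD hx hy) e
  have h3 := choice_apply_eq_or hC hD hx hy e
  show D (x ⊔ y) e ≤ C (D (x ⊔ y)) e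
  omega

/-- What is interesting under the meet is interesting under one of the two vectors. -/
theorem interesting_or {e : ι} (he : Interesting b C (D (x ⊔ y)) e) :
    Interesting b C x e ∨ Interesting b C y e := by
  by_contra hno
  push Not at hno
  have hb := sup_le hx.1.1 hy.1.1
  have hM := acceptable_choice hC hD hx hy
  have hs : Pi.single e (b e) ≤ b := single_le le_rfl
  have h1 := hC.weakPref_sup hM.1 hs hx.1.1 (weakPref_choice_left hC hD hx hy)
    ((hC.not_interesting_iff hx.1).1 hno.1)
  have h2 := hC.weakPref_sup hM.1 hs hy.1.1 (weakPref_choice_right hC hD hx hy)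
    ((hC.not_interesting_iff hy.1).1 hno.2)
  have hZ := sup_le hM.1 hs
  refine (hC.interesting_iff hM).1 he ?_
  rw [WeakPref, sup_comm]
  refine (eq_of_le_of_sum_le ?_ ?_).symm
  · intro e'
    have h3 := hC.min_le_choice_of_weakPref hZ hx.1.1 h1 e'
    have h4 := hC.min_le_choice_of_weakPref hZ hy.1.1 h2 e'
    have h5 := choice_apply_eq_or hC hD hx hy e'
    simp only [Pi.sup_apply] at *
    omega
  · have h6 := hC.sum_choice_of_weakPref hZ hx.1.1 h1
    have h7 := sum_choice hC hD hx hy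
    omega

theorem isStablePair_choice : IsStablePair b C D (D (x ⊔ y)) := by
  have hb := sup_le hx.1.1 hy.1.1
  have hM := hD.acceptable hb
  refine ⟨acceptable_choice hC hD hx hy, hM, fun e he => ?_⟩
  have hw := hD.weakPref_choice hb
  rcases interesting_or hC hD hx hy he.1 with h1 | h1
  · exact hx.2.2 e ⟨h1, hD.interesting_anti hx.2.1 hM
      (hD.weakPref_of_le hb hM.1 le_sup_left hw) he.2⟩
  · exact hy.2.2 e ⟨h1, hD.interesting_anti hy.2.1 hM
      (hD.weakPref_of_le hb hM.1 le_sup_right hw) he.2⟩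

/-- The preferences of the two sides are opposite. -/
theorem weakPref_polar (hxy : WeakPref C x y) : WeakPref D y x := by
  have h1 := choice_add_choice hC hD hx hy
  rw [show C (x ⊔ y) = y from hxy, add_comm] at h1
  rw [WeakPref, sup_comm]
  exact add_right_cancel h1

theorem weakPref_inf {z : ι → ℕ} (hz : IsStablePair b C D z) (hzx : WeakPref C z x)
    (hzy : WeakPref C z y) : WeakPref C z (D (x ⊔ y)) := by
  have hb := sup_le hx.1.1 hy.1.1
  have h1 := weakPref_polar hC hD hz hx hzx
  have h2 := weakPref_polar hC hD hz hy hzy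
  have h3 := hD.weakPref_sup hx.1.1 hy.1.1 hz.1.1 h1 h2
  have h4 := hD.weakPref_of_le hb hz.1.1 (hD.choice_le _ hb) h3
  exact weakPref_polar hD hC (isStablePair_choice hC hD hx hy).symm hz.symm h4

end IsStablePair

/-- Deferred acceptance: `B` are the capacities still open to the proposing side `D`, and `A`
collects the proposals made so far. -/
theorem exists_isStablePair (hC : IsChoiceFunction b C) (hD : IsChoiceFunction b D) :
    ∃ x, IsStablePair b C D x := by
  have key : ∀ (n : ℕ) (B A : ι → ℕ), ∑ e, B e = n → B ≤ b → A ≤ b → C A ≤ D B →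
      (∀ e, B e < b e → B e < A e) → ∃ x, IsStablePair b C D x := by
    intro n
    induction n using Nat.strong_induction_on with
    | _ n ih =>
      intro B A hn hB hA hCA hBA
      have hDB := hD.le_cap hB
      have hA' : A ⊔ D B ≤ b := sup_le hA hDB
      have hCA' : C (A ⊔ D B) = C (D B) := by
        rw [hC.choice_sup hA hDB, sup_eq_right.2 hCA]
      by_cases hfix : C (D B) = D B
      · refine ⟨D B, ⟨hDB, hfix⟩, hD.acceptable hB, ?_⟩
        rintro e ⟨h1, h2⟩
        have hlt := lt_cap_of_interesting h1
        have hle : D B e ≤ B e := hD.choice_le B hB e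
        rcases hle.lt_or_eq with h3 | h3
        · have h4 : D B + Pi.single e 1 ≤ B := add_single_le (hD.choice_le B hB) h3
          have h5 := hD.consistence B _ hB h4 (by intro e'; simp)
          have h6 := hD.choice_apply_of_interesting h2
          rw [h5] at h6
          omega
        · have h4 : D B + Pi.single e 1 ≤ A ⊔ D B :=
            add_single_le le_sup_right (by
              have := hBA e (h3 ▸ hlt)
              simp only [Pi.sup_apply]; omega)
          have h5 := hC.consistence _ _ hA' h4 (by
            rw [hCA', hfix]; intro e'; simp)
          have h6 := hC.choice_apply_of_interesting h1
          rw [h5, hCA', hfix] at h6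
          omega
      · -- the rejected proposals are withdrawn from the open capacities
        set B' : ι → ℕ := fun e => if C (D B) e < D B e then C (D B) e else B e with hB'def
        have hCD : ∀ e, C (D B) e ≤ D B e := hC.choice_le _ hDB
        have hDBe : ∀ e, D B e ≤ B e := hD.choice_le B hB
        have hB'B : B' ≤ B := by
          intro e
          have h1 := hCD e
          have h2 := hDBe e
          simp only [hB'def]
          split_ifs <;> omega
        obtain ⟨e₀, he₀⟩ : ∃ e, C (D B) e < D B e := by
          by_contra hno
          push Not at hno
          exact hfix (le_antisymm hCD hno)
        refine ih (∑ e, B' e) ?_ B' (A ⊔ D B) rfl (hB'B.trans hB) hA' ?_ ?_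
        · rw [← hn]
          refine Finset.sum_lt_sum (fun e _ => hB'B e) ⟨e₀, Finset.mem_univ _, ?_⟩
          have h2 := hDBe e₀
          simp only [hB'def, if_pos he₀]
          omega
        · rw [hCA']
          intro e
          have h1 := hCD e
          have h2 := hDBe e
          have h3 := hD.min_le_choice hB hB'B e
          show C (D B) e ≤ D B' e
          have h4 : B' e = if C (D B) e < D B e then C (D B) e else B e := rfl
          split_ifs at h4 <;> omega
        · intro e he
          have h1 := hDBe e
          have h2 := hBA e
          simp only [hB'def] at he ⊢
          simp only [Pi.sup_apply]
          split_ifs at he ⊢ <;> omega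
  have h0 : C 0 = 0 := le_antisymm (hC.choice_le 0 (zero_le)) (zero_le)
  exact key _ b 0 rfl le_rfl (zero_le) (by rw [h0]; exact zero_le)
    fun e he => absurd he (lt_irrefl _)

end StablePair

/-! ### Gluing choice functions along a partition -/

section Glue

variable {E V : Type*} (π : E → V)
  (Cv : ∀ v, ({e : E // π e = v} → ℕ) → ({e : E // π e = v} → ℕ))

/-- The choice function on `E` that acts by `Cv v` on the fibre of `π` over `v`. -/
def glueChoice (z : E → ℕ) : E → ℕ := fun e => Cv (π e) (fun e' => z e') ⟨e, rfl⟩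

theorem glueChoice_apply (z : E → ℕ) (v : V) (e : {e : E // π e = v}) :
    glueChoice π Cv z e = Cv v (fun e' => z e') e := by
  obtain ⟨e, rfl⟩ := e
  rfl

theorem sum_eq_sum_fibre [Fintype E] [DecidableEq V] (z : E → ℕ) :
    ∑ e, z e = ∑ v ∈ Finset.univ.image π, ∑ e : {e : E // π e = v}, z e := by
  rw [← Finset.sum_fiberwise_of_maps_to (g := π) (t := Finset.univ.image π)
    (fun e _ => Finset.mem_image_of_mem _ (Finset.mem_univ e))]
  refine Finset.sum_congr rfl fun v _ => ?_
  exact Finset.sum_subtype _ (by simp) z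

theorem isChoiceFunction_glueChoice [Fintype E] [DecidableEq V] {b : E → ℕ}
    (h : ∀ v, IsChoiceFunction (fun e : {e : E // π e = v} => b e) (Cv v)) :
    IsChoiceFunction b (glueChoice π Cv) where
  choice_le z hz e := (h (π e)).choice_le _ (fun e' => hz e') ⟨e, rfl⟩
  consistence z z' hz hz' hle := by
    funext e
    refine congrFun ((h (π e)).consistence (fun e' => z e') (fun e' => z' e')
      (fun e' => hz e') (fun e' => hz' e') fun e' => ?_) ⟨e, rfl⟩
    have := hle e'
    rwa [glueChoice_apply] at this
  substitutability z z' hz hz' e :=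
    (h (π e)).substitutability (fun e' => z e') (fun e' => z' e')
      (fun e' => hz e') (fun e' => hz' e') ⟨e, rfl⟩
  size_monotonicity z z' hz hz' := by
    rw [sum_eq_sum_fibre π, sum_eq_sum_fibre π]
    refine Finset.sum_le_sum fun v _ => ?_
    simp only [glueChoice_apply]
    exact (h v).size_monotonicity (fun e' => z e') (fun e' => z' e')
      (fun e' => hz e') (fun e' => hz' e')

theorem acceptable_glueChoice_iff {b x : E → ℕ} :
    (∀ v, Acceptable (fun e : {e : E // π e = v} => b e) (Cv v) (fun e => x e)) ↔
      Acceptable b (glueChoice π Cv) x := by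
  constructor
  · intro h
    exact ⟨fun e => (h (π e)).1 ⟨e, rfl⟩, funext fun e => congrFun (h (π e)).2 ⟨e, rfl⟩⟩
  · intro h v
    refine ⟨fun e => h.1 e, funext fun e => ?_⟩
    exact (glueChoice_apply π Cv x v e).symm.trans (congrFun h.2 e)

theorem weakPref_glueChoice_iff {x y : E → ℕ} :
    (∀ v, WeakPref (Cv v) (fun e => x e) (fun e => y e)) ↔ WeakPref (glueChoice π Cv) x y := by
  constructor
  · intro h
    exact funext fun e => congrFun (h (π e)) ⟨e, rfl⟩
  · intro h v
    refine funext fun e => ?_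
    exact (glueChoice_apply π Cv _ v e).symm.trans (congrFun h e)

theorem interesting_glueChoice_iff {b x : E → ℕ} (hx : x ≤ b) (e : E) :
    Interesting (fun e' : {e' : E // π e' = π e} => b e') (Cv (π e)) (fun e' => x e') ⟨e, rfl⟩ ↔
      Interesting b (glueChoice π Cv) x e := by
  classical
  constructor
  · rintro ⟨z', hb, hlt, hoff, hch⟩
    have hz' : z' = fun e' : {e' : E // π e' = π e} =>
        (if h : π e' = π e then z' ⟨e', h⟩ else x e' : ℕ) := by
      funext e'
      simp [e'.2]
    refine ⟨fun e' => if h : π e' = π e then z' ⟨e', h⟩ else x e', ?_, ?_, ?_, ?_⟩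
    · intro e'
      dsimp only
      split_ifs with h
      · exact hb ⟨e', h⟩
      · exact hx e'
    · simpa using hlt
    · intro e' he'
      dsimp only
      split_ifs with h
      · exact hoff ⟨e', h⟩ (by simpa using he')
      · rfl
    · have := hch
      rw [hz'] at this
      exact this
  · rintro ⟨z', hb, hlt, hoff, hch⟩
    exact ⟨fun e' => z' e', fun e' => hb e', hlt,
      fun e' he' => hoff e' (fun h => he' (Subtype.ext h)), hch⟩

theorem choice_add_single_glueChoice_iff [DecidableEq E] {x : E → ℕ} {v : V}
    (hx : glueChoice π Cv x = x) (a c : {e : E // π e = v}) (l : ℕ) :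
    Cv v ((fun e : {e : E // π e = v} => x e) + Pi.single a l) + Pi.single c l
        = (fun e : {e : E // π e = v} => x e) + Pi.single a l ↔
      glueChoice π Cv (x + Pi.single (a : E) l) + Pi.single (c : E) l
        = x + Pi.single (a : E) l := by
  have hs : ∀ (d e : {e : E // π e = v}), (Pi.single (d : E) l : E → ℕ) e
      = (Pi.single d l : {e : E // π e = v} → ℕ) e := by
    intro d e
    by_cases h : e = d
    · subst h; simp
    · have : (e : E) ≠ d := fun h' => h (Subtype.ext h')
      simp [h, this]
  have hs' : (fun e : {e : E // π e = v} => (x + Pi.single (a : E) l : E → ℕ) e)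
      = (fun e : {e : E // π e = v} => x e) + Pi.single a l := by
    funext e
    simp [hs]
  constructor
  · intro h
    funext e
    by_cases he : π e = v
    · have h1 := congrFun h ⟨e, he⟩
      rw [← hs'] at h1
      have h2 := glueChoice_apply π Cv (x + Pi.single (a : E) l) v ⟨e, he⟩
      simp only [Pi.add_apply] at h1 h2 ⊢
      rw [h2, hs c ⟨e, he⟩, h1]
    · have ha : e ≠ a := by rintro rfl; exact he a.2
      have hc : e ≠ c := by rintro rfl; exact he c.2
      have h3 : (fun e' : {e' : E // π e' = π e} => (x + Pi.single (a : E) l : E → ℕ) e')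
          = fun e' : {e' : E // π e' = π e} => x e' := by
        funext e'
        have : (e' : E) ≠ a := by
          intro h'
          exact he (e'.2.symm.trans (h' ▸ a.2))
        simp [this]
      have h4 : glueChoice π Cv (x + Pi.single (a : E) l) e = x e := by
        have h5 := congrFun hx e
        unfold glueChoice at h5 ⊢
        rw [h3]; exact h5
      simp [ha, hc, h4]
  · intro h
    funext e
    have h1 := congrFun h e
    have h2 := glueChoice_apply π Cv (x + Pi.single (a : E) l) v e
    rw [hs'] at h2
    simp only [Pi.add_apply] at h1 h2 ⊢
    rw [← hs c e, ← h2, h1, hs a e]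

/-- A replacement by the glued choice function takes place within one fibre. -/
theorem glueChoice_same_fibre [DecidableEq E] {x : E → ℕ} {a c : E} {l : ℕ} (hl : 0 < l)
    (hx : glueChoice π Cv x = x)
    (h : glueChoice π Cv (x + Pi.single a l) + Pi.single c l = x + Pi.single a l) :
    π c = π a := by
  by_contra hne
  have h3 : (fun e' : {e' : E // π e' = π c} => (x + Pi.single a l : E → ℕ) e')
      = fun e' : {e' : E // π e' = π c} => x e' := by
    funext e'
    have : (e' : E) ≠ a := by
      intro h'
      exact hne (e'.2.symm.trans (h' ▸ rfl))
    simp [this]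
  have h4 : glueChoice π Cv (x + Pi.single a l) c = x c := by
    have h5 := congrFun hx c
    unfold glueChoice at h5 ⊢
    rw [h3]; exact h5
  have h6 := congrFun h c
  have hca : c ≠ a := fun h' => hne (h' ▸ rfl)
  simp [h4, hca] at h6
  omega

end Glue

/-! ### Linear choice functions -/

section Linear

variable {ι : Type*}

theorem sum_min_sub_sum (o : LinearOrder ι) (q : ℕ) (z : ι → ℕ) (s : Finset ι) :
    ∑ e ∈ s, min (z e) (q - ∑ e' ∈ s.filter (fun e' => o.lt e e'), z e')
      = min q (∑ e ∈ s, z e) := by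
  induction s using Finset.induction_on_min with
  | empty => simp
  | insert a s ha ih =>
    have hna : a ∉ s := fun h => lt_irrefl _ (ha a h)
    rw [Finset.sum_insert hna, Finset.sum_insert hna]
    have h1 : (insert a s).filter (fun e' => o.lt a e') = s := by
      ext e
      simp only [Finset.mem_filter, Finset.mem_insert]
      constructor
      · rintro ⟨rfl | h, h'⟩
        · exact absurd h' (lt_irrefl _)
        · exact h
      · exact fun h => ⟨Or.inr h, ha e h⟩
    have h2 : ∀ e ∈ s, (insert a s).filter (fun e' => o.lt e e')
        = s.filter (fun e' => o.lt e e') := by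
      intro e he
      ext e'
      simp only [Finset.mem_filter, Finset.mem_insert]
      constructor
      · rintro ⟨rfl | h, h'⟩
        · exact absurd (lt_trans h' (ha e he)) (lt_irrefl _)
        · exact ⟨h, h'⟩
      · exact fun h => ⟨Or.inr h.1, h.2⟩
    have h3 : ∑ e ∈ s, min (z e) (q - ∑ e' ∈ (insert a s).filter (fun e' => o.lt e e'), z e')
        = ∑ e ∈ s, min (z e) (q - ∑ e' ∈ s.filter (fun e' => o.lt e e'), z e') :=
      Finset.sum_congr rfl fun e he => by rw [h2 e he]
    rw [h1, h3, ih]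
    omega

variable [Fintype ι]

theorem sum_linearChoice (o : LinearOrder ι) (q : ℕ) (z : ι → ℕ) :
    ∑ e, linearChoice o q z e = min q (∑ e, z e) :=
  sum_min_sub_sum o q z Finset.univ

theorem isChoiceFunction_linearChoice (o : LinearOrder ι) (q : ℕ) (b : ι → ℕ) :
    IsChoiceFunction b (linearChoice o q) := by
  have hle : ∀ z, linearChoice o q z ≤ z := fun z e => min_le_left _ _
  have hsub : ∀ z z', z' ≤ z → linearChoice o q z ⊓ z' ≤ linearChoice o q z' := by
    intro z z' hz e
    have h1 : ∑ e' ∈ Finset.univ.filter (fun e' => o.lt e e'), z' e'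
        ≤ ∑ e' ∈ Finset.univ.filter (fun e' => o.lt e e'), z e' :=
      Finset.sum_le_sum fun e' _ => hz e'
    simp only [Pi.inf_apply, linearChoice]
    omega
  have hsize : ∀ z z' : ι → ℕ, z' ≤ z →
      ∑ e, linearChoice o q z' e ≤ ∑ e, linearChoice o q z e := by
    intro z z' hz
    rw [sum_linearChoice, sum_linearChoice]
    have : ∑ e, z' e ≤ ∑ e, z e := Finset.sum_le_sum fun e' _ => hz e'
    omega
  refine ⟨fun z _ => hle z, fun z z' _ hz hC => ?_, fun z z' _ hz => hsub z z' hz,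
    fun z z' _ hz => hsize z z' hz⟩
  refine (eq_of_le_of_sum_le ?_ (hsize z z' hz)).symm
  have := hsub z z' hz
  rwa [inf_eq_left.2 hC] at this

theorem linearChoice_eq_self_iff (o : LinearOrder ι) (q : ℕ) (z : ι → ℕ) :
    linearChoice o q z = z ↔ ∑ e, z e ≤ q := by
  constructor
  · intro h
    have := sum_linearChoice o q z
    rw [h] at this
    omega
  · intro h
    refine eq_of_le_of_sum_le (fun e => min_le_left _ _) ?_
    rw [sum_linearChoice]
    omega

theorem interesting_linearChoice_iff (o : LinearOrder ι) (q : ℕ) {b z : ι → ℕ} (hz : z ≤ b)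
    (e : ι) : Interesting b (linearChoice o q) z e ↔
      z e < b e ∧ ∑ e' ∈ Finset.univ.filter (fun e' => o.le e e'), z e' < q := by
  classical
  have hsplit : ∀ z' : ι → ℕ, (∀ e', e' ≠ e → z' e' = z e') →
      ∑ e' ∈ Finset.univ.filter (fun e' => o.le e e'), z e'
        = z e + ∑ e' ∈ Finset.univ.filter (fun e' => o.lt e e'), z' e' := by
    intro z' hz'
    have h1 : Finset.univ.filter (fun e' => o.le e e')
        = insert e (Finset.univ.filter (fun e' => o.lt e e')) := by
      ext e'
      simp only [Finset.mem_filter, Finset.mem_univ, true_and, Finset.mem_insert]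
      constructor
      · intro h
        rcases le_iff_eq_or_lt.1 h with h | h
        · exact Or.inl h.symm
        · exact Or.inr h
      · rintro (rfl | h)
        · exact le_rfl
        · exact le_of_lt h
    rw [h1, Finset.sum_insert (by simp)]
    congr 1
    refine Finset.sum_congr rfl fun e' he' => (hz' e' ?_).symm
    rintro rfl
    simp at he'
  constructor
  · rintro ⟨z', hb, hlt, hoff, hch⟩
    refine ⟨hlt.trans_le (hb e), ?_⟩
    rw [hsplit z' hoff]
    simp only [linearChoice] at hch
    omega
  · rintro ⟨h1, h2⟩
    have hoff : ∀ e', e' ≠ e → (z + Pi.single e 1 : ι → ℕ) e' = z e' := fun e' he' => by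
      simp [he']
    refine ⟨z + Pi.single e 1, add_single_le hz h1, by simp, hoff, ?_⟩
    rw [hsplit _ hoff] at h2
    have : (z + Pi.single e 1 : ι → ℕ) e = z e + 1 := by simp
    simp only [linearChoice, this]
    omega

end Linear

/-! ### Stable g-allocations as stable vectors of the two glued choice functions -/

/-- The form of the gapless condition in which consecutive vectors may coincide. -/
def WeaklyGapless {ι : Type*} [DecidableEq ι] (b : ι → ℕ) (C : (ι → ℕ) → (ι → ℕ)) : Prop :=
  ∀ (z₁ z₂ z₃ : ι → ℕ) (a c c' : ι), Acceptable b C z₁ → Acceptable b C z₂ →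
    Acceptable b C z₃ → WeakPref C z₁ z₂ → WeakPref C z₂ z₃ →
    IsTandem b C z₁ a c → IsTandem b C z₂ a c' → IsTandem b C z₃ a c → c = c'

namespace SGAM

section

variable {W F E : Type*} [Fintype E] [DecidableEq W] [DecidableEq F]
  (M : SGAM W F E)

/-- The choice functions of all firms, acting jointly on `E → ℕ`. -/
def gF : (E → ℕ) → (E → ℕ) := glueChoice M.firm M.choice

/-- The choice functions of all workers, acting jointly on `E → ℕ`. -/
def gW : (E → ℕ) → (E → ℕ) := glueChoice M.worker M.choiceW

theorem gF_spec : IsChoiceFunction M.cap M.gF :=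
  isChoiceFunction_glueChoice _ _ M.choice_spec

theorem gW_spec : IsChoiceFunction M.cap M.gW :=
  isChoiceFunction_glueChoice _ _ fun w => isChoiceFunction_linearChoice (M.pref w) _ _

theorem isGAllocation_iff {x : E → ℕ} :
    M.IsGAllocation x ↔ Acceptable M.cap M.gF x ∧ Acceptable M.cap M.gW x :=
  (and_congr (acceptable_glueChoice_iff M.worker M.choiceW)
    (acceptable_glueChoice_iff M.firm M.choice)).trans and_comm

theorem interestingF_iff {x : E → ℕ} (hx : x ≤ M.cap) (e : E) :
    M.InterestingF x e ↔ Interesting M.cap M.gF x e :=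
  interesting_glueChoice_iff M.firm M.choice hx e

theorem interestingW_iff {x : E → ℕ} (hx : x ≤ M.cap) (e : E) :
    M.InterestingW x e ↔ Interesting M.cap M.gW x e :=
  interesting_glueChoice_iff M.worker M.choiceW hx e

theorem isStable_iff {x : E → ℕ} : M.IsStable x ↔ IsStablePair M.cap M.gF M.gW x := by
  unfold IsStable IsStablePair
  rw [isGAllocation_iff, and_assoc]
  refine and_congr_right fun h1 => and_congr_right fun _ => forall_congr' fun e => ?_
  rw [M.interestingF_iff h1.1, M.interestingW_iff h1.1, and_comm]

theorem leF_iff {x y : E → ℕ} : M.leF x y ↔ WeakPref M.gF x y :=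
  weakPref_glueChoice_iff M.firm M.choice

theorem sum_gW (z : E → ℕ) (w : W) :
    ∑ e : M.EdgesW w, M.gW z e = min (M.quota w) (∑ e : M.EdgesW w, z e) := by
  have h : ∀ e : M.EdgesW w, M.gW z e = linearChoice (M.pref w) (M.quota w) (fun e => z e) e :=
    fun e => glueChoice_apply M.worker M.choiceW z w e
  simp only [h]
  exact sum_linearChoice _ _ _

theorem gW_eq_self_iff {x : E → ℕ} :
    M.gW x = x ↔ ∀ w, ∑ e : M.EdgesW w, x e ≤ M.quota w := by
  constructor
  · intro h w
    have := M.sum_gW x w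
    rw [h] at this
    omega
  · intro h
    funext e
    exact congrFun ((linearChoice_eq_self_iff (M.pref (M.worker e)) (M.quota (M.worker e))
      (fun e' => x e')).2 (h _)) ⟨e, rfl⟩

theorem interesting_gW_iff {x : E → ℕ} (hx : x ≤ M.cap) {w : W} (e : M.EdgesW w) :
    Interesting M.cap M.gW x e ↔ x e < M.cap e ∧
      ∑ e' ∈ Finset.univ.filter (fun e' => (M.pref w).le e e'), x e' < M.quota w := by
  obtain ⟨e, rfl⟩ := e
  rw [← M.interestingW_iff hx]
  exact interesting_linearChoice_iff (M.pref (M.worker e)) (M.quota (M.worker e))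
    (b := M.resW M.cap (M.worker e)) (z := M.resW x (M.worker e)) (fun e' => hx e') ⟨e, rfl⟩

/-! ### Admissible edges -/

/-- The criterion for `W`-admissibility under a stable `x`: the edge `a` is the most preferred
edge at its worker among those interesting for their firms, and the quota is positive. Stability
forces the worker to be fully filled and all these edges to be at most as good as the last edge
of the support; the positive quota guarantees that the support is not empty. -/
def Adm (x : E → ℕ) (a : E) : Prop :=
  Interesting M.cap M.gF x a ∧
    (∀ e : M.EdgesW (M.worker a), Interesting M.cap M.gF x e →
      (M.pref (M.worker a)).le e ⟨a, rfl⟩) ∧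
    0 < M.quota (M.worker a)

variable {M} in
theorem Adm.unique {x : E → ℕ} {a a' : E} (h : M.Adm x a) (h' : M.Adm x a')
    (hw : M.worker a = M.worker a') : a = a' := by
  have h1 := h.2.1 ⟨a', hw.symm⟩ h'.1
  have h2 := h'.2.1 ⟨a, hw⟩ h.1
  have key : ∀ (w w' : W) (hw : w = w') (ha : M.worker a = w) (ha' : M.worker a' = w),
      (M.pref w').le ⟨a, ha.trans hw⟩ ⟨a', ha'.trans hw⟩ → (M.pref w).le ⟨a, ha⟩ ⟨a', ha'⟩ := by
    rintro w _ rfl ha ha' h; exact h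
  have h3 := key _ _ hw rfl hw.symm h2
  exact congrArg Subtype.val (@le_antisymm _ (M.pref (M.worker a)).toPartialOrder _ _ h3 h1)

variable {M} in
/-- If `e` is interesting for its firm under a stable `x`, then its worker has filled the quota
with edges not worse than `e`. -/
theorem quota_le_of_interesting {x : E → ℕ} (hx : IsStablePair M.cap M.gF M.gW x) {w : W}
    (e : M.EdgesW w) (he : Interesting M.cap M.gF x e) :
    M.quota w ≤ ∑ e' ∈ Finset.univ.filter (fun e' => (M.pref w).le e e'), x e' := by
  by_contra hlt
  exact hx.2.2 e ⟨he, (M.interesting_gW_iff hx.1.1 e).2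
    ⟨lt_cap_of_interesting he, not_le.1 hlt⟩⟩

variable {M} in
theorem fullyFilled_of_interesting {x : E → ℕ} (hx : IsStablePair M.cap M.gF M.gW x) {w : W}
    (e : M.EdgesW w) (he : Interesting M.cap M.gF x e) : ∑ e, x (e : M.EdgesW w) = M.quota w := by
  have h1 := quota_le_of_interesting hx e he
  have h2 := (M.gW_eq_self_iff).1 hx.2.1.2 w
  have h3 : ∑ e' ∈ Finset.univ.filter (fun e' => (M.pref w).le e e'), x e'
      ≤ ∑ e, x (e : M.EdgesW w) :=
    Finset.sum_le_sum_of_subset (Finset.filter_subset _ _)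
  omega

variable {M} in
/-- The support at the worker consists of edges not worse than an edge interesting for its
firm. -/
theorem le_of_interesting {x : E → ℕ} (hx : IsStablePair M.cap M.gF M.gW x) {w : W}
    (e : M.EdgesW w) (he : Interesting M.cap M.gF x e) (l : M.EdgesW w) (hl : 0 < x l) :
    (M.pref w).le e l := by
  classical
  by_contra hlt
  have h1 := quota_le_of_interesting hx e he
  have h2 := (M.gW_eq_self_iff).1 hx.2.1.2 w
  have h3 : ∑ e' ∈ insert l (Finset.univ.filter (fun e' => (M.pref w).le e e')), x e'
      ≤ ∑ e, x (e : M.EdgesW w) :=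
    Finset.sum_le_sum_of_subset (Finset.subset_univ _)
  rw [Finset.sum_insert (by simpa using hlt)] at h3
  omega

variable {M} in
theorem wAdmissible_iff {x : E → ℕ} (hx : IsStablePair M.cap M.gF M.gW x) {a : E} :
    M.WAdmissible x a ↔ M.Adm x a := by
  constructor
  · rintro ⟨h1, ⟨⟨l, hl, hal⟩, h2⟩, h3⟩
    refine ⟨(M.interestingF_iff hx.1.1 a).1 h2, fun e he => h3 e ⟨⟨l, hl, ?_⟩, ?_⟩, ?_⟩
    · exact le_of_interesting hx e he l hl.1
    · exact (M.interestingF_iff hx.1.1 e).2 he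
    · rw [← h1]
      exact lt_of_lt_of_le hl.1 (Finset.single_le_sum (f := fun e => M.resW x (M.worker a) e)
        (fun _ _ => Nat.zero_le _) (Finset.mem_univ l))
  · rintro ⟨h1, h2, h3⟩
    have hff : M.FullyFilled x (M.worker a) := fullyFilled_of_interesting hx ⟨a, rfl⟩ h1
    -- the last edge of the support
    obtain ⟨l, hl⟩ : ∃ l, M.IsLast x (M.worker a) l := by
      let _ := M.pref (M.worker a)
      have hne : (Finset.univ.filter fun e : M.EdgesW (M.worker a) => 0 < x e).Nonempty := by
        by_contra hemp
        rw [Finset.not_nonempty_iff_eq_empty, Finset.filter_eq_empty_iff] at hemp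
        have : ∑ e : M.EdgesW (M.worker a), x e = 0 :=
          Finset.sum_eq_zero fun e he => by simpa using hemp he
        rw [FullyFilled] at hff
        have h4 : ∑ e, M.resW x (M.worker a) e = ∑ e : M.EdgesW (M.worker a), x e := rfl
        omega
      obtain ⟨l, hl, hmin⟩ := Finset.exists_min_image _ id hne
      exact ⟨l, (Finset.mem_filter.1 hl).2,
        fun e he => hmin e (Finset.mem_filter.2 ⟨Finset.mem_univ _, he⟩)⟩
    refine ⟨hff, ⟨⟨l, hl, ?_⟩, ?_⟩, fun e he => h2 e ?_⟩
    · exact le_of_interesting hx _ h1 l hl.1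
    · exact (M.interestingF_iff hx.1.1 a).2 h1
    · exact (M.interestingF_iff hx.1.1 e).1 he.2

variable [DecidableEq E]

variable {M} in
/-- Admissibility passes to more preferred vectors as long as the edge stays
interesting for its firm. -/
theorem Adm.mono {x y : E → ℕ} {a : E} (h : M.Adm x a) (hx : Acceptable M.cap M.gF x)
    (hy : Acceptable M.cap M.gF y) (hxy : WeakPref M.gF x y)
    (ha : Interesting M.cap M.gF y a) : M.Adm y a :=
  ⟨ha, fun e he => h.2.1 e (M.gF_spec.interesting_anti hx hy hxy he), h.2.2⟩

theorem isTandem_iff {x : E → ℕ} (hx : Acceptable M.cap M.gF x) {a c : E} :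
    (∃ h : M.firm c = M.firm a, IsTandem (M.resF M.cap (M.firm a)) (M.choice (M.firm a))
      (M.resF x (M.firm a)) ⟨a, rfl⟩ ⟨c, h⟩) ↔ IsTandem M.cap M.gF x a c := by
  constructor
  · rintro ⟨h, h1, h2, h3, h4⟩
    exact ⟨h1, h2, fun hca => h3 (Subtype.ext hca),
      (choice_add_single_glueChoice_iff M.firm M.choice hx.2 ⟨a, rfl⟩ ⟨c, h⟩ 1).1 h4⟩
  · rintro ⟨h1, h2, h3, h4⟩
    have h := glueChoice_same_fibre M.firm M.choice one_pos hx.2 h4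
    exact ⟨h, h1, h2, fun hca => h3 (congrArg Subtype.val hca),
      (choice_add_single_glueChoice_iff M.firm M.choice hx.2 ⟨a, rfl⟩ ⟨c, h⟩ 1).2 h4⟩

theorem weaklyGapless (hG : M.Gapless) : WeaklyGapless M.cap M.gF := by
  intro z₁ z₂ z₃ a c c' h₁ h₂ h₃ h₁₂ h₂₃ t₁ t₂ t₃
  obtain ⟨hc, s₁⟩ := (M.isTandem_iff h₁).2 t₁
  obtain ⟨hc', s₂⟩ := (M.isTandem_iff h₂).2 t₂
  obtain ⟨hc'', s₃⟩ := (M.isTandem_iff h₃).2 t₃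
  have r₁₂ := M.leF_iff.2 h₁₂ (M.firm a)
  have r₂₃ := M.leF_iff.2 h₂₃ (M.firm a)
  have A : ∀ {z : E → ℕ}, Acceptable M.cap M.gF z →
      Acceptable (M.resF M.cap (M.firm a)) (M.choice (M.firm a)) (M.resF z (M.firm a)) :=
    fun h => (acceptable_glueChoice_iff M.firm M.choice).2 h (M.firm a)
  have key : (⟨c, hc⟩ : M.EdgesF (M.firm a)) = ⟨c', hc'⟩ := by
    by_cases e₁ : M.resF z₁ (M.firm a) = M.resF z₂ (M.firm a)
    · exact (e₁ ▸ s₁).unique s₂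
    by_cases e₂ : M.resF z₂ (M.firm a) = M.resF z₃ (M.firm a)
    · exact s₃.unique (e₂ ▸ s₂)
    exact hG (M.firm a) _ _ _ _ _ _ _ (A h₁) (A h₂) (A h₃) ⟨e₁, r₁₂⟩ ⟨e₂, r₂₃⟩ s₁ s₂ s₃ rfl
  exact congrArg Subtype.val key

variable {M} in
theorem tandem_iff {x : E → ℕ} (hx : IsStablePair M.cap M.gF M.gW x) {a c : E} :
    M.Tandem x a c ↔ M.Adm x a ∧ IsTandem M.cap M.gF x a c := by
  unfold Tandem
  rw [wAdmissible_iff hx, M.isTandem_iff hx.1]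

variable {M} in
theorem Tandem.unique {x : E → ℕ} (hx : IsStablePair M.cap M.gF M.gW x) {a c a' c' : E}
    (h : M.Tandem x a c) (h' : M.Tandem x a' c') (hw : M.worker a = M.worker a') :
    a = a' ∧ c = c' := by
  rw [tandem_iff hx] at h h'
  obtain rfl := h.1.unique h'.1 hw
  exact ⟨rfl, h.2.unique h'.2⟩

end

end SGAM

/-! ### Families of simultaneous replacements -/

section Replacement

variable {ι : Type*} [DecidableEq ι] {b : ι → ℕ} {C : (ι → ℕ) → (ι → ℕ)}

/-- The vector `∑ k(p) 1^{p.1}` of all insertions of a family `T` of pairs with weights `k`. -/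
def fstVec (T : Finset (ι × ι)) (k : ι × ι → ℕ) : ι → ℕ := ∑ p ∈ T, Pi.single p.1 (k p)

/-- The vector `∑ k(p) 1^{p.2}` of all removals of a family `T` of pairs with weights `k`. -/
def sndVec (T : Finset (ι × ι)) (k : ι × ι → ℕ) : ι → ℕ := ∑ p ∈ T, Pi.single p.2 (k p)

theorem fstVec_apply (T : Finset (ι × ι)) (k : ι × ι → ℕ) (e : ι) :
    fstVec T k e = ∑ p ∈ T, if e = p.1 then k p else 0 := by
  simp [fstVec, Finset.sum_apply, Pi.single_apply]

theorem sndVec_apply (T : Finset (ι × ι)) (k : ι × ι → ℕ) (e : ι) :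
    sndVec T k e = ∑ p ∈ T, if e = p.2 then k p else 0 := by
  simp [sndVec, Finset.sum_apply, Pi.single_apply]

theorem fstVec_of_mem {T : Finset (ι × ι)} {k : ι × ι → ℕ}
    (hinj : Set.InjOn Prod.fst (T : Set (ι × ι))) {p : ι × ι} (hp : p ∈ T) :
    fstVec T k p.1 = k p := by
  rw [fstVec_apply, Finset.sum_eq_single_of_mem p hp, if_pos rfl]
  intro q hq hne
  rw [if_neg]
  exact fun h => hne (hinj hq hp h.symm)

theorem sndVec_of_mem {T : Finset (ι × ι)} {k : ι × ι → ℕ}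
    (hinj : Set.InjOn Prod.snd (T : Set (ι × ι))) {p : ι × ι} (hp : p ∈ T) :
    sndVec T k p.2 = k p := by
  rw [sndVec_apply, Finset.sum_eq_single_of_mem p hp, if_pos rfl]
  intro q hq hne
  rw [if_neg]
  exact fun h => hne (hinj hq hp h.symm)

theorem fstVec_pos {T : Finset (ι × ι)} {k : ι × ι → ℕ} {e : ι} (h : 0 < fstVec T k e) :
    ∃ p ∈ T, p.1 = e := by
  rw [fstVec_apply] at h
  obtain ⟨p, hp, hpos⟩ := Finset.sum_pos_iff.1 h
  split_ifs at hpos with he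
  · exact ⟨p, hp, he.symm⟩
  · exact absurd hpos (lt_irrefl _)

theorem sndVec_pos {T : Finset (ι × ι)} {k : ι × ι → ℕ} {e : ι} (h : 0 < sndVec T k e) :
    ∃ p ∈ T, p.2 = e := by
  rw [sndVec_apply] at h
  obtain ⟨p, hp, hpos⟩ := Finset.sum_pos_iff.1 h
  split_ifs at hpos with he
  · exact ⟨p, hp, he.symm⟩
  · exact absurd hpos (lt_irrefl _)

theorem sum_fstVec [Fintype ι] (T : Finset (ι × ι)) (k : ι × ι → ℕ) :
    ∑ e, fstVec T k e = ∑ p ∈ T, k p := by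
  simp only [fstVec_apply]
  rw [Finset.sum_comm]
  simp

theorem sum_sndVec [Fintype ι] (T : Finset (ι × ι)) (k : ι × ι → ℕ) :
    ∑ e, sndVec T k e = ∑ p ∈ T, k p := by
  simp only [sndVec_apply]
  rw [Finset.sum_comm]
  simp

theorem fstVec_add (T : Finset (ι × ι)) (k k' : ι × ι → ℕ) :
    fstVec T (k + k') = fstVec T k + fstVec T k' := by
  simp [fstVec, Pi.single_add, Finset.sum_add_distrib]

theorem sndVec_add (T : Finset (ι × ι)) (k k' : ι × ι → ℕ) :
    sndVec T (k + k') = sndVec T k + sndVec T k' := by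
  simp [sndVec, Pi.single_add, Finset.sum_add_distrib]

theorem fstVec_single {T : Finset (ι × ι)} {p : ι × ι} (hp : p ∈ T) (l : ℕ) :
    fstVec T (Pi.single p l) = Pi.single p.1 l := by
  rw [fstVec, Finset.sum_eq_single_of_mem p hp fun q _ hq => by simp [hq]]
  simp

theorem sndVec_single {T : Finset (ι × ι)} {p : ι × ι} (hp : p ∈ T) (l : ℕ) :
    sndVec T (Pi.single p l) = Pi.single p.2 l := by
  rw [sndVec, Finset.sum_eq_single_of_mem p hp fun q _ hq => by simp [hq]]
  simp

theorem fstVec_insert {T : Finset (ι × ι)} {p : ι × ι} (hp : p ∉ T) (k : ι × ι → ℕ) :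
    fstVec (insert p T) k = Pi.single p.1 (k p) + fstVec T k := Finset.sum_insert hp

theorem sndVec_insert {T : Finset (ι × ι)} {p : ι × ι} (hp : p ∉ T) (k : ι × ι → ℕ) :
    sndVec (insert p T) k = Pi.single p.2 (k p) + sndVec T k := Finset.sum_insert hp

/-- Each pair `p` of the family `T` describes a replacement at `u` in which `k(p)` units of
`p.1` drive out `k(p)` units of `p.2`; different pairs share neither the inserted nor the removed
entry. -/
structure IsReplacementFamily (b : ι → ℕ) (C : (ι → ℕ) → (ι → ℕ)) (u : ι → ℕ)
    (T : Finset (ι × ι)) (k : ι × ι → ℕ) : Prop where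
  cap : ∀ p ∈ T, u p.1 + k p ≤ b p.1
  ne : ∀ p ∈ T, p.2 ≠ p.1
  choice : ∀ p ∈ T, C (u + Pi.single p.1 (k p)) + Pi.single p.2 (k p) = u + Pi.single p.1 (k p)
  injOn_fst : Set.InjOn Prod.fst (T : Set (ι × ι))
  injOn_snd : Set.InjOn Prod.snd (T : Set (ι × ι))

theorem isReplacementFamily_of_tandem {u : ι → ℕ} {T : Finset (ι × ι)}
    (ht : ∀ p ∈ T, IsTandem b C u p.1 p.2) (h₁ : Set.InjOn Prod.fst (T : Set (ι × ι)))
    (h₂ : Set.InjOn Prod.snd (T : Set (ι × ι))) : IsReplacementFamily b C u T 1 where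
  cap p hp := (ht p hp).1
  ne p hp := (ht p hp).2.2.1
  choice p hp := (ht p hp).2.2.2
  injOn_fst := h₁
  injOn_snd := h₂

namespace IsReplacementFamily

variable {u : ι → ℕ} {T : Finset (ι × ι)} {k : ι × ι → ℕ}

theorem mono (hT : IsReplacementFamily b C u T k) {T' : Finset (ι × ι)} (h : T' ⊆ T) :
    IsReplacementFamily b C u T' k where
  cap p hp := hT.cap p (h hp)
  ne p hp := hT.ne p (h hp)
  choice p hp := hT.choice p (h hp)
  injOn_fst := hT.injOn_fst.mono (by exact_mod_cast h)
  injOn_snd := hT.injOn_snd.mono (by exact_mod_cast h)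

theorem add_fstVec_le (hT : IsReplacementFamily b C u T k) (hu : u ≤ b) : u + fstVec T k ≤ b := by
  intro e
  rcases Nat.eq_zero_or_pos (fstVec T k e) with h | h
  · simpa [h] using hu e
  · obtain ⟨p, hp, rfl⟩ := fstVec_pos h
    simpa [fstVec_of_mem hT.injOn_fst hp] using hT.cap p hp

theorem add_single_le_add_fstVec (hT : IsReplacementFamily b C u T k) {p : ι × ι} (hp : p ∈ T) :
    u + Pi.single p.1 (k p) ≤ u + fstVec T k := by
  refine add_single_le (fun e => by simp) ?_
  simp [fstVec_of_mem hT.injOn_fst hp]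

theorem choice_apply_snd (hT : IsReplacementFamily b C u T k) {p : ι × ι} (hp : p ∈ T) :
    C (u + Pi.single p.1 (k p)) p.2 + k p = u p.2 := by
  have := congrFun (hT.choice p hp) p.2
  simpa [hT.ne p hp] using this

/-- All replacements of the family can be performed simultaneously. -/
theorem choice_add [Fintype ι] (hT : IsReplacementFamily b C u T k) (hC : IsChoiceFunction b C)
    (hu : Acceptable b C u) : C (u + fstVec T k) + sndVec T k = u + fstVec T k := by
  refine hC.choice_add_eq hu (hT.add_fstVec_le hu.1) ?_ fun e he => ?_
  · rw [sum_fstVec, sum_sndVec]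
  · obtain ⟨p, hp, rfl⟩ := sndVec_pos he
    refine ⟨_, hT.add_single_le_add_fstVec hp, by simp, ?_⟩
    rw [sndVec_of_mem hT.injOn_snd hp]
    exact (hT.choice_apply_snd hp).le

theorem fst_ne_snd [Fintype ι] (hT : IsReplacementFamily b C u T k) (hC : IsChoiceFunction b C)
    (hu : Acceptable b C u) {p q : ι × ι} (hp : p ∈ T) (hq : q ∈ T) (hkp : 0 < k p)
    (hkq : 0 < k q) : p.1 ≠ q.2 := by
  intro h
  have h1 := congrFun (hT.choice_add hC hu) q.2
  have h2 := hC.choice_apply_le (hT.add_fstVec_le hu.1) (hT.add_single_le_add_fstVec hq)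
    (e := q.2)
  have h3 := hC.min_le_choice (hT.add_fstVec_le hu.1) (hT.add_single_le_add_fstVec hq) q.2
  have h4 := hT.choice_apply_snd hq
  have h5 := fstVec_of_mem (k := k) hT.injOn_fst hp
  have h6 := sndVec_of_mem (k := k) hT.injOn_snd hq
  rw [h] at h5
  simp [hT.ne q hq] at h1 h3
  omega

/-- Inserting into the vector chosen from `u + fstVec T k` is the same as inserting into
`u + fstVec T k`. -/
theorem choice_choice_add [Fintype ι] (hT : IsReplacementFamily b C u T k)
    (hC : IsChoiceFunction b C) (hu : Acceptable b C u) {β : ι → ℕ}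
    (hβ : u + fstVec T k + β ≤ b) (h : ∀ p ∈ T, β p.2 = 0) :
    C (C (u + fstVec T k) + β) = C (u + fstVec T k + β) := by
  refine hC.choice_choice_add hβ fun e he => ?_
  have h1 := congrFun (hT.choice_add hC hu) e
  have h2 : sndVec T k e = 0 := by
    by_contra h0
    obtain ⟨p, hp, rfl⟩ := sndVec_pos (Nat.pos_of_ne_zero h0)
    rw [h p hp] at he
    exact lt_irrefl _ he
  simpa [h2] using h1

/-- Performing one replacement of a family of tandems leaves a family of tandems. -/
theorem of_insert [Fintype ι] {p : ι × ι} (hT : IsReplacementFamily b C u (insert p T) 1)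
    (hC : IsChoiceFunction b C) (hu : Acceptable b C u) (hp : p ∉ T)
    (ht : ∀ q ∈ insert p T, IsTandem b C u q.1 q.2) :
    IsReplacementFamily b C (C (u + Pi.single p.1 1)) T 1 ∧
      (∀ q ∈ T, IsTandem b C (C (u + Pi.single p.1 1)) q.1 q.2) ∧
      C (u + fstVec (insert p T) 1) = C (C (u + Pi.single p.1 1) + fstVec T 1) := by
  have hp' := Finset.mem_insert_self p T
  have htT : ∀ q ∈ T, IsTandem b C (C (u + Pi.single p.1 1)) q.1 q.2 := by
    intro q hq
    have hqp : q ≠ p := fun h => hp (h ▸ hq)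
    have hq' := Finset.mem_insert_of_mem (a := q) (b := p) hq
    exact hC.tandem_tandem hu (ht q hq') (ht p hp')
      (fun h => hqp (hT.injOn_fst hq' hp' h)) (fun h => hqp (hT.injOn_snd hq' hp' h))
  have hsub := hT.mono (Finset.subset_insert p T)
  refine ⟨isReplacementFamily_of_tandem htT hsub.injOn_fst hsub.injOn_snd, htT, ?_⟩
  have hb := hT.add_fstVec_le hu.1
  have hsingle := hT.mono (T' := {p}) (by simp)
  have hfv : fstVec {p} (1 : ι × ι → ℕ) = Pi.single p.1 1 := by simp [fstVec]
  have hβ : u + fstVec {p} 1 + fstVec T 1 ≤ b := by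
    rwa [fstVec_insert hp, ← add_assoc, Pi.one_apply, ← hfv] at hb
  rw [fstVec_insert hp, ← add_assoc, Pi.one_apply, ← hfv, hsingle.choice_choice_add hC hu hβ]
  intro q hq
  obtain rfl := Finset.mem_singleton.1 hq
  by_contra h0
  obtain ⟨q', hq', h1⟩ := fstVec_pos (Nat.pos_of_ne_zero h0)
  exact hT.fst_ne_snd hC hu (Finset.mem_insert_of_mem hq') hp' one_pos one_pos h1

/-- A tandem that is disjoint from a family of replacements survives them. -/
theorem tandem_choice [Fintype ι] {p : ι × ι} (hT : IsReplacementFamily b C u (insert p T) 1)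
    (hC : IsChoiceFunction b C) (hu : Acceptable b C u) (hp : p ∉ T)
    (ht : IsTandem b C u p.1 p.2) : IsTandem b C (C (u + fstVec T 1)) p.1 p.2 := by
  have hp' := Finset.mem_insert_self p T
  have hT' := hT.mono (Finset.subset_insert p T)
  have hadd := hT.choice_add hC hu
  have hadd' := hT'.choice_add hC hu
  have hb := hT.add_fstVec_le hu.1
  rw [fstVec_insert hp, sndVec_insert hp, Pi.one_apply, add_comm (Pi.single p.1 1)] at hadd
  simp only [← add_assoc] at hadd
  rw [fstVec_insert hp, Pi.one_apply, add_comm (Pi.single p.1 1), ← add_assoc] at hb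
  have hf : fstVec T 1 p.1 = 0 := by
    by_contra h0
    obtain ⟨q, hq, h⟩ := fstVec_pos (Nat.pos_of_ne_zero h0)
    exact hp (hT.injOn_fst (Finset.mem_insert_of_mem hq) hp' h ▸ hq)
  have hs : sndVec T 1 p.2 = 0 := by
    by_contra h0
    obtain ⟨q, hq, h⟩ := sndVec_pos (Nat.pos_of_ne_zero h0)
    exact hp (hT.injOn_snd (Finset.mem_insert_of_mem hq) hp' h ▸ hq)
  have h1 := congrFun hadd' p.1
  have h2 := congrFun hadd' p.2
  simp only [Pi.add_apply, hf, hs] at h1 h2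
  refine ⟨?_, ?_, ht.2.2.1, ?_⟩
  · have := ht.1
    omega
  · have := ht.2.1
    omega
  · rw [hT'.choice_choice_add hC hu hb fun q hq => ?_]
    · refine add_right_cancel (b := sndVec T 1) ?_
      rw [hadd, add_right_comm _ (Pi.single p.1 1), hadd']
    · refine Pi.single_eq_of_ne (fun h => ?_) 1
      exact hT.fst_ne_snd hC hu hp' (Finset.mem_insert_of_mem hq) one_pos one_pos h.symm

end IsReplacementFamily

/-- A replacement that can be performed with weight `l` can be performed with each smaller
weight. -/
theorem IsChoiceFunction.choice_add_of_le [Fintype ι] (hC : IsChoiceFunction b C) {u : ι → ℕ}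
    (hu : Acceptable b C u) {a c : ι} {i l : ℕ} (hil : i ≤ l) (hb : u a + l ≤ b a) (hca : c ≠ a)
    (h : C (u + Pi.single a l) + Pi.single c l = u + Pi.single a l) :
    C (u + Pi.single a i) + Pi.single c i = u + Pi.single a i := by
  have hl : u + Pi.single a l ≤ b := add_single_le hu.1 hb
  have hle : u + Pi.single a i ≤ u + Pi.single a l :=
    add_single_le (fun e => by simp) (by simpa using hil)
  have hi := hle.trans hl
  have h1 := hC.size_monotonicity _ _ hl hle
  have h2 := hC.size_monotonicity _ u hi (fun e => by simp)
  have h3 := congrArg (fun z => ∑ e, z e) h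
  simp only [sum_add_single] at h3
  rw [hu.2] at h2
  -- only the entry `c` can be reduced, so its value is determined by the size
  have h4 : ∀ e, e ≠ c → C (u + Pi.single a i) e = (u + Pi.single a i : ι → ℕ) e := by
    intro e he
    have h5 := hC.min_le_choice hl hle e
    have h6 : C (u + Pi.single a i) e ≤ (u + Pi.single a i : ι → ℕ) e := hC.choice_le _ hi e
    have h7 := congrFun h e
    have h8 : (u + Pi.single a i : ι → ℕ) e ≤ (u + Pi.single a l : ι → ℕ) e := hle e
    simp only [Pi.add_apply, Pi.single_eq_of_ne he, add_zero] at *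
    omega
  have h5 : C (u + Pi.single a i) c ≤ (u + Pi.single a i : ι → ℕ) c := hC.choice_le _ hi c
  set d := (u + Pi.single a i : ι → ℕ) c - C (u + Pi.single a i) c with hd
  have h6 : C (u + Pi.single a i) + Pi.single c d = u + Pi.single a i := by
    funext e
    by_cases he : e = c
    · subst he
      rw [Pi.add_apply, Pi.single_eq_same]
      omega
    · simpa [he] using h4 e he
  have h7 := congrArg (fun z => ∑ e, z e) h6
  simp only [sum_add_single] at h7
  rwa [show d = i by omega] at h6

end Replacement

/-! ### Consequences of the gapless condition for one choice function -/

section Gapless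

variable {ι : Type*} [Fintype ι] [DecidableEq ι] {b : ι → ℕ} {C : (ι → ℕ) → (ι → ℕ)}

namespace WeaklyGapless

variable (hG : WeaklyGapless b C) (hC : IsChoiceFunction b C)
include hG hC

/-- Under the gapless condition, a tandem `(a, c)` at `u` that is still a tandem later on does
not make any entry uninteresting. If it did so with `e`, then the vectors `u`, `C (u + 1ᵉ)` and
`v` would violate the condition. -/
theorem interesting_of_tandem {u v : ι → ℕ} (hu : Acceptable b C u) (hv : Acceptable b C v)
    {a c e : ι} (ht : IsTandem b C u a c) (ht' : IsTandem b C v a c)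
    (huv : WeakPref C (C (u + Pi.single a 1)) v) (he : Interesting b C u e) :
    Interesting b C (C (u + Pi.single a 1)) e := by
  have hua : u + Pi.single a 1 ≤ b := add_single_le hu.1 ht.1
  have hu₁ := hC.acceptable hua
  by_contra hno
  have hea : e ≠ a := by
    rintro rfl
    exact hno (hC.interesting_anti hu₁ hv huv (tandem_interesting hv.1 ht'))
  have hue := lt_cap_of_interesting he
  have huae : u + Pi.single a 1 + Pi.single e 1 ≤ b :=
    add_single_le hua (by simpa [hea] using hue)
  have hueb : u + Pi.single e 1 ≤ b := add_single_le hu.1 hue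
  -- the later insertion of `e` is rejected entirely
  have hdom : WeakPref C (u + Pi.single a 1 + Pi.single e 1) (C (u + Pi.single a 1)) := by
    refine hC.weakPref_of_le (sup_le hua (single_le le_rfl : Pi.single e (b e) ≤ b)) hu₁.1 ?_
      (hC.weakPref_sup hua (single_le le_rfl) hu₁.1 (hC.weakPref_choice hua)
        ((hC.not_interesting_iff hu₁).1 hno))
    refine add_single_le le_sup_left ?_
    simp [hea]
    omega
  have hch : C (u + Pi.single a 1 + Pi.single e 1) = C (u + Pi.single a 1) :=
    eq_of_weakPref_of_le ((hC.choice_le _ hua).trans (fun e' => by simp)) hdom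
  have hle : u + Pi.single e 1 ≤ u + Pi.single a 1 + Pi.single e 1 := by
    intro e'; simp only [Pi.add_apply]; omega
  -- hence `e` drives out `c` at `u`
  have heq : C (u + Pi.single e 1) + Pi.single c 1 = u + Pi.single e 1 := by
    refine (eq_of_le_of_sum_le ?_ ?_).symm
    · intro e'
      have h1 := hC.min_le_choice huae hle e'
      have h2 := congrFun ht.2.2.2 e'
      have h3 := hC.choice_apply_of_interesting he
      rw [hch] at h1
      by_cases h4 : e' = e
      · subst h4; simp [h3]
      · simp only [Pi.add_apply, Pi.single_eq_of_ne h4, add_zero] at *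
        omega
    · rw [sum_add_single, sum_add_single]
      have h1 := hC.size_monotonicity _ _ huae hle
      rw [hch, sum_choice_of_tandem ht] at h1
      omega
  have hce : c ≠ e := by
    rintro rfl
    have h1 := congrFun heq c
    have h2 := hC.choice_apply_of_interesting he
    simp [h2] at h1
  set z := C (u + Pi.single e 1) with hz
  have hza : Acceptable b C z := hC.acceptable hueb
  have hzu : z a = u a := by
    have := congrFun heq a
    simpa [ht.2.2.1.symm, hea.symm] using this
  have hle2 : z + Pi.single a 1 ≤ u + Pi.single a 1 + Pi.single e 1 := by
    rw [add_right_comm]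
    exact add_le_add_left (hC.choice_le _ hueb) _
  have heq2 : C (u + Pi.single a 1) + Pi.single e 1 = z + Pi.single a 1 := by
    refine add_right_cancel (b := (Pi.single c 1 : ι → ℕ)) ?_
    rw [add_right_comm, ht.2.2.2, add_right_comm z, heq, add_right_comm]
  have hch2 : C (z + Pi.single a 1) = C (u + Pi.single a 1) := by
    rw [hC.consistence _ _ huae hle2 (by rw [hch, ← heq2]; intro e'; simp), hch]
  have htz : IsTandem b C z a e := by
    refine ⟨hzu ▸ ht.1, ?_, hea, by rw [hch2, heq2]⟩
    have h1 : z e = u e + 1 := hC.choice_apply_of_interesting he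
    omega
  have huz : WeakPref C u z :=
    hC.weakPref_of_le hueb hza.1 (fun e' => by simp) (hC.weakPref_choice hueb)
  have hzu₁ : WeakPref C z (C (u + Pi.single a 1)) :=
    hC.weakPref_of_le huae hu₁.1 ((hC.choice_le _ hueb).trans hle) hdom
  exact hce (hG u z v a c e hu hza hv huz (hC.weakPref_trans hza.1 hu₁.1 hv.1 hzu₁ huv) ht htz ht')

/-- Under the gapless condition, a family of tandems all of which are still tandems after the
family has been performed does not make any entry uninteresting. -/
theorem interesting_of_family {T : Finset (ι × ι)} : ∀ {u v : ι → ℕ}, Acceptable b C u →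
    IsReplacementFamily b C u T 1 → (∀ p ∈ T, IsTandem b C u p.1 p.2) →
    v = C (u + fstVec T 1) → (∀ p ∈ T, IsTandem b C v p.1 p.2) → ∀ e, Interesting b C u e →
    Interesting b C v e := by
  induction T using Finset.induction_on with
  | empty =>
    rintro u v hu - - rfl - e he
    simpa [fstVec, hu.2] using he
  | insert p T hp ih =>
    intro u v hu hfam ht hv htv e he
    have htp := ht p (Finset.mem_insert_self _ _)
    have hup : u + Pi.single p.1 1 ≤ b := add_single_le hu.1 htp.1
    have hu₁ := hC.acceptable hup
    have hva : Acceptable b C v := hv ▸ hC.acceptable (hfam.add_fstVec_le hu.1)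
    obtain ⟨hfamT, htT, hstep⟩ := hfam.of_insert hC hu hp ht
    rw [hstep] at hv
    have hw : WeakPref C (C (u + Pi.single p.1 1)) v := by
      have h1 := hfamT.add_fstVec_le hu₁.1
      rw [hv]
      exact hC.weakPref_of_le h1 (hC.le_cap h1) (fun e => by simp) (hC.weakPref_choice h1)
    exact ih hu₁ hfamT htT hv (fun q hq => htv q (Finset.mem_insert_of_mem hq)) e
      (hG.interesting_of_tandem hC hu hva htp (htv p (Finset.mem_insert_self _ _)) hw he)

/-- Under the gapless condition, a tandem `(a, c)` that is available after `(a₁, c₁)` was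
available before it, provided that `(a₁, c₁)` is still a tandem after both. -/
theorem tandem_of_tandem {u v : ι → ℕ} (hu : Acceptable b C u) (hv : Acceptable b C v)
    {a c a₁ c₁ : ι} (ht₁ : IsTandem b C u a₁ c₁) (ht₁' : IsTandem b C v a₁ c₁)
    (ht : IsTandem b C (C (u + Pi.single a₁ 1)) a c)
    (hw : WeakPref C (C (C (u + Pi.single a₁ 1) + Pi.single a 1)) v)
    (haa : a ≠ a₁) (hac : a ≠ c₁) (hca : c ≠ a₁) (hcc : c ≠ c₁) : IsTandem b C u a c := by
  have hua : u + Pi.single a₁ 1 ≤ b := add_single_le hu.1 ht₁.1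
  have hu₁ := hC.acceptable hua
  have huu₁ : WeakPref C u (C (u + Pi.single a₁ 1)) :=
    hC.weakPref_of_le hua hu₁.1 (fun e => by simp) (hC.weakPref_choice hua)
  obtain ⟨d, hd⟩ := hC.exists_tandem_of_weakPref hu hu₁ huu₁ (sum_choice_of_tandem ht₁).le ht
  -- if `d = c₁`, then `a₁` has the tandems `(a₁, c₁)`, `(a₁, c)`, `(a₁, c₁)` at the vectors
  -- `u`, `C (u + 1ᵃ)` and `v`, against the gapless condition
  by_cases hdc : d = c₁
  swap
  · exact ht.unique (hC.tandem_tandem hu hd ht₁ haa hdc) ▸ hd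
  exfalso
  subst hdc
  have hub : u + Pi.single a 1 ≤ b := add_single_le hu.1 hd.1
  have hub₁ : u + Pi.single a₁ 1 + Pi.single a 1 ≤ b :=
    add_single_le hua (by simpa [haa] using hd.1)
  have hu₁b : C (u + Pi.single a₁ 1) + Pi.single a 1 ≤ b := add_single_le hu₁.1 ht.1
  have hch : C (C (u + Pi.single a₁ 1) + Pi.single a 1)
      = C (u + Pi.single a₁ 1 + Pi.single a 1) := by
    refine hC.choice_choice_add hub₁ fun e he => ?_
    have : e = a := by
      by_contra hne; simp [hne] at he
    subst this
    simpa [hac] using congrFun ht₁.2.2.2 e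
  set z := C (u + Pi.single a 1) with hz
  have hza : Acceptable b C z := hC.acceptable hub
  have hz₁ : z + Pi.single a₁ 1 ≤ u + Pi.single a₁ 1 + Pi.single a 1 := by
    rw [add_right_comm]
    exact add_le_add_left (hC.choice_le _ hub) _
  have heq : C (C (u + Pi.single a₁ 1) + Pi.single a 1) + Pi.single c 1 = z + Pi.single a₁ 1 := by
    refine add_right_cancel (b := (Pi.single d 1 : ι → ℕ)) ?_
    rw [ht.2.2.2, add_right_comm, ht₁.2.2.2, add_right_comm z, hd.2.2.2, add_right_comm]
  have hchz : C (z + Pi.single a₁ 1) = C (C (u + Pi.single a₁ 1) + Pi.single a 1) := by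
    rw [hch]
    refine hC.consistence _ _ hub₁ hz₁ ?_
    rw [← hch, ← heq]
    intro e; simp
  have htz : IsTandem b C z a₁ c := by
    refine ⟨?_, ?_, hca, by rw [hchz, heq]⟩
    · have h1 := congrFun hd.2.2.2 a₁
      simp [haa.symm, ht₁.2.2.1.symm] at h1
      rw [hz, h1]; exact ht₁.1
    · have := congrFun heq c
      simp [hca] at this
      omega
  have huz : WeakPref C u z :=
    hC.weakPref_of_le hub hza.1 (fun e => by simp) (hC.weakPref_choice hub)
  have hzv : WeakPref C z v := by
    refine hC.weakPref_trans hza.1 (hC.le_cap hu₁b) hv.1 ?_ hw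
    rw [hch]
    exact hC.weakPref_of_le hub₁ (hC.le_cap hub₁) (le_trans (fun e => by simp) hz₁)
      (hC.weakPref_choice hub₁)
  exact hcc (hG u z v a₁ d c hu hza hv huz hzv ht₁ htz ht₁').symm

/-- Under the gapless condition, a family of tandems all of which are still tandems after the
family has been performed does not create tandems that are disjoint from it. -/
theorem tandem_of_family {a c : ι} {T : Finset (ι × ι)} (haT : ∀ p ∈ T, a ≠ p.1 ∧ a ≠ p.2)
    (hcT : ∀ p ∈ T, c ≠ p.1 ∧ c ≠ p.2) : ∀ {u v : ι → ℕ}, Acceptable b C u →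
    IsReplacementFamily b C u T 1 → (∀ p ∈ T, IsTandem b C u p.1 p.2) →
    v = C (u + fstVec T 1) → IsTandem b C v a c → (∀ p ∈ T, IsTandem b C v p.1 p.2) →
    IsTandem b C u a c := by
  induction T using Finset.induction_on with
  | empty =>
    rintro u v hu - - rfl htv -
    simpa [fstVec, hu.2] using htv
  | insert p T hp ih =>
    intro u v hu hfam ht hv hac htv
    have htp := ht p (Finset.mem_insert_self _ _)
    have hup : u + Pi.single p.1 1 ≤ b := add_single_le hu.1 htp.1
    have hu₁ := hC.acceptable hup
    have hva : Acceptable b C v := hv ▸ hC.acceptable (hfam.add_fstVec_le hu.1)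
    obtain ⟨hfamT, htT, hstep⟩ := hfam.of_insert hC hu hp ht
    rw [hstep] at hv
    have hTv := hfamT.add_fstVec_le hu₁.1
    have hw : WeakPref C (C (u + Pi.single p.1 1)) v := by
      rw [hv]
      exact hC.weakPref_of_le hTv (hC.le_cap hTv) (fun e => by simp) (hC.weakPref_choice hTv)
    have hu₁ac := ih (fun q hq => haT q (Finset.mem_insert_of_mem hq))
      (fun q hq => hcT q (Finset.mem_insert_of_mem hq)) hu₁ hfamT htT hv hac
      (fun q hq => htv q (Finset.mem_insert_of_mem hq))
    -- after performing `(a, c)` at `v` the pair `p` is still a tandem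
    have hpa := haT p (Finset.mem_insert_self _ _)
    have hpc := hcT p (Finset.mem_insert_self _ _)
    have hvb : v + Pi.single a 1 ≤ b := add_single_le hva.1 hac.1
    have hpv := hC.tandem_tandem hva (htv p (Finset.mem_insert_self _ _)) hac hpa.1.symm hpc.2.symm
    have hdom := (hC.tandem_of_weakPref hu₁ hva hw hac).2
    have hu₁b : C (u + Pi.single p.1 1) + Pi.single a 1 ≤ b := add_single_le hu₁.1 hu₁ac.1
    exact hG.tandem_of_tandem hC hu (hC.acceptable hvb) htp hpv hu₁ac
      (hC.weakPref_of_le hu₁b (hC.le_cap hvb) (hC.choice_le _ hu₁b) hdom)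
      hpa.1 hpa.2 hpc.1 hpc.2

end WeaklyGapless

end Gapless

/-! ### Cyclic chains -/

namespace Cycle

variable {α : Type*} {r : α → α → Prop}

theorem mem_toFinset_iff [DecidableEq α] {s : Cycle α} {p : α} : p ∈ s.toFinset ↔ p ∈ s := by
  induction s using Quotient.inductionOn' with
  | h l => simp

theorem exists_eq_coe_cons {s : Cycle α} {p : α} (hp : p ∈ s) :
    ∃ t : List α, s = ((p :: t : List α) : Cycle α) := by
  induction s using Quotient.inductionOn' with
  | h l =>
    obtain ⟨l₁, l₂, rfl⟩ := List.append_of_mem (show p ∈ l from hp)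
    exact ⟨l₂ ++ l₁, Cycle.coe_eq_coe.2 ⟨l₁.length, by simp⟩⟩

theorem exists_mem_of_ne_nil {s : Cycle α} (h : s ≠ Cycle.nil) : ∃ p, p ∈ s := by
  induction s using Quotient.inductionOn' with
  | h l =>
    cases l with
    | nil => exact absurd rfl h
    | cons p t => exact ⟨p, List.mem_cons_self⟩

theorem Chain.exists_next {s : Cycle α} (h : s.Chain r) {p : α} (hp : p ∈ s) :
    ∃ q ∈ s, r p q := by
  obtain ⟨t, rfl⟩ := exists_eq_coe_cons hp
  rw [Cycle.chain_coe_cons] at h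
  cases t with
  | nil =>
    rw [List.nil_append, List.isChain_cons_cons] at h
    exact ⟨p, hp, h.1⟩
  | cons q t =>
    rw [List.cons_append, List.isChain_cons_cons] at h
    exact ⟨q, by simp, h.1⟩

theorem Chain.exists_prev {s : Cycle α} (h : s.Chain r) {p : α} (hp : p ∈ s) :
    ∃ q ∈ s, r q p := by
  obtain ⟨t, rfl⟩ := exists_eq_coe_cons hp
  rw [Cycle.chain_coe_cons, ← List.cons_append] at h
  rcases List.eq_nil_or_concat (p :: t) with h0 | ⟨t', q, hq⟩
  · exact absurd h0 (List.cons_ne_nil _ _)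
  · rw [List.concat_eq_append] at hq
    rw [hq, List.append_assoc, List.singleton_append] at h
    have h1 := (List.isChain_split.1 h).2
    rw [List.isChain_cons_cons] at h1
    exact ⟨q, by rw [hq]; simp, h1.1⟩

theorem eq_tail_of_isChain {S : α → Prop} {p : α}
    (hr : ∀ a b b', S b → S b' → r a b → r a b' → b = b') (hp : S p) :
    ∀ {t t' : List α} {a : α}, (∀ q ∈ t, S q) → (∀ q ∈ t', S q) → p ∉ t → p ∉ t' →
      List.IsChain r (a :: (t ++ [p])) → List.IsChain r (a :: (t' ++ [p])) → t = t' := by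
  intro t
  induction t with
  | nil =>
    intro t' a _ hS' _ hp' h h'
    cases t' with
    | nil => rfl
    | cons b s =>
      rw [List.nil_append, List.isChain_cons_cons] at h
      rw [List.cons_append, List.isChain_cons_cons] at h'
      have := hr a p b hp (hS' b (by simp)) h.1 h'.1
      exact absurd (this ▸ List.mem_cons_self) hp'
  | cons c t ih =>
    intro t' a hS hS' hp₁ hp' h h'
    cases t' with
    | nil =>
      rw [List.nil_append, List.isChain_cons_cons] at h'
      rw [List.cons_append, List.isChain_cons_cons] at h
      have := hr a p c hp (hS c (by simp)) h'.1 h.1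
      exact absurd (this ▸ List.mem_cons_self) hp₁
    | cons b s =>
      rw [List.cons_append, List.isChain_cons_cons] at h h'
      obtain rfl := hr a c b (hS c (by simp)) (hS' b (by simp)) h.1 h'.1
      rw [ih (fun q hq => hS q (by simp [hq])) (fun q hq => hS' q (by simp [hq]))
        (fun hq => hp₁ (by simp [hq])) (fun hq => hp' (by simp [hq])) h.2 h'.2]

/-- A cyclic chain without repetitions for a relation with unique successors is determined by
any of its members. -/
theorem eq_of_mem_of_mem {S : α → Prop} (hr : ∀ a b b', S b → S b' → r a b → r a b' → b = b')
    {s s' : Cycle α} (hs : s.Chain r) (hs' : s'.Chain r) (hn : s.Nodup) (hn' : s'.Nodup)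
    (hS : ∀ q ∈ s, S q) (hS' : ∀ q ∈ s', S q) {p : α} (hp : p ∈ s) (hp' : p ∈ s') : s = s' := by
  obtain ⟨t, rfl⟩ := exists_eq_coe_cons hp
  obtain ⟨t', rfl⟩ := exists_eq_coe_cons hp'
  rw [Cycle.chain_coe_cons] at hs hs'
  rw [Cycle.nodup_coe_iff, List.nodup_cons] at hn hn'
  rw [eq_tail_of_isChain hr (hS p hp) (fun q hq => hS q (List.mem_cons_of_mem _ hq))
    (fun q hq => hS' q (List.mem_cons_of_mem _ hq)) hn.1 hn'.1 hs hs']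

theorem exists_mem_periodicPts [Finite α] (f : α → α) (x : α) :
    ∃ y, y ∈ Function.periodicPts f := by
  obtain ⟨m, n, hmn, h⟩ := Finite.exists_ne_map_eq_of_infinite fun n : ℕ => f^[n] x
  wlog hlt : m < n generalizing m n
  · exact this n m hmn.symm h.symm (by omega)
  refine ⟨f^[m] x, n - m, by omega, ?_⟩
  show f^[n - m] (f^[m] x) = f^[m] x
  rw [← Function.iterate_add_apply, Nat.sub_add_cancel hlt.le]
  exact h.symm

end Cycle

/-! ### Rotations of a stable g-allocation -/

namespace SGAM

section

variable {W F E : Type*} [Fintype E] [DecidableEq W] [DecidableEq F] [DecidableEq E]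
  {M : SGAM W F E} {x y : E → ℕ}

/-- Edges of a cycle of tandems are never deleted, since the predecessor of an edge in the cycle
would have to be deleted earlier. -/
theorem not_deleted {L : Cycle (E × E)} (hL : ∀ p ∈ L, M.Tandem x p.1 p.2)
    (hc : L.Chain fun p p' => M.worker p.2 = M.worker p'.1) {a : E} (ha : M.Deleted x a) :
    ∀ c, (a, c) ∉ L := by
  induction ha with
  | delete a _ _ ih =>
    intro c hac
    obtain ⟨q, hq, hqa⟩ := hc.exists_prev hac
    exact ih q.1 q.2 (hL q hq) hqa q.2 hq

/-- The cleaning procedure does not affect cycles of tandems. -/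
theorem isRotation_iff (hx : IsStablePair M.cap M.gF M.gW x) {L : Cycle (E × E)} :
    M.IsRotation x L ↔ L ≠ Cycle.nil ∧ L.Nodup ∧
      (∀ p ∈ L, M.Adm x p.1 ∧ IsTandem M.cap M.gF x p.1 p.2) ∧
      L.Chain (fun p p' => M.worker p.2 = M.worker p'.1) := by
  constructor
  · rintro ⟨h1, h2, h3, h4⟩
    exact ⟨h1, h2, fun p hp => (tandem_iff hx).1 (h3 p hp).1, h4⟩
  · rintro ⟨h1, h2, h3, h4⟩
    have h5 : ∀ p ∈ L, M.Tandem x p.1 p.2 := fun p hp => (tandem_iff hx).2 (h3 p hp)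
    exact ⟨h1, h2, fun p hp => ⟨h5 p hp, fun hd => not_deleted h5 h4 hd p.2 hp⟩, h4⟩

namespace IsRotation

variable {L L' : Cycle (E × E)} (hx : IsStablePair M.cap M.gF M.gW x) (hL : M.IsRotation x L)
include hx hL

theorem adm {p : E × E} (hp : p ∈ L) : M.Adm x p.1 := (((isRotation_iff hx).1 hL).2.2.1 p hp).1

theorem tandem {p : E × E} (hp : p ∈ L) : IsTandem M.cap M.gF x p.1 p.2 :=
  (((isRotation_iff hx).1 hL).2.2.1 p hp).2

theorem eq_of_worker_fst {p q : E × E} (hp : p ∈ L) (hL' : M.IsRotation x L') (hq : q ∈ L')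
    (h : M.worker p.1 = M.worker q.1) : p = q := by
  have h1 := (adm hx hL hp).unique (adm hx hL' hq) h
  have h2 := tandem hx hL hp
  rw [h1] at h2
  exact Prod.ext h1 (h2.unique (tandem hx hL' hq))

/-- Different rotations of the same g-allocation visit different workers. -/
theorem eq_of_worker (hL' : M.IsRotation x L') {p q : E × E} (hp : p ∈ L) (hq : q ∈ L')
    (h : M.worker p.1 = M.worker q.1) : L = L' := by
  obtain rfl := eq_of_worker_fst hx hL hp hL' hq h
  refine Cycle.eq_of_mem_of_mem (S := fun q => M.Tandem x q.1 q.2) ?_ hL.2.2.2 hL'.2.2.2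
    hL.2.1 hL'.2.1 (fun q hq => (hL.2.2.1 q hq).1) (fun q hq => (hL'.2.2.1 q hq).1) hp hq
  intro a b b' hb hb' h1 h2
  have := Tandem.unique hx hb hb' (h1.symm.trans h2)
  exact Prod.ext this.1 this.2

theorem eq_of_worker_snd {p q : E × E} (hp : p ∈ L) (hq : q ∈ L)
    (h : M.worker p.2 = M.worker q.2) : p = q := by
  -- the successor map is surjective on the finite set of pairs, hence injective
  have hnext : ∀ p : {p // p ∈ L.toFinset}, ∃ q : {p // p ∈ L.toFinset},
      M.worker p.1.2 = M.worker q.1.1 := fun p => by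
    obtain ⟨q, hq, hpq⟩ := hL.2.2.2.exists_next (Cycle.mem_toFinset_iff.1 p.2)
    exact ⟨⟨q, Cycle.mem_toFinset_iff.2 hq⟩, hpq⟩
  choose σ hσ using hnext
  have hsurj : Function.Surjective σ := fun q => by
    obtain ⟨p, hp, hpq⟩ := hL.2.2.2.exists_prev (Cycle.mem_toFinset_iff.1 q.2)
    refine ⟨⟨p, Cycle.mem_toFinset_iff.2 hp⟩, Subtype.ext ?_⟩
    exact eq_of_worker_fst hx hL (Cycle.mem_toFinset_iff.1 (σ _).2) hL
      (Cycle.mem_toFinset_iff.1 q.2) ((hσ ⟨p, Cycle.mem_toFinset_iff.2 hp⟩).symm.trans hpq)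
  have hinj := Finite.injective_iff_surjective.2 hsurj
  have h1 : (⟨p, Cycle.mem_toFinset_iff.2 hp⟩ : {p // p ∈ L.toFinset})
      = ⟨q, Cycle.mem_toFinset_iff.2 hq⟩ := by
    refine hinj (Subtype.ext ?_)
    exact eq_of_worker_fst hx hL (Cycle.mem_toFinset_iff.1 (σ _).2) hL
      (Cycle.mem_toFinset_iff.1 (σ _).2) ((hσ ⟨p, Cycle.mem_toFinset_iff.2 hp⟩).symm.trans
        (h.trans (hσ ⟨q, Cycle.mem_toFinset_iff.2 hq⟩)))
  exact congrArg Subtype.val h1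

theorem injOn_fst : Set.InjOn Prod.fst (L.toFinset : Set (E × E)) := fun _ hp _ hq h =>
  eq_of_worker_fst hx hL (Cycle.mem_toFinset_iff.1 hp) hL (Cycle.mem_toFinset_iff.1 hq)
    (congrArg M.worker h)

theorem injOn_snd : Set.InjOn Prod.snd (L.toFinset : Set (E × E)) := fun _ hp _ hq h =>
  eq_of_worker_snd hx hL (Cycle.mem_toFinset_iff.1 hp) (Cycle.mem_toFinset_iff.1 hq)
    (congrArg M.worker h)

theorem family : IsReplacementFamily M.cap M.gF x L.toFinset 1 :=
  isReplacementFamily_of_tandem (fun _ hp => tandem hx hL (Cycle.mem_toFinset_iff.1 hp))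
    (injOn_fst hx hL) (injOn_snd hx hL)

/-- A rotation meets every worker in equally many positive and negative edges. -/
theorem sum_worker (w : W) : ∑ e : M.EdgesW w, fstVec L.toFinset 1 e
    = ∑ e : M.EdgesW w, sndVec L.toFinset 1 e := by
  have hf : ∑ e : M.EdgesW w, fstVec L.toFinset 1 e
      = (L.toFinset.filter fun p => M.worker p.1 = w).card := by
    simp only [fstVec_apply]
    rw [Finset.sum_comm, Finset.card_filter]
    refine Finset.sum_congr rfl fun p _ => ?_
    rw [← Finset.sum_subtype (Finset.univ.filter fun e => M.worker e = w) (by simp)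
      (fun e => if e = p.1 then (1 : E × E → ℕ) p else 0), Finset.sum_ite_eq']
    simp
  have hs : ∑ e : M.EdgesW w, sndVec L.toFinset 1 e
      = (L.toFinset.filter fun p => M.worker p.2 = w).card := by
    simp only [sndVec_apply]
    rw [Finset.sum_comm, Finset.card_filter]
    refine Finset.sum_congr rfl fun p _ => ?_
    rw [← Finset.sum_subtype (Finset.univ.filter fun e => M.worker e = w) (by simp)
      (fun e => if e = p.2 then (1 : E × E → ℕ) p else 0), Finset.sum_ite_eq']
    simp
  rw [hf, hs]
  have h1 : (L.toFinset.filter fun p => M.worker p.1 = w).card ≤ 1 :=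
    Finset.card_le_one.2 fun p hp q hq => by
      simp only [Finset.mem_filter, Cycle.mem_toFinset_iff] at hp hq
      exact eq_of_worker_fst hx hL hp.1 hL hq.1 (hp.2.trans hq.2.symm)
  have h2 : (L.toFinset.filter fun p => M.worker p.2 = w).card ≤ 1 :=
    Finset.card_le_one.2 fun p hp q hq => by
      simp only [Finset.mem_filter, Cycle.mem_toFinset_iff] at hp hq
      exact eq_of_worker_snd hx hL hp.1 hq.1 (hp.2.trans hq.2.symm)
  have h3 : 0 < (L.toFinset.filter fun p => M.worker p.1 = w).card ↔
      0 < (L.toFinset.filter fun p => M.worker p.2 = w).card := by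
    rw [Finset.card_pos, Finset.card_pos]
    constructor
    · rintro ⟨p, hp⟩
      simp only [Finset.mem_filter, Cycle.mem_toFinset_iff] at hp
      obtain ⟨q, hq, hqp⟩ := hL.2.2.2.exists_prev hp.1
      exact ⟨q, by simp [Cycle.mem_toFinset_iff, hq, hqp, hp.2]⟩
    · rintro ⟨p, hp⟩
      simp only [Finset.mem_filter, Cycle.mem_toFinset_iff] at hp
      obtain ⟨q, hq, hqp⟩ := hL.2.2.2.exists_next hp.1
      exact ⟨q, by simp [Cycle.mem_toFinset_iff, hq, ← hqp, hp.2]⟩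
  omega

/-- Shifting along a rotation with weight one leads to a stable g-allocation. At each worker the
shifted vector is supported by edges that are not worse than any edge still interesting for its
firm. -/
theorem isStablePair_shift :
    IsStablePair M.cap M.gF M.gW (M.gF (x + fstVec L.toFinset 1)) := by
  have hfam := family hx hL
  have hb := hfam.add_fstVec_le hx.1.1
  have hadd := hfam.choice_add M.gF_spec hx.1
  have hy := M.gF_spec.acceptable hb
  set y := M.gF (x + fstVec L.toFinset 1) with hy_def
  have hxy : WeakPref M.gF x y :=
    M.gF_spec.weakPref_of_le hb hy.1 (fun e => by simp) (M.gF_spec.weakPref_choice hb)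
  have hsum : ∀ w, ∑ e : M.EdgesW w, y e = ∑ e : M.EdgesW w, x e := by
    intro w
    have h1 : ∑ e : M.EdgesW w, (y + sndVec L.toFinset 1) e
        = ∑ e : M.EdgesW w, (x + fstVec L.toFinset 1) e := by rw [hadd]
    simp only [Pi.add_apply, Finset.sum_add_distrib] at h1
    have := sum_worker hx hL w
    omega
  refine ⟨hy, ⟨hy.1, M.gW_eq_self_iff.2 fun w => ?_⟩, fun e he => ?_⟩
  · rw [hsum]
    exact M.gW_eq_self_iff.1 hx.2.1.2 w
  · have hIx := M.gF_spec.interesting_anti hx.1 hy hxy he.1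
    have h1 := ((M.interesting_gW_iff hy.1 (⟨e, rfl⟩ : M.EdgesW (M.worker e))).1 he.2).2
    have h2 := fullyFilled_of_interesting hx (⟨e, rfl⟩ : M.EdgesW (M.worker e)) hIx
    rw [← hsum] at h2
    refine h1.ne (Eq.trans (Finset.sum_subset (Finset.subset_univ _) fun e' _ he' => ?_) h2)
    by_contra hpos
    apply he'
    refine Finset.mem_filter.2 ⟨Finset.mem_univ _, ?_⟩
    by_cases hxe : 0 < x e'
    · exact le_of_interesting hx _ hIx e' hxe
    · have h3 : 0 < fstVec L.toFinset 1 (e' : E) := by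
        have := congrFun hadd e'
        simp only [Pi.add_apply] at this
        omega
      obtain ⟨q, hq, hqe⟩ := fstVec_pos h3
      have h4 := adm hx hL (Cycle.mem_toFinset_iff.1 hq)
      have h5 := h4.2.1
      rw [hqe] at h5
      obtain ⟨e', hw⟩ := e'
      simp only at hqe
      subst hqe
      have key : ∀ (w w' : W) (hww : w = w') (h : M.worker q.1 = w) (h' : M.worker e = w),
          (M.pref w).le ⟨e, h'⟩ ⟨q.1, h⟩ → (M.pref w').le ⟨e, h'.trans hww⟩ ⟨q.1, h.trans hww⟩ := by
        rintro w _ rfl h h' hle; exact hle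
      exact key _ _ hw rfl hw.symm (h4.2.1 ⟨e, hw.symm⟩ hIx)

end IsRotation

/-- The total amount at a worker is the same in all stable g-allocations. -/
theorem sum_worker_eq (hx : IsStablePair M.cap M.gF M.gW x) (hy : IsStablePair M.cap M.gF M.gW y)
    (w : W) : ∑ e : M.EdgesW w, x e = ∑ e : M.EdgesW w, y e := by
  have key : ∀ {x y : E → ℕ}, IsStablePair M.cap M.gF M.gW x → IsStablePair M.cap M.gF M.gW y →
      ∀ w, ∑ e : M.EdgesW w, x e = ∑ e : M.EdgesW w, M.gW (x ⊔ y) e := by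
    intro x y hx hy
    have hle : ∀ w, ∑ e : M.EdgesW w, x e ≤ ∑ e : M.EdgesW w, M.gW (x ⊔ y) e := by
      intro w
      rw [M.sum_gW]
      refine le_min (M.gW_eq_self_iff.1 hx.2.1.2 w) (Finset.sum_le_sum fun e _ => ?_)
      exact le_sup_left (a := x e) (b := y e)
    have htot := (IsStablePair.sum_choice M.gF_spec M.gW_spec hx hy).symm
    rw [sum_eq_sum_fibre M.worker, sum_eq_sum_fibre M.worker] at htot
    intro w
    by_cases hw : w ∈ Finset.univ.image M.worker
    · exact (Finset.sum_eq_sum_iff_of_le fun w _ => hle w).1 htot w hw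
    · have hemp : ∀ e : M.EdgesW w, False := fun e =>
        hw (e.2 ▸ Finset.mem_image_of_mem _ (Finset.mem_univ _))
      rw [Finset.sum_eq_zero fun e _ => (hemp e).elim, Finset.sum_eq_zero fun e _ => (hemp e).elim]
  rw [key hx hy, sup_comm, ← key hy hx]

/-- If `x` and `y` differ at the worker `w`, then the `W`-admissible edge at `w` forms a tandem,
the vector `y` is preferred to the insertion of this edge, and `y` differs from `x` at the worker
to which the tandem leads. -/
theorem exists_tandem_of_ne (hx : IsStablePair M.cap M.gF M.gW x)
    (hy : IsStablePair M.cap M.gF M.gW y) (hxy : WeakPref M.gF x y) {w : W}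
    (hw : ∃ e, M.worker e = w ∧ x e ≠ y e) :
    ∃ p : E × E, M.worker p.1 = w ∧ M.Adm x p.1 ∧ IsTandem M.cap M.gF x p.1 p.2 ∧
      WeakPref M.gF (x + Pi.single p.1 1) y ∧ ∃ e, M.worker e = M.worker p.2 ∧ x e ≠ y e := by
  have hCF := M.gF_spec
  -- an edge at `w` whose value grows
  obtain ⟨e, he⟩ : ∃ e : M.EdgesW w, x e < y e := by
    by_contra hno
    push Not at hno
    obtain ⟨e, rfl, hne⟩ := hw
    have h1 := (Finset.sum_eq_sum_iff_of_le fun (e' : M.EdgesW (M.worker e)) _ => hno e').1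
      (sum_worker_eq hy hx (M.worker e)) ⟨e, rfl⟩ (Finset.mem_univ _)
    exact hne h1.symm
  have hIe : Interesting M.cap M.gF x e := hCF.interesting_of_lt hx.1
    (sup_le hx.1.1 hy.1.1) le_sup_left (by rwa [show M.gF (x ⊔ y) = y from hxy])
  -- the most preferred interesting edge at `w`
  obtain ⟨a, ha, hmax⟩ : ∃ a : M.EdgesW w, Interesting M.cap M.gF x a ∧
      ∀ e : M.EdgesW w, Interesting M.cap M.gF x e → (M.pref w).le e a := by
    classical
    let _ := M.pref w
    obtain ⟨a, ha, hmax⟩ := Finset.exists_max_image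
      (Finset.univ.filter fun e : M.EdgesW w => Interesting M.cap M.gF x e) id ⟨e, by simp [hIe]⟩
    exact ⟨a, (Finset.mem_filter.1 ha).2,
      fun e he => hmax e (Finset.mem_filter.2 ⟨Finset.mem_univ _, he⟩)⟩
  have hacap := lt_cap_of_interesting ha
  have hxa : x + Pi.single (a : E) 1 ≤ M.cap := add_single_le hx.1.1 hacap
  have hq : 0 < M.quota w := by
    have h1 := M.gW_eq_self_iff.1 hy.2.1.2 w
    have h2 := Finset.single_le_sum (f := fun e : M.EdgesW w => y e) (fun _ _ => Nat.zero_le _)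
      (Finset.mem_univ e)
    omega
  have hadm : M.Adm x a := by
    obtain ⟨a, rfl⟩ := a
    exact ⟨ha, hmax, hq⟩
  have hdom : WeakPref M.gF (x + Pi.single (a : E) 1) y := by
    by_cases hlt : x a < y a
    · exact hCF.weakPref_of_le (sup_le hx.1.1 hy.1.1) hy.1.1
        (add_single_le le_sup_left (by simp only [Pi.sup_apply]; omega))
        (hCF.weakPref_sup hx.1.1 hy.1.1 hy.1.1 hxy (weakPref_refl hy.1))
    · -- `w` prefers `a` to `e`, so `a` is interesting for `w` under `y`, hence not for the firm
      have hne : e ≠ a := by rintro rfl; exact hlt he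
      have hIW : Interesting M.cap M.gW y a := by
        refine (M.interesting_gW_iff hy.1.1 a).2 ⟨by omega, ?_⟩
        have hnle : ¬ (M.pref w).le a e := fun h =>
          hne (@le_antisymm _ (M.pref w).toPartialOrder _ _ (hmax e hIe) h)
        have h1 : ∑ e' ∈ insert e (Finset.univ.filter (fun e' => (M.pref w).le a e')), y e'
            ≤ ∑ e' : M.EdgesW w, y e' :=
          Finset.sum_le_sum_of_subset (Finset.subset_univ _)
        rw [Finset.sum_insert (by simpa using hnle)] at h1
        have h2 := M.gW_eq_self_iff.1 hy.2.1.2 w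
        omega
      have hs : Pi.single (a : E) (M.cap a) ≤ M.cap := single_le le_rfl
      refine hCF.weakPref_of_le (sup_le hx.1.1 hs) hy.1.1
        (add_single_le le_sup_left (by simp; omega)) (hCF.weakPref_sup hx.1.1 hs hy.1.1 hxy
        ((hCF.not_interesting_iff hy.1).1 fun h => hy.2.2 a ⟨h, hIW⟩))
  obtain ⟨c, hc⟩ : ∃ c, IsTandem M.cap M.gF x a c := by
    refine hCF.exists_tandem hx.1 ha ((hCF.sum_choice_of_weakPref hxa hy.1.1 hdom).trans ?_)
    exact (IsStablePair.sum_eq hCF M.gW_spec hy hx).le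
  refine ⟨(a, c), a.2, hadm, hc, hdom, c, rfl, ?_⟩
  have h1 := hCF.min_le_choice_of_weakPref hxa hy.1.1 hdom c
  have h2 := congrFun hc.2.2.2 c
  simp [hc.2.2.1] at h1 h2
  omega

/-- Below every more preferred stable g-allocation there is a shift along a rotation. -/
theorem exists_rotation_of_ne (hx : IsStablePair M.cap M.gF M.gW x)
    (hy : IsStablePair M.cap M.gF M.gW y) (hxy : WeakPref M.gF x y) (hne : x ≠ y) :
    ∃ L, M.IsRotation x L ∧ WeakPref M.gF (M.gF (x + fstVec L.toFinset 1)) y := by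
  have hCF := M.gF_spec
  let G := {p : E × E // M.Adm x p.1 ∧ IsTandem M.cap M.gF x p.1 p.2 ∧
    WeakPref M.gF (x + Pi.single p.1 1) y ∧ ∃ e, M.worker e = M.worker p.2 ∧ x e ≠ y e}
  have hnext : ∀ p : G, ∃ q : G, M.worker p.1.2 = M.worker q.1.1 := fun p => by
    obtain ⟨q, hq, h⟩ := exists_tandem_of_ne hx hy hxy p.2.2.2.2
    exact ⟨⟨q, h⟩, hq.symm⟩
  choose σ hσ using hnext
  obtain ⟨e, he⟩ := Function.ne_iff.1 hne
  obtain ⟨p₀, -, hp₀⟩ := exists_tandem_of_ne hx hy hxy ⟨e, rfl, he⟩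
  obtain ⟨g, hg⟩ := Cycle.exists_mem_periodicPts σ ⟨p₀, hp₀⟩
  let L : Cycle (E × E) := (Function.periodicOrbit σ g).map Subtype.val
  have hmem : ∀ p ∈ L, ∃ q : G, q.1 = p := fun p hp => by
    obtain ⟨q, -, hq⟩ := Cycle.mem_map.1 hp
    exact ⟨q, hq⟩
  have hL : M.IsRotation x L := by
    refine (isRotation_iff hx).2 ⟨?_, ?_, fun p hp => ?_, ?_⟩
    · intro h
      rw [Cycle.map_eq_nil] at h
      exact Function.periodicOrbit_eq_nil_iff_not_periodic_pt.1 h hg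
    · have h1 : (Function.periodicOrbit σ g).Nodup := Function.nodup_periodicOrbit
      revert h1
      show _ → (Cycle.map _ _).Nodup
      generalize Function.periodicOrbit σ g = s
      induction s using Quotient.inductionOn' with
      | h l => exact fun h => List.Nodup.map Subtype.val_injective h
    · obtain ⟨q, rfl⟩ := hmem p hp
      exact ⟨q.2.1, q.2.2.1⟩
    · refine (Cycle.chain_map _).2 ((Function.periodicOrbit_chain' _ hg).2 fun n => ?_)
      rw [Function.iterate_succ_apply']
      exact hσ _
  refine ⟨L, hL, ?_⟩
  have hfam := hL.family hx
  have hb := hfam.add_fstVec_le hx.1.1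
  refine hCF.weakPref_of_le hb hy.1.1 (hCF.choice_le _ hb)
    (hCF.weakPref_of_forall hb hy.1 fun e he => ?_)
  rcases Nat.eq_zero_or_pos (fstVec L.toFinset 1 e) with h0 | h0
  · exact hCF.weakPref_of_le hx.1.1 hy.1.1 (single_le (by simp [h0])) hxy
  · obtain ⟨p, hp, rfl⟩ := fstVec_pos h0
    obtain ⟨q, rfl⟩ := hmem p (Cycle.mem_toFinset_iff.1 hp)
    refine hCF.weakPref_of_le (add_single_le hx.1.1 q.2.2.1.1) hy.1.1 (single_le ?_) q.2.2.2.1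
    simp [fstVec_of_mem hfam.injOn_fst hp]

end

end SGAM

/-! ### Persistence of rotations -/

/-- A common tandem of two stable vectors is a tandem of their meet. -/
theorem IsStablePair.tandem_choice {ι : Type*} [Fintype ι] [DecidableEq ι] {b : ι → ℕ}
    {C D : (ι → ℕ) → (ι → ℕ)} (hC : IsChoiceFunction b C) (hD : IsChoiceFunction b D)
    {x y : ι → ℕ} (hx : IsStablePair b C D x) (hy : IsStablePair b C D y) {a c : ι}
    (htx : IsTandem b C x a c) (hty : IsTandem b C y a c) :
    IsTandem b C (D (x ⊔ y)) a c := by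
  have hm := IsStablePair.acceptable_choice hC hD hx hy
  have hmx := IsStablePair.weakPref_choice_left hC hD hx hy
  have hmy := IsStablePair.weakPref_choice_right hC hD hx hy
  obtain ⟨d, hd⟩ := hC.exists_tandem_of_weakPref hm hx.1 hmx
    (IsStablePair.sum_choice hC hD hx hy).ge htx
  suffices hdc : d = c from hdc ▸ hd
  by_contra hdc
  have hma : D (x ⊔ y) + Pi.single a 1 ≤ b := add_single_le hm.1 hd.1
  have key : ∀ {z : ι → ℕ}, Acceptable b C z → WeakPref C (D (x ⊔ y)) z → IsTandem b C z a c →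
      z d < D (x ⊔ y) d := by
    intro z hz hmz htz
    have hza : z + Pi.single a 1 ≤ b := add_single_le hz.1 htz.1
    have h1 := hC.min_le_choice_of_weakPref hma (hC.le_cap hza)
      (hC.tandem_of_weakPref hm hz hmz htz).2 d
    have h2 := congrFun htz.2.2.2 d
    have h3 := congrFun hd.2.2.2 d
    have h4 := hd.2.1
    simp [hd.2.2.1, hdc] at h1 h2 h3
    omega
  have h1 := key hx.1 hmx htx
  have h2 := key hy.1 hmy hty
  have h3 := IsStablePair.choice_apply_eq_or hC hD hx hy d
  omega

namespace SGAM

section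

variable {W F E : Type*} [Fintype E] [DecidableEq W] [DecidableEq F] [DecidableEq E]
  {M : SGAM W F E} {x y z : E → ℕ} {L L' : Cycle (E × E)}

/-- The result of shifting along `L` with weight one. It is defined as the choice of the firms
from `x + χ^{L⁺}`; for a rotation this is `x + χ^{L⁺} - χ^{L⁻}`. -/
def shiftVec (M : SGAM W F E) (x : E → ℕ) (L : Cycle (E × E)) : E → ℕ :=
  M.gF (x + fstVec L.toFinset 1)

namespace IsRotation

theorem shiftVec_add (hx : IsStablePair M.cap M.gF M.gW x) (hL : M.IsRotation x L) :
    M.shiftVec x L + sndVec L.toFinset 1 = x + fstVec L.toFinset 1 :=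
  (hL.family hx).choice_add M.gF_spec hx.1

theorem weakPref_shift (hx : IsStablePair M.cap M.gF M.gW x) (hL : M.IsRotation x L) :
    WeakPref M.gF (x + fstVec L.toFinset 1) (M.shiftVec x L) :=
  M.gF_spec.weakPref_choice ((hL.family hx).add_fstVec_le hx.1.1)

theorem weakPref_self_shift (hx : IsStablePair M.cap M.gF M.gW x) (hL : M.IsRotation x L) :
    WeakPref M.gF x (M.shiftVec x L) :=
  M.gF_spec.weakPref_of_le ((hL.family hx).add_fstVec_le hx.1.1)
    (hL.isStablePair_shift hx).1.1 (fun e => by simp) (hL.weakPref_shift hx)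

theorem transfer (hx : IsStablePair M.cap M.gF M.gW x) (hL : M.IsRotation x L)
    (hy : IsStablePair M.cap M.gF M.gW y)
    (h : ∀ p ∈ L, M.Adm y p.1 ∧ IsTandem M.cap M.gF y p.1 p.2) : M.IsRotation y L := by
  have := (isRotation_iff hx).1 hL
  exact (isRotation_iff hy).2 ⟨this.1, this.2.1, h, this.2.2.2⟩

/-- A rotation stays a rotation in a more preferred vector where it consists of tandems. -/
theorem of_weakPref (hx : IsStablePair M.cap M.gF M.gW x) (hL : M.IsRotation x L)
    (hy : IsStablePair M.cap M.gF M.gW y) (hxy : WeakPref M.gF x y)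
    (h : ∀ p ∈ L, IsTandem M.cap M.gF y p.1 p.2) : M.IsRotation y L :=
  hL.transfer hx hy fun p hp => ⟨(hL.adm hx hp).mono hx.1 hy.1 hxy
    (tandem_interesting hy.1.1 (h p hp)), h p hp⟩

/-- The edges of different rotations have different workers. -/
theorem worker_ne (hx : IsStablePair M.cap M.gF M.gW x) (hL : M.IsRotation x L)
    (hL' : M.IsRotation x L') (hne : L ≠ L') {p q : E × E} (hp : p ∈ L) (hq : q ∈ L') :
    (M.worker p.1 ≠ M.worker q.1 ∧ M.worker p.1 ≠ M.worker q.2) ∧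
      (M.worker p.2 ≠ M.worker q.1 ∧ M.worker p.2 ≠ M.worker q.2) := by
  have key : ∀ {p q : E × E}, p ∈ L → q ∈ L' → M.worker p.1 ≠ M.worker q.1 :=
    fun hp hq h => hne (hL.eq_of_worker hx hL' hp hq h)
  obtain ⟨p', hp', hpp⟩ := hL.2.2.2.exists_next hp
  obtain ⟨q', hq', hqq⟩ := hL'.2.2.2.exists_next hq
  rw [hpp, hqq]
  exact ⟨⟨key hp hq, key hp hq'⟩, key hp' hq, key hp' hq'⟩

/-- Different rotations can be applied one after the other. -/
theorem shift_of_ne (hx : IsStablePair M.cap M.gF M.gW x) (hL : M.IsRotation x L)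
    (hL' : M.IsRotation x L') (hne : L ≠ L') : M.IsRotation (M.shiftVec x L) L' := by
  refine hL'.of_weakPref hx (hL.isStablePair_shift hx) (hL.weakPref_self_shift hx) fun p hp => ?_
  have hdis : ∀ q ∈ L, p.1 ≠ q.1 ∧ p.2 ≠ q.2 := fun q hq =>
    ⟨fun h => (hL.worker_ne hx hL' hne hq hp).1.1 (congrArg M.worker h.symm),
      fun h => (hL.worker_ne hx hL' hne hq hp).2.2 (congrArg M.worker h.symm)⟩
  have hpL : p ∉ L.toFinset := fun h => (hdis p (Cycle.mem_toFinset_iff.1 h)).1 rfl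
  have ht : ∀ q ∈ insert p L.toFinset, IsTandem M.cap M.gF x q.1 q.2 := by
    intro q hq
    rcases Finset.mem_insert.1 hq with rfl | hq
    · exact hL'.tandem hx hp
    · exact hL.tandem hx (Cycle.mem_toFinset_iff.1 hq)
  refine (isReplacementFamily_of_tandem ht ?_ ?_).tandem_choice M.gF_spec hx.1 hpL
    (hL'.tandem hx hp)
  · rw [Finset.coe_insert, Set.injOn_insert (by exact_mod_cast hpL)]
    refine ⟨hL.injOn_fst hx, ?_⟩
    rintro ⟨q, hq, h⟩
    exact (hdis q (Cycle.mem_toFinset_iff.1 hq)).1 h.symm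
  · rw [Finset.coe_insert, Set.injOn_insert (by exact_mod_cast hpL)]
    refine ⟨hL.injOn_snd hx, ?_⟩
    rintro ⟨q, hq, h⟩
    exact (hdis q (Cycle.mem_toFinset_iff.1 hq)).2 h.symm

/-- Shifts along different rotations have the double shift as their join. -/
theorem shift_shift_le (hx : IsStablePair M.cap M.gF M.gW x) (hL : M.IsRotation x L)
    (hL' : M.IsRotation x L') (hne : L ≠ L') (hy : IsStablePair M.cap M.gF M.gW y)
    (h₁ : WeakPref M.gF (M.shiftVec x L) y) (h₂ : WeakPref M.gF (M.shiftVec x L') y) :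
    WeakPref M.gF (M.shiftVec (M.shiftVec x L) L') y := by
  have hx₁ := hL.isStablePair_shift hx
  have hx₂ := hL'.isStablePair_shift hx
  have hL₁ := hL.shift_of_ne hx hL' hne
  have hb := (hL₁.family hx₁).add_fstVec_le hx₁.1.1
  have hsup := sup_le hx₁.1.1 hx₂.1.1
  refine M.gF_spec.weakPref_of_le hsup hy.1.1 ((M.gF_spec.choice_le _ hb).trans ?_)
    (M.gF_spec.weakPref_sup hx₁.1.1 hx₂.1.1 hy.1.1 h₁ h₂)
  intro e
  rcases Nat.eq_zero_or_pos (fstVec L'.toFinset 1 e) with h0 | h0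
  · simp only [Pi.add_apply, h0, add_zero]
    exact le_sup_left (a := M.shiftVec x L e)
  · obtain ⟨p, hp, rfl⟩ := fstVec_pos h0
    have hp' := Cycle.mem_toFinset_iff.1 hp
    have e₁ := congrFun (hL.shiftVec_add hx) p.1
    have e₂ := congrFun (hL'.shiftVec_add hx) p.1
    have f₁ : fstVec L.toFinset 1 p.1 = 0 := by
      by_contra hpos
      obtain ⟨q, hq, h⟩ := fstVec_pos (Nat.pos_of_ne_zero hpos)
      exact (hL.worker_ne hx hL' hne (Cycle.mem_toFinset_iff.1 hq) hp').1.1 (congrArg M.worker h)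
    have f₂ : sndVec L'.toFinset 1 p.1 = 0 := by
      by_contra hpos
      obtain ⟨q, hq, h⟩ := sndVec_pos (Nat.pos_of_ne_zero hpos)
      exact (hL'.family hx).fst_ne_snd M.gF_spec hx.1 hp hq one_pos one_pos h.symm
    simp only [Pi.add_apply, f₁, f₂] at e₁ e₂
    refine le_trans ?_ (le_sup_right (a := M.shiftVec x L p.1))
    show M.shiftVec x L p.1 + fstVec L'.toFinset 1 p.1 ≤ M.shiftVec x L' p.1
    omega

/-- By the gapless condition, the vectors under which `L` is a rotation form a convex set. -/
theorem of_between (hG : WeaklyGapless M.cap M.gF) (hx : IsStablePair M.cap M.gF M.gW x)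
    (hy : IsStablePair M.cap M.gF M.gW y) (hz : IsStablePair M.cap M.gF M.gW z)
    (hLx : M.IsRotation x L) (hLz : M.IsRotation z L) (hxy : WeakPref M.gF x y)
    (hyz : WeakPref M.gF y z) : M.IsRotation y L := by
  refine hLx.of_weakPref hx hy hxy fun p hp => ?_
  obtain ⟨c, hc⟩ := M.gF_spec.exists_tandem_of_weakPref hy.1 hz.1 hyz
    (IsStablePair.sum_eq M.gF_spec M.gW_spec hz hy).le (hLz.tandem hz hp)
  exact (hG x y z _ _ _ hx.1 hy.1 hz.1 hxy hyz (hLx.tandem hx hp) hc (hLz.tandem hz hp)) ▸ hc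

/-- The vectors under which `L` is a rotation are closed under meets. -/
theorem inf (hx : IsStablePair M.cap M.gF M.gW x) (hy : IsStablePair M.cap M.gF M.gW y)
    (hLx : M.IsRotation x L) (hLy : M.IsRotation y L) : M.IsRotation (M.gW (x ⊔ y)) L := by
  have hm := IsStablePair.isStablePair_choice M.gF_spec M.gW_spec hx hy
  refine hLx.transfer hx hm fun p hp => ?_
  have ht := IsStablePair.tandem_choice M.gF_spec M.gW_spec hx hy (hLx.tandem hx hp)
    (hLy.tandem hy hp)
  refine ⟨⟨tandem_interesting hm.1.1 ht, fun e he => ?_, (hLx.adm hx hp).2.2⟩, ht⟩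
  rcases IsStablePair.interesting_or M.gF_spec M.gW_spec hx hy he with h | h
  · exact (hLx.adm hx hp).2.1 e h
  · exact (hLy.adm hy hp).2.1 e h

/-- By the gapless condition, a shift along `L` after which `L` is still a rotation does not
create other rotations. -/
theorem of_shift (hG : WeaklyGapless M.cap M.gF) (hx : IsStablePair M.cap M.gF M.gW x)
    (hL : M.IsRotation x L) (hL₁ : M.IsRotation (M.shiftVec x L) L)
    (hL' : M.IsRotation (M.shiftVec x L) L') (hne : L ≠ L') : M.IsRotation x L' := by
  have hx₁ := hL.isStablePair_shift hx
  have hT : ∀ p ∈ L.toFinset, IsTandem M.cap M.gF x p.1 p.2 := fun p hp =>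
    hL.tandem hx (Cycle.mem_toFinset_iff.1 hp)
  have hT₁ : ∀ p ∈ L.toFinset, IsTandem M.cap M.gF (M.shiftVec x L) p.1 p.2 := fun p hp =>
    hL₁.tandem hx₁ (Cycle.mem_toFinset_iff.1 hp)
  refine hL'.transfer hx₁ hx fun p hp => ?_
  have hdis : ∀ q ∈ L.toFinset, _ := fun q hq =>
    hL₁.worker_ne hx₁ hL' hne (Cycle.mem_toFinset_iff.1 hq) hp
  have ht : IsTandem M.cap M.gF x p.1 p.2 :=
    hG.tandem_of_family M.gF_spec
      (fun q hq => ⟨fun h => (hdis q hq).1.1 (congrArg M.worker h.symm),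
        fun h => (hdis q hq).2.1 (congrArg M.worker h.symm)⟩)
      (fun q hq => ⟨fun h => (hdis q hq).1.2 (congrArg M.worker h.symm),
        fun h => (hdis q hq).2.2 (congrArg M.worker h.symm)⟩)
      hx.1 (hL.family hx) hT rfl (hL'.tandem hx₁ hp) hT₁
  have hadm := hL'.adm hx₁ hp
  exact ⟨⟨tandem_interesting hx.1.1 ht, fun e he => hadm.2.1 e
    (hG.interesting_of_family M.gF_spec hx.1 (hL.family hx) hT rfl hT₁ e he), hadm.2.2⟩, ht⟩

/-! ### Feasible weights -/

theorem feasible_iff (hx : IsStablePair M.cap M.gF M.gW x) (hL : M.IsRotation x L) {l : ℕ} :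
    M.Feasible x L l ↔
      0 < l ∧ IsReplacementFamily M.cap M.gF x L.toFinset (fun _ => l) := by
  constructor
  · rintro ⟨h1, h2, h3, h4⟩
    refine ⟨h1, ⟨fun p hp => ?_, fun p hp => ?_, fun p hp => ?_, hL.injOn_fst hx,
      hL.injOn_snd hx⟩⟩
    · exact h3 p.1 ⟨p.2, Cycle.mem_toFinset_iff.1 hp⟩
    · exact (hL.tandem hx (Cycle.mem_toFinset_iff.1 hp)).2.2.1
    · obtain ⟨h, h5⟩ := h4 p.1 p.2 (Cycle.mem_toFinset_iff.1 hp)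
      exact (choice_add_single_glueChoice_iff M.firm M.choice hx.1.2 ⟨p.1, rfl⟩ ⟨p.2, h⟩ l).1 h5
  · rintro ⟨h1, h2⟩
    refine ⟨h1, ?_, ?_, fun a c hac => ?_⟩
    · rintro c ⟨a, hac⟩
      have := h2.choice_apply_snd (Cycle.mem_toFinset_iff.2 hac)
      simp only at this
      omega
    · rintro a ⟨c, hac⟩
      exact h2.cap _ (Cycle.mem_toFinset_iff.2 hac)
    · have h3 := h2.choice _ (Cycle.mem_toFinset_iff.2 hac)
      have h4 := glueChoice_same_fibre M.firm M.choice h1 hx.1.2 h3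
      exact ⟨h4, (choice_add_single_glueChoice_iff M.firm M.choice hx.1.2 ⟨a, rfl⟩
        ⟨c, h4⟩ l).2 h3⟩

theorem indicator_posEdges (hx : IsStablePair M.cap M.gF M.gW x) (hL : M.IsRotation x L) (l : ℕ) :
    (posEdges L).indicator (fun _ => l) = fstVec L.toFinset (fun _ => l) := by
  funext e
  by_cases he : e ∈ posEdges L
  · rw [Set.indicator_of_mem he]
    obtain ⟨c, hc⟩ := he
    exact (fstVec_of_mem (k := fun _ => l) (hL.injOn_fst hx) (Cycle.mem_toFinset_iff.2 hc)).symm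
  · rw [Set.indicator_of_notMem he]
    by_contra h0
    obtain ⟨p, hp, rfl⟩ := fstVec_pos (Nat.pos_of_ne_zero (Ne.symm h0))
    exact he ⟨p.2, Cycle.mem_toFinset_iff.1 hp⟩

theorem indicator_negEdges (hx : IsStablePair M.cap M.gF M.gW x) (hL : M.IsRotation x L) (l : ℕ) :
    (negEdges L).indicator (fun _ => l) = sndVec L.toFinset (fun _ => l) := by
  funext e
  by_cases he : e ∈ negEdges L
  · rw [Set.indicator_of_mem he]
    obtain ⟨c, hc⟩ := he
    exact (sndVec_of_mem (k := fun _ => l) (hL.injOn_snd hx) (Cycle.mem_toFinset_iff.2 hc)).symm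
  · rw [Set.indicator_of_notMem he]
    by_contra h0
    obtain ⟨p, hp, rfl⟩ := sndVec_pos (Nat.pos_of_ne_zero (Ne.symm h0))
    exact he ⟨p.1, Cycle.mem_toFinset_iff.1 hp⟩

/-- After a shift with weight one along a rotation, feasibility of the weight `l + 1` turns into
feasibility of the weight `l`. -/
theorem family_shift (hx : IsStablePair M.cap M.gF M.gW x) (hL : M.IsRotation x L) {l : ℕ}
    (h : IsReplacementFamily M.cap M.gF x L.toFinset (fun _ => l + 1)) :
    IsReplacementFamily M.cap M.gF (M.shiftVec x L) L.toFinset (fun _ => l) := by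
  have hCF := M.gF_spec
  have hfam := hL.family hx
  have hadd := hL.shiftVec_add hx
  refine ⟨fun p hp => ?_, h.ne, fun p hp => ?_, h.injOn_fst, h.injOn_snd⟩
  · have h1 := congrFun hadd p.1
    have h2 := h.cap p hp
    have h3 := fstVec_of_mem (k := 1) (hL.injOn_fst hx) hp
    simp only [Pi.add_apply, h3, Pi.one_apply] at h1 h2 ⊢
    omega
  · have hk : IsReplacementFamily M.cap M.gF x L.toFinset (1 + Pi.single p l) := by
      have hle : ∀ q, (1 + Pi.single p l : E × E → ℕ) q ≤ l + 1 := by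
        intro q
        by_cases hq : q = p
        · subst hq; simp [add_comm]
        · simp [hq]
      refine ⟨fun q hq => ?_, h.ne, fun q hq => ?_, h.injOn_fst, h.injOn_snd⟩
      · have := h.cap q hq
        have := hle q
        omega
      · exact hCF.choice_add_of_le hx.1 (hle q) (h.cap q hq) (h.ne q hq) (h.choice q hq)
    have h1 := hk.choice_add hCF hx.1
    have hb := hk.add_fstVec_le hx.1.1
    rw [fstVec_add, fstVec_single hp, ← add_assoc] at h1 hb
    rw [sndVec_add, sndVec_single hp] at h1
    have h2 := hfam.choice_choice_add hCF hx.1 (β := Pi.single p.1 l) hb fun q hq =>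
      by simp [(hfam.fst_ne_snd hCF hx.1 hp hq one_pos one_pos).symm]
    show M.gF (M.gF (x + fstVec L.toFinset 1) + Pi.single p.1 l) + _ = _
    rw [h2]
    refine add_right_cancel (b := sndVec L.toFinset 1) ?_
    rw [add_right_comm, add_assoc, h1, ← hadd, add_right_comm]

theorem shift_of_family (hx : IsStablePair M.cap M.gF M.gW x) (hL : M.IsRotation x L) {l : ℕ}
    (hl : 0 < l) (h : IsReplacementFamily M.cap M.gF x L.toFinset (fun _ => l + 1)) :
    M.IsRotation (M.shiftVec x L) L := by
  have hx₁ : IsStablePair M.cap M.gF M.gW (M.shiftVec x L) := hL.isStablePair_shift hx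
  have h1 := hL.family_shift hx h
  refine hL.of_weakPref hx hx₁ (hL.weakPref_self_shift hx) fun p hp => ?_
  have hp' := Cycle.mem_toFinset_iff.2 hp
  have h2 := M.gF_spec.choice_add_of_le hx₁.1 (show 1 ≤ l from hl) (h1.cap p hp') (h1.ne p hp')
    (h1.choice p hp')
  refine ⟨?_, ?_, h1.ne p hp', h2⟩
  · have := h1.cap p hp'
    omega
  · have := congrFun h2 p.2
    simp [h1.ne p hp'] at this
    omega

/-- By the gapless condition, consecutive shifts along `L` combine into a feasible one. -/
theorem family_succ (hG : WeaklyGapless M.cap M.gF) (hx : IsStablePair M.cap M.gF M.gW x)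
    (hL : M.IsRotation x L) {l : ℕ}
    (h : IsReplacementFamily M.cap M.gF x L.toFinset (fun _ => l))
    (hy : IsStablePair M.cap M.gF M.gW y) (hLy : M.IsRotation y L)
    (hxy : y + sndVec L.toFinset (fun _ => l) = x + fstVec L.toFinset (fun _ => l)) :
    IsReplacementFamily M.cap M.gF x L.toFinset (fun _ => l + 1) := by
  have hCF := M.gF_spec
  have hb := h.add_fstVec_le hx.1.1
  have hy_eq : M.gF (x + fstVec L.toFinset fun _ => l) = y :=
    add_right_cancel ((h.choice_add hCF hx.1).trans hxy.symm)
  have hdom : WeakPref M.gF (x + fstVec L.toFinset fun _ => l) y :=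
    hy_eq ▸ hCF.weakPref_choice hb
  -- the result of performing a single pair of `L` with weight `l` lies between `x` and `y`
  have key : ∀ p ∈ L.toFinset, IsTandem M.cap M.gF (M.gF (x + Pi.single p.1 l)) p.1 p.2 := by
    intro p hp
    have hp' := Cycle.mem_toFinset_iff.1 hp
    have hle := h.add_single_le_add_fstVec hp
    have hu := hCF.acceptable (hle.trans hb)
    have hxu : WeakPref M.gF x (M.gF (x + Pi.single p.1 l)) :=
      hCF.weakPref_of_le (hle.trans hb) hu.1 (fun e => by simp) (hCF.weakPref_choice (hle.trans hb))
    have huy : WeakPref M.gF (M.gF (x + Pi.single p.1 l)) y :=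
      hCF.weakPref_of_le hb hy.1.1 ((hCF.choice_le _ (hle.trans hb)).trans hle) hdom
    have hs : ∑ e, y e ≤ ∑ e, M.gF (x + Pi.single p.1 l) e := by
      have h1 := hCF.size_monotonicity _ x (hle.trans hb) (fun e => by simp)
      rw [hx.1.2] at h1
      have h2 := IsStablePair.sum_eq hCF M.gW_spec hx hy
      omega
    obtain ⟨c, hc⟩ := hCF.exists_tandem_of_weakPref hu hy.1 huy hs (hLy.tandem hy hp')
    exact (hG _ _ _ _ _ _ hx.1 hu hy.1 hxu huy (hL.tandem hx hp') hc (hLy.tandem hy hp')) ▸ hc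
  have hval : ∀ p ∈ L.toFinset, M.gF (x + Pi.single p.1 l) p.1 = x p.1 + l := by
    intro p hp
    have := congrFun (h.choice p hp) p.1
    simpa [(h.ne p hp).symm] using this
  have hcap : ∀ p ∈ L.toFinset, x p.1 + (l + 1) ≤ M.cap p.1 := by
    intro p hp
    have h1 := (key p hp).1
    rw [hval p hp] at h1
    omega
  refine ⟨hcap, h.ne, fun p hp => ?_, h.injOn_fst, h.injOn_snd⟩
  have h3 : x + Pi.single p.1 (l + 1) = x + Pi.single p.1 l + Pi.single p.1 1 := by
    rw [add_assoc, ← Pi.single_add]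
  have h4 : M.gF (x + Pi.single p.1 (l + 1))
      = M.gF (M.gF (x + Pi.single p.1 l) + Pi.single p.1 1) := by
    rw [h3]
    refine (hCF.choice_choice_add ?_ fun e he => ?_).symm
    · rw [← h3]; exact add_single_le hx.1.1 (hcap p hp)
    · have : e = p.1 := by
        by_contra hne; simp [hne] at he
      subst this
      rw [hval p hp]; simp
  rw [h4, h3, add_comm l 1, Pi.single_add, ← add_assoc, (key p hp).2.2.2, add_right_comm,
    h.choice p hp]

end IsRotation

end

end SGAM

/-! ### Lattices with labelled steps -/

/-- A lattice with labelled elementary steps `U x L y` ("the step from `x` with label `L` leads to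
`y`"). The axioms are those properties of stable g-allocations and their shifts with weight one
from which the representation by closed functions follows: `diamond` says that different steps
commute and have a join, `convex` and `inf` that the elements from which a label can be used form
a convex set closed under meets, and `back` that a step after which its label can be used again
creates no new labels. -/
structure StepSystem {S Λ : Type*} [Lattice S] (U : S → Λ → S → Prop) : Prop where
  lt : ∀ {x L y}, U x L y → x < y
  det : ∀ {x L y y'}, U x L y → U x L y' → y = y'
  exists_step : ∀ {x y}, x < y → ∃ L x', U x L x' ∧ x' ≤ y
  diamond : ∀ {x L L' y y'}, U x L y → U x L' y' → L ≠ L' →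
    ∃ z, U y L' z ∧ U y' L z ∧ ∀ t, y ≤ t → y' ≤ t → z ≤ t
  convex : ∀ {x y z L}, (∃ x', U x L x') → (∃ z', U z L z') → x ≤ y → y ≤ z → ∃ y', U y L y'
  inf : ∀ {x y L}, (∃ x', U x L x') → (∃ y', U y L y') → ∃ z', U (x ⊓ y) L z'
  back : ∀ {x y L L'}, U x L y → (∃ y', U y L y') → (∃ y', U y L' y') → L ≠ L' →
    ∃ x', U x L' x'

/-- `StepPath U x y m`: there is a sequence of steps from `x` to `y` that uses each label `L`
exactly `m L` times. -/
inductive StepPath {S Λ : Type*} [DecidableEq Λ] (U : S → Λ → S → Prop) : S → S → (Λ → ℕ) → Prop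
  | nil (x : S) : StepPath U x x 0
  | cons {x x' y : S} {L : Λ} {m : Λ → ℕ} (h : U x L x') (hm : StepPath U x' y m) :
      StepPath U x y (Pi.single L 1 + m)

theorem StepPath.trans {S Λ : Type*} [DecidableEq Λ] {U : S → Λ → S → Prop} {x y z : S}
    {m m' : Λ → ℕ} (h : StepPath U x y m) (h' : StepPath U y z m') : StepPath U x z (m + m') := by
  induction h with
  | nil x => simpa using h'
  | cons h _ ih => rw [add_assoc]; exact .cons h (ih h')

namespace StepSystem

variable {S Λ : Type*} [Lattice S] [BoundedOrder S] [Finite S] [DecidableEq Λ]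
  {U : S → Λ → S → Prop} (hU : StepSystem U)
include hU

omit [BoundedOrder S] in
theorem exists_path {x y : S} (hxy : x ≤ y) : ∃ m, StepPath U x y m := by
  induction x using WellFoundedGT.induction with
  | ind x ih =>
    rcases hxy.eq_or_lt with rfl | hlt
    · exact ⟨0, .nil x⟩
    · obtain ⟨L, x', h, hle⟩ := hU.exists_step hlt
      obtain ⟨m, hm⟩ := ih x' (hU.lt h) hle
      exact ⟨_, .cons h hm⟩

omit [BoundedOrder S] [Finite S] in
theorem path_le {x y : S} {m : Λ → ℕ} (h : StepPath U x y m) : x ≤ y := by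
  induction h with
  | nil x => exact le_rfl
  | cons h _ ih => exact (hU.lt h).le.trans ih

omit [BoundedOrder S] in
/-- By the diamond property, the number of uses of each label depends on the ends only. -/
theorem path_unique {x y : S} {m m' : Λ → ℕ} (h : StepPath U x y m) (h' : StepPath U x y m') :
    m = m' := by
  induction x using WellFoundedGT.induction generalizing m m' with
  | ind x ih =>
    cases h with
    | nil =>
      cases h' with
      | nil => rfl
      | cons h₁ hm₁ => exact absurd ((hU.lt h₁).trans_le (hU.path_le hm₁)) (lt_irrefl _)
    | @cons _ x₁ _ L₁ m₁ h₁ hm₁ =>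
      cases h' with
      | nil => exact absurd ((hU.lt h₁).trans_le (hU.path_le hm₁)) (lt_irrefl _)
      | @cons _ x₂ _ L₂ m₂ h₂ hm₂ =>
        by_cases hL : L₁ = L₂
        · subst hL
          obtain rfl := hU.det h₁ h₂
          rw [ih x₁ (hU.lt h₁) hm₁ hm₂]
        · obtain ⟨z, hz₁, hz₂, hz⟩ := hU.diamond h₁ h₂ hL
          obtain ⟨n, hn⟩ := hU.exists_path (hz y (hU.path_le hm₁) (hU.path_le hm₂))
          rw [ih x₁ (hU.lt h₁) hm₁ (.cons hz₁ hn), ih x₂ (hU.lt h₂) hm₂ (.cons hz₂ hn),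
            add_left_comm]

/-- The number of uses of each label on the way from `⊥` to `x`. -/
noncomputable def count (x : S) : Λ → ℕ := (hU.exists_path (bot_le (a := x))).choose

theorem path_count (x : S) : StepPath U ⊥ x (hU.count x) :=
  (hU.exists_path (bot_le (a := x))).choose_spec

theorem count_of_path {x y : S} {m : Λ → ℕ} (h : StepPath U x y m) :
    hU.count y = hU.count x + m :=
  hU.path_unique (hU.path_count y) ((hU.path_count x).trans h)

theorem count_bot (L : Λ) : hU.count ⊥ L = 0 :=
  congrFun (hU.path_unique (hU.path_count ⊥) (.nil ⊥)) L

theorem count_step {x y : S} {L : Λ} (h : U x L y) : hU.count y = hU.count x + Pi.single L 1 :=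
  hU.count_of_path (m := Pi.single L 1) (by simpa using StepPath.cons h (.nil y))

theorem count_step_self {x y : S} {L : Λ} (h : U x L y) : hU.count y L = hU.count x L + 1 := by
  simp [hU.count_step h]

theorem count_step_of_ne {x y : S} {L L' : Λ} (h : U x L y) (hne : L' ≠ L) :
    hU.count y L' = hU.count x L' := by
  simp [hU.count_step h, hne]

theorem count_mono {x y : S} (hxy : x ≤ y) (L : Λ) : hU.count x L ≤ hU.count y L := by
  obtain ⟨m, hm⟩ := hU.exists_path hxy
  rw [hU.count_of_path hm]
  exact Nat.le_add_right _ _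

/-- A step that is used on some way to `y` can be taken at once. -/
theorem step_le {x x' y : S} {L : Λ} (h : U x L x') (hxy : x ≤ y)
    (hlt : hU.count x L < hU.count y L) : x' ≤ y := by
  induction x using WellFoundedGT.induction generalizing x' with
  | ind x ih =>
    have hne : x < y := hxy.lt_of_ne fun h => by simp [h] at hlt
    obtain ⟨L₁, x₁, h₁, hle⟩ := hU.exists_step hne
    by_cases hL : L = L₁
    · subst hL
      rwa [hU.det h h₁]
    · obtain ⟨z, hz₁, hz₂, -⟩ := hU.diamond h h₁ hL
      exact (hU.lt hz₁).le.trans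
        (ih x₁ (hU.lt h₁) hz₂ hle (by rwa [hU.count_step_of_ne h₁ hL]))

theorem count_le_count_iff {x y : S} : hU.count x ≤ hU.count y ↔ x ≤ y := by
  refine ⟨fun h => ?_, fun h L => hU.count_mono h L⟩
  by_contra hxy
  have hlt : x ⊓ y < x := inf_le_left.lt_of_ne fun h => hxy (inf_eq_left.1 h)
  obtain ⟨L, m, hm, hmx⟩ := hU.exists_step hlt
  have h1 := hU.count_step_self hm
  have h2 := hU.count_mono hmx L
  have h3 := hU.step_le hm inf_le_right (by have : hU.count x L ≤ hU.count y L := h L; omega)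
  exact (hU.lt hm).not_ge (le_inf hmx h3)

theorem exists_first_use {x y : S} {L : Λ} (hxy : x ≤ y) (hlt : hU.count x L < hU.count y L) :
    ∃ u u', x ≤ u ∧ U u L u' ∧ u' ≤ y ∧ hU.count u L = hU.count x L := by
  induction x using WellFoundedGT.induction with
  | ind x ih =>
    have hne : x < y := hxy.lt_of_ne fun h => by simp [h] at hlt
    obtain ⟨L₁, x₁, h₁, hle⟩ := hU.exists_step hne
    by_cases hL : L = L₁
    · subst hL
      exact ⟨x, x₁, le_rfl, h₁, hle, rfl⟩
    · have h2 := hU.count_step_of_ne h₁ hL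
      obtain ⟨u, u', hu, h3, h4, h5⟩ := ih x₁ (hU.lt h₁) hle (by rwa [h2])
      exact ⟨u, u', (hU.lt h₁).le.trans hu, h3, h4, h5.trans h2⟩

/-- A label that is partially used at `x` is available at `x`. -/
theorem exists_step_of_lt {x : S} {L : Λ} (h0 : 0 < hU.count x L)
    (h1 : hU.count x L < hU.count ⊤ L) : ∃ x', U x L x' := by
  obtain ⟨u, u', -, hu, hux, -⟩ := hU.exists_first_use (bot_le (a := x))
    (by rw [hU.count_bot]; exact h0)
  obtain ⟨v, v', hv, hv', -, -⟩ := hU.exists_first_use (le_top (a := x)) h1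
  exact hU.convex ⟨u', hu⟩ ⟨v', hv'⟩ ((hU.lt hu).le.trans hux) hv

/-- Among the elements from which `L` can be used for the first time, there is a least one. -/
theorem exists_least {L : Λ} (h : 0 < hU.count ⊤ L) :
    ∃ p, IsLeast {z | (∃ z', U z L z') ∧ hU.count z L = 0} p := by
  obtain ⟨u, u', -, hu, -, hu0⟩ := hU.exists_first_use (bot_le (a := (⊤ : S)))
    (by rw [hU.count_bot]; exact h)
  rw [hU.count_bot] at hu0
  obtain ⟨p, hp⟩ := Set.Finite.exists_minimal (Set.toFinite
    {z | (∃ z', U z L z') ∧ hU.count z L = 0}) ⟨u, ⟨u', hu⟩, hu0⟩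
  refine ⟨p, hp.1, fun z hz => ?_⟩
  have hinf : p ⊓ z ∈ {z | (∃ z', U z L z') ∧ hU.count z L = 0} := by
    refine ⟨hU.inf hp.1.1 hz.1, ?_⟩
    have := hU.count_mono (inf_le_left (a := p) (b := z)) L
    rw [hp.1.2] at this
    omega
  exact (hp.2 hinf inf_le_left).trans inf_le_right

omit [BoundedOrder S] in
/-- If `L` is used on the way to `p` and is still available at `p`, then its use can be moved to
the end of the way. -/
theorem exists_step_to {s s' p : S} {L : Λ} (h : U s L s') (hp : s' ≤ p) (hL : ∃ p', U p L p') :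
    ∃ u, U u L p := by
  induction s' using WellFoundedGT.induction generalizing s with
  | ind s' ih =>
    rcases hp.eq_or_lt with rfl | hlt
    · exact ⟨s, h⟩
    · obtain ⟨L₁, t, ht, htp⟩ := hU.exists_step hlt
      by_cases hne : L = L₁
      · subst hne
        exact ih t (hU.lt ht) ht htp
      · have hs' := hU.convex ⟨s', h⟩ hL (hU.lt h).le hp
        obtain ⟨r, hr⟩ := hU.back h hs' ⟨t, ht⟩ hne
        obtain ⟨z, hz, hz', -⟩ := hU.diamond h hr hne
        obtain rfl := hU.det hz ht
        exact ih z (hU.lt ht) hz' htp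

/-- Every label is used completely or not at all at the least element from which another label
can be used for the first time. -/
theorem count_least {L L' : Λ} {p : S}
    (hp : IsLeast {z | (∃ z', U z L' z') ∧ hU.count z L' = 0} p) (h0 : 0 < hU.count p L) :
    hU.count p L = hU.count ⊤ L := by
  by_contra hne
  have hlt := (hU.count_mono (le_top (a := p)) L).lt_of_ne hne
  have hL := hU.exists_step_of_lt h0 hlt
  have hLL : L ≠ L' := by
    rintro rfl
    rw [hp.1.2] at h0
    exact lt_irrefl _ h0
  obtain ⟨s, s', -, hs, hsp, -⟩ := hU.exists_first_use (bot_le (a := p))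
    (by rw [hU.count_bot]; exact h0)
  obtain ⟨u, hu⟩ := hU.exists_step_to hs hsp hL
  have h1 := hU.back hu hL hp.1.1 hLL
  have h2 := hU.count_step_of_ne hu hLL.symm
  exact (hU.lt hu).not_ge (hp.2 ⟨h1, h2.symm.trans hp.1.2⟩)

/-- If `L'` can be used while `L` is not completely used, then `L'` can be used completely without
using `L` at all. -/
theorem exists_saturated {x : S} {L L' : Λ} (hne : L ≠ L') (h' : 0 < hU.count x L')
    (h : hU.count x L < hU.count ⊤ L) :
    ∃ z, (∀ K, 0 < hU.count z K → hU.count z K = hU.count ⊤ K) ∧ hU.count z L = 0 ∧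
      0 < hU.count z L' := by
  obtain ⟨p, hp⟩ := hU.exists_least (h'.trans_le (hU.count_mono (le_top (a := x)) L'))
  obtain ⟨u, u', -, hu, hux, hu0⟩ := hU.exists_first_use (bot_le (a := x))
    (by rw [hU.count_bot]; exact h')
  rw [hU.count_bot] at hu0
  have hpx : p ≤ x := (hp.2 ⟨⟨u', hu⟩, hu0⟩).trans ((hU.lt hu).le.trans hux)
  obtain ⟨p', hp'⟩ := hp.1.1
  have hpL : hU.count p' L = 0 := by
    rw [hU.count_step_of_ne hp' hne]
    by_contra h0
    have h1 := hU.count_least hp (Nat.pos_of_ne_zero h0)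
    have h2 := hU.count_mono hpx L
    omega
  -- a maximal element above `p'` that uses only labels of `p'` uses them completely
  obtain ⟨z, hz⟩ := Set.Finite.exists_maximal (Set.toFinite
    {z | p' ≤ z ∧ ∀ K, 0 < hU.count z K → 0 < hU.count p' K}) ⟨p', le_rfl, fun _ h => h⟩
  refine ⟨z, fun K hK => ?_, ?_, ?_⟩
  · by_contra hKne
    obtain ⟨z', hz'⟩ := hU.exists_step_of_lt hK ((hU.count_mono (le_top (a := z)) K).lt_of_ne hKne)
    refine (hU.lt hz').not_ge (hz.2 ⟨hz.1.1.trans (hU.lt hz').le, fun K' hK' => ?_⟩ (hU.lt hz').le)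
    by_cases hKK : K' = K
    · exact hz.1.2 K' (hKK ▸ hK)
    · rw [hU.count_step_of_ne hz' hKK] at hK'
      exact hz.1.2 K' hK'
  · by_contra h0
    have := hz.1.2 L (Nat.pos_of_ne_zero h0)
    omega
  · have h1 := hU.count_mono hz.1.1 L'
    have h2 := hU.count_step_self hp'
    omega

/-- Every function that respects all precedences between the labels is the counting function of
some element. -/
theorem exists_count_eq {ξ : Λ → ℕ} (hξ : ξ ≤ hU.count ⊤)
    (hc : ∀ L L', (∀ z, (∃ z', U z L' z') → hU.count z L' = 0 → 0 < hU.count z L) →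
      0 < ξ L' → ξ L = hU.count ⊤ L) : ∃ x, hU.count x = ξ := by
  obtain ⟨x, hx⟩ := Set.Finite.exists_maximal (Set.toFinite {x | hU.count x ≤ ξ})
    ⟨⊥, fun L => (hU.count_bot L).trans_le (Nat.zero_le _)⟩
  refine ⟨x, le_antisymm hx.1 ?_⟩
  by_contra hnle
  -- some label that is missing at `x` is available at `x`: otherwise a label used before a missing
  -- one is missing as well, and its first use is earlier
  have key : ∀ p L, IsLeast {z | (∃ z', U z L z') ∧ hU.count z L = 0} p →
      hU.count x L < ξ L → ∃ L, hU.count x L < ξ L ∧ ∃ x', U x L x' := by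
    intro p
    induction p using WellFoundedLT.induction with
    | ind p ih =>
      intro L hp hlt
      by_cases hL : ∃ x', U x L x'
      · exact ⟨L, hlt, hL⟩
      have hlt' := hlt.trans_le (hξ L)
      have h0 : hU.count x L = 0 := by
        by_contra h0
        exact hL (hU.exists_step_of_lt (Nat.pos_of_ne_zero h0) hlt')
      have hpx : ¬ p ≤ x := fun hpx => by
        obtain ⟨v, v', hv, hv', -, -⟩ := hU.exists_first_use (le_top (a := x)) hlt'
        exact hL (hU.convex hp.1.1 ⟨v', hv'⟩ hpx hv)
      rw [← hU.count_le_count_iff, Pi.le_def] at hpx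
      push Not at hpx
      obtain ⟨L', hL'⟩ := hpx
      have h1 : ξ L' = hU.count ⊤ L' := hc L' L (fun z hz hz0 => by
        have := hU.count_mono (hp.2 ⟨hz, hz0⟩) L'
        omega) (by omega)
      have h2 := hU.count_mono (le_top (a := p)) L'
      obtain ⟨p', hp'⟩ := hU.exists_least (L := L') (by omega)
      obtain ⟨u, u', -, hu, hup, hu0⟩ := hU.exists_first_use (bot_le (a := p)) (L := L')
        (by rw [hU.count_bot]; exact (Nat.zero_le _).trans_lt hL')
      rw [hU.count_bot] at hu0
      exact ih p' ((hp'.2 ⟨⟨u', hu⟩, hu0⟩).trans_lt ((hU.lt hu).trans_le hup)) L' hp' (by omega)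
  rw [Pi.le_def] at hnle
  push Not at hnle
  obtain ⟨L, hL⟩ := hnle
  obtain ⟨p, hp⟩ := hU.exists_least (L := L) ((Nat.zero_le _).trans_lt (hL.trans_le (hξ L)))
  obtain ⟨K, hK, x', hx'⟩ := key p L hp hL
  refine (hU.lt hx').not_ge (hx.2 (fun K' => ?_) (hU.lt hx').le)
  by_cases hKK : K' = K
  · subst hKK
    rw [hU.count_step_self hx']
    exact hK
  · rw [hU.count_step_of_ne hx' hKK]
    exact hx.1 K'

end StepSystem

/-! ### The lattice of stable g-allocations -/

namespace SGAM

section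

variable {W F E : Type*} [Fintype E] [DecidableEq W] [DecidableEq F] {M : SGAM W F E}

theorem Stable.pair (x : M.Stable) : IsStablePair M.cap M.gF M.gW x.val :=
  M.isStable_iff.1 x.isStable

theorem Stable.val_injective : Function.Injective (Stable.val (M := M)) := by
  rintro ⟨x, _⟩ ⟨y, _⟩ rfl
  rfl

variable [DecidableEq E]

/-- The lattice structure of the set of stable g-allocations. The joint choice of the firms from
`x ⊔ y` is the join, and that of the workers is the meet. -/
noncomputable instance : Lattice M.Stable where
  le x y := M.leF x.val y.val
  le_refl x := M.leF_iff.2 (weakPref_refl x.pair.1)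
  le_trans x y z hxy hyz := M.leF_iff.2 (M.gF_spec.weakPref_trans x.pair.1.1 y.pair.1.1
    z.pair.1.1 (M.leF_iff.1 hxy) (M.leF_iff.1 hyz))
  le_antisymm x y hxy hyx :=
    Stable.val_injective (weakPref_antisymm (M.leF_iff.1 hxy) (M.leF_iff.1 hyx))
  sup x y := ⟨M.gF (x.val ⊔ y.val), M.isStable_iff.2
    (IsStablePair.isStablePair_choice M.gW_spec M.gF_spec x.pair.symm y.pair.symm).symm⟩
  le_sup_left x y := M.leF_iff.2 <|
    have hb := sup_le x.pair.1.1 y.pair.1.1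
    M.gF_spec.weakPref_of_le hb (M.gF_spec.le_cap hb) le_sup_left (M.gF_spec.weakPref_choice hb)
  le_sup_right x y := M.leF_iff.2 <|
    have hb := sup_le x.pair.1.1 y.pair.1.1
    M.gF_spec.weakPref_of_le hb (M.gF_spec.le_cap hb) le_sup_right (M.gF_spec.weakPref_choice hb)
  sup_le x y z hxz hyz := M.leF_iff.2 <|
    have hb := sup_le x.pair.1.1 y.pair.1.1
    M.gF_spec.weakPref_of_le hb z.pair.1.1 (M.gF_spec.choice_le _ hb)
      (M.gF_spec.weakPref_sup x.pair.1.1 y.pair.1.1 z.pair.1.1 (M.leF_iff.1 hxz) (M.leF_iff.1 hyz))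
  inf x y := ⟨M.gW (x.val ⊔ y.val), M.isStable_iff.2
    (IsStablePair.isStablePair_choice M.gF_spec M.gW_spec x.pair y.pair)⟩
  inf_le_left x y := M.leF_iff.2
    (IsStablePair.weakPref_choice_left M.gF_spec M.gW_spec x.pair y.pair)
  inf_le_right x y := M.leF_iff.2
    (IsStablePair.weakPref_choice_right M.gF_spec M.gW_spec x.pair y.pair)
  le_inf z x y hzx hzy := M.leF_iff.2 (IsStablePair.weakPref_inf M.gF_spec M.gW_spec x.pair y.pair
    z.pair (M.leF_iff.1 hzx) (M.leF_iff.1 hzy))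

theorem Stable.le_iff {x y : M.Stable} : x ≤ y ↔ WeakPref M.gF x.val y.val := M.leF_iff

instance : Finite M.Stable :=
  Finite.of_injective
    (fun (x : M.Stable) e => (⟨x.val e, Nat.lt_succ_of_le (x.pair.1.1 e)⟩ : Fin (M.cap e + 1)))
    fun _ _ h => Stable.val_injective (funext fun e => congrArg Fin.val (congrFun h e))

instance : Nonempty M.Stable :=
  (exists_isStablePair M.gF_spec M.gW_spec).elim fun x hx => ⟨⟨x, M.isStable_iff.2 hx⟩⟩

noncomputable instance : BoundedOrder M.Stable :=
  letI := Fintype.ofFinite M.Stable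
  Fintype.toBoundedOrder M.Stable

theorem isXMin_iff {x : M.Stable} : M.IsXMin x ↔ x = ⊥ := isBot_iff_eq_bot

theorem isXMax_iff {x : M.Stable} : M.IsXMax x ↔ x = ⊤ := isTop_iff_eq_top

theorem isFullRoute_iff {T : List (Cycle (E × E) × ℕ)} :
    M.IsFullRoute T ↔ M.IsNonExcessiveRoute (⊤ : M.Stable) ⊥ T := by
  constructor
  · rintro ⟨x, y, hx, hy, h⟩
    rwa [isXMin_iff.1 hx, isXMax_iff.1 hy] at h
  · exact fun h => ⟨⊥, ⊤, isXMin_iff.2 rfl, isXMax_iff.2 rfl, h⟩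

/-! ### Shifts with weight one -/

variable {x y z : M.Stable} {L : Cycle (E × E)} {l : ℕ}

/-- `y` is obtained from `x` by shifting along the rotation `L ∈ ℒ(x)` with weight one. -/
def UnitStep (M : SGAM W F E) (x : M.Stable) (L : Cycle (E × E)) (y : M.Stable) : Prop :=
  M.IsRotation x.val L ∧ y.val = M.shiftVec x.val L

theorem exists_unitStep_iff : (∃ y, M.UnitStep x L y) ↔ M.IsRotation x.val L :=
  ⟨fun ⟨_, h⟩ => h.1, fun h => ⟨⟨_, M.isStable_iff.2 (h.isStablePair_shift x.pair)⟩, h, rfl⟩⟩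

theorem UnitStep.val_add (h : M.UnitStep x L y) :
    y.val + sndVec L.toFinset 1 = x.val + fstVec L.toFinset 1 := by
  rw [h.2, h.1.shiftVec_add x.pair]

theorem Gapless.stepSystem (hC : M.Gapless) : StepSystem M.UnitStep where
  lt {x L y} h := by
    refine lt_of_le_of_ne (Stable.le_iff.2 (h.2 ▸ h.1.weakPref_self_shift x.pair)) ?_
    rintro rfl
    have h1 := add_left_cancel h.val_add
    obtain ⟨p, hp⟩ := Cycle.exists_mem_of_ne_nil h.1.1
    have h2 := fstVec_of_mem (k := 1) (h.1.injOn_fst x.pair) (Cycle.mem_toFinset_iff.2 hp)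
    obtain ⟨q, hq, hqp⟩ := sndVec_pos (T := L.toFinset) (k := 1) (e := p.1) (by rw [h1, h2]; simp)
    exact (h.1.family x.pair).fst_ne_snd M.gF_spec x.pair.1 (Cycle.mem_toFinset_iff.2 hp) hq
      one_pos one_pos hqp.symm
  det h h' := Stable.val_injective (h.2.trans h'.2.symm)
  exists_step {x y} h := by
    obtain ⟨L, hL, hle⟩ := exists_rotation_of_ne x.pair y.pair (Stable.le_iff.1 h.le)
      fun hxy => h.ne (Stable.val_injective hxy)
    obtain ⟨x', hx'⟩ := exists_unitStep_iff.2 hL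
    exact ⟨L, x', hx', Stable.le_iff.2 (hx'.2 ▸ hle)⟩
  diamond {x L L' y y'} h h' hne := by
    obtain ⟨z, hz⟩ := exists_unitStep_iff.2 (h.2 ▸ h.1.shift_of_ne x.pair h'.1 hne)
    obtain ⟨z', hz'⟩ := exists_unitStep_iff.2 (h'.2 ▸ h'.1.shift_of_ne x.pair h.1 hne.symm)
    have hzz : z = z' := by
      refine Stable.val_injective (add_right_cancel
        (b := sndVec L.toFinset 1 + sndVec L'.toFinset 1) ?_)
      rw [← add_assoc, ← add_assoc, add_right_comm, hz.val_add, add_right_comm, h.val_add,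
        hz'.val_add, add_right_comm y'.val, h'.val_add, add_right_comm]
    refine ⟨z, hz, hzz ▸ hz', fun t hyt hyt' => Stable.le_iff.2 ?_⟩
    rw [hz.2, h.2]
    exact h.1.shift_shift_le x.pair h'.1 hne t.pair (h.2 ▸ Stable.le_iff.1 hyt)
      (h'.2 ▸ Stable.le_iff.1 hyt')
  convex {x y z L} hx hz hxy hyz := exists_unitStep_iff.2 <|
    IsRotation.of_between (M.weaklyGapless hC) x.pair y.pair z.pair (exists_unitStep_iff.1 hx)
      (exists_unitStep_iff.1 hz) (Stable.le_iff.1 hxy) (Stable.le_iff.1 hyz)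
  inf {x y L} hx hy := exists_unitStep_iff.2 <|
    IsRotation.inf x.pair y.pair (exists_unitStep_iff.1 hx) (exists_unitStep_iff.1 hy)
  back {x y L L'} h hL hL' hne := by
    rw [exists_unitStep_iff, h.2] at hL hL'
    exact exists_unitStep_iff.2 (h.1.of_shift (M.weaklyGapless hC) x.pair hL hL' hne)

theorem UnitStep.shift (h : M.UnitStep x L y) : M.Shift x L 1 y := by
  refine ⟨h.1, (h.1.feasible_iff x.pair).2 ⟨one_pos, h.1.family x.pair⟩, ?_⟩
  rw [h.1.indicator_posEdges x.pair, h.1.indicator_negEdges x.pair]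
  exact h.val_add

/-- A shift decomposes into shifts with weight one. -/
theorem Shift.path (h : M.Shift x L l y) : StepPath M.UnitStep x y (Pi.single L l) := by
  induction l generalizing x with
  | zero => exact absurd h.2.1.1 (lt_irrefl _)
  | succ l ih =>
    obtain ⟨hL, hf, heq⟩ := h
    rw [hL.indicator_posEdges x.pair, hL.indicator_negEdges x.pair] at heq
    rw [hL.feasible_iff x.pair] at hf
    obtain ⟨x₁, hx₁⟩ := exists_unitStep_iff.2 hL
    have hy : y.val + sndVec L.toFinset (fun _ => l) = x₁.val + fstVec L.toFinset (fun _ => l) := by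
      refine add_right_cancel (b := sndVec L.toFinset 1) ?_
      rw [add_assoc, ← sndVec_add, add_right_comm, hx₁.val_add, add_assoc, ← fstVec_add,
        add_comm 1]
      exact heq
    rw [add_comm l 1, Pi.single_add]
    refine .cons hx₁ ?_
    rcases Nat.eq_zero_or_pos l with rfl | hl
    · have : y = x₁ := Stable.val_injective (by simpa [fstVec, sndVec] using hy)
      rw [this, Pi.single_zero]
      exact .nil x₁
    · have hL₁ : M.IsRotation x₁.val L := hx₁.2 ▸ hL.shift_of_family x.pair hl hf.2
      refine ih ⟨hL₁, (hL₁.feasible_iff x₁.pair).2 ⟨hl, hx₁.2 ▸ hL.family_shift x.pair hf.2⟩, ?_⟩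
      rw [hL₁.indicator_posEdges x₁.pair, hL₁.indicator_negEdges x₁.pair, hy]

/-- By the gapless condition, a shift can be prolonged as long as its rotation persists. -/
theorem Shift.succ (hC : M.Gapless) (h : M.Shift x L l y) (h' : M.UnitStep y L z) :
    M.Shift x L (l + 1) z := by
  obtain ⟨hL, hf, heq⟩ := h
  rw [hL.feasible_iff x.pair] at hf
  rw [hL.indicator_posEdges x.pair, hL.indicator_negEdges x.pair] at heq
  refine ⟨hL, (hL.feasible_iff x.pair).2 ⟨l.succ_pos, hL.family_succ (M.weaklyGapless hC) x.pair
    hf.2 y.pair h'.1 heq⟩, ?_⟩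
  rw [hL.indicator_posEdges x.pair, hL.indicator_negEdges x.pair]
  show z.val + sndVec L.toFinset ((fun _ => l) + 1) = x.val + fstVec L.toFinset ((fun _ => l) + 1)
  rw [sndVec_add, fstVec_add, ← add_assoc, ← add_assoc, ← heq, add_right_comm, h'.val_add,
    add_right_comm]

/-! ### Non-excessive routes -/

namespace Gapless

variable (hC : M.Gapless) {T : List (Cycle (E × E) × ℕ)}
include hC

/-- The total weight with which each rotation is used on the way from `x^min` to `x`. -/
noncomputable abbrev count (x : M.Stable) : Cycle (E × E) → ℕ := hC.stepSystem.count x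

theorem count_shift (h : M.Shift x L l y) : hC.count y L = hC.count x L + l := by
  simp [hC.stepSystem.count_of_path h.path]

theorem count_shift_of_ne (h : M.Shift x L l y) {L' : Cycle (E × E)} (hne : L' ≠ L) :
    hC.count y L' = hC.count x L' := by
  simp [hC.stepSystem.count_of_path h.path, hne]

theorem lt_of_shift (h : M.Shift x L l y) : x < y := by
  refine (hC.stepSystem.path_le h.path).lt_of_ne ?_
  rintro rfl
  have := hC.count_shift h
  have := h.2.1.1
  omega

/-- After a shift with the maximal weight that does not lead beyond `y`, the rotation is not
used any more on the way to `y`. -/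
theorem count_eq_of_maximal (h : M.Shift x L l z) (hzy : z ≤ y)
    (hmax : ∀ (m : ℕ) (z : M.Stable), M.Shift x L m z → M.leF z.val y.val → m ≤ l) :
    hC.count z L = hC.count y L := by
  have hU := hC.stepSystem
  by_contra hne
  have hlt := (hU.count_mono hzy L).lt_of_ne hne
  obtain ⟨u, u', hu, huu, -, -⟩ := hU.exists_first_use hzy hlt
  obtain ⟨v, hv⟩ := hU.convex (exists_unitStep_iff.2 h.1) ⟨u', huu⟩ (hC.lt_of_shift h).le hu
  exact absurd (hmax _ v (h.succ hC hv) (hU.step_le hv hzy hlt)) (Nat.not_succ_le_self l)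

theorem le_of_route (h : M.IsNonExcessiveRoute y x T) : x ≤ y := by
  induction h with
  | nil => exact le_rfl
  | cons x x' L l T hstep _ _ ih => exact (hC.lt_of_shift hstep).le.trans ih

theorem mem_route_iff (h : M.IsNonExcessiveRoute y x T) (L : Cycle (E × E)) (l : ℕ) :
    (L, l) ∈ T ↔ 0 < l ∧ hC.count y L = hC.count x L + l := by
  induction h with
  | nil => simp only [List.not_mem_nil, false_iff]; omega
  | cons x x' K k T hstep hmax hT ih =>
    have h1 := hC.count_eq_of_maximal hstep (hC.le_of_route hT) hmax
    have h2 := hC.count_shift hstep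
    have h3 := hstep.2.1.1
    rw [List.mem_cons, ih, Prod.mk.injEq]
    by_cases hK : L = K
    · subst hK
      simp only [true_and]
      omega
    · simp [hK, hC.count_shift_of_ne hstep hK]

theorem mem_map_fst_route_iff (h : M.IsNonExcessiveRoute y x T) (L : Cycle (E × E)) :
    L ∈ T.map Prod.fst ↔ hC.count x L < hC.count y L := by
  simp only [List.mem_map, Prod.exists, exists_and_right, exists_eq_right, hC.mem_route_iff h]
  constructor
  · rintro ⟨l, h1, h2⟩
    omega
  · exact fun h => ⟨hC.count y L - hC.count x L, by omega, by omega⟩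

theorem nodup_route (h : M.IsNonExcessiveRoute y x T) : (T.map Prod.fst).Nodup := by
  induction h with
  | nil => exact List.nodup_nil
  | cons x x' K k T hstep hmax hT ih =>
    rw [List.map_cons, List.nodup_cons, hC.mem_map_fst_route_iff hT]
    exact ⟨(hC.count_eq_of_maximal hstep (hC.le_of_route hT) hmax).not_lt, ih⟩

/-- Shifting greedily with maximal weights yields a non-excessive route. -/
theorem exists_route (hxy : x ≤ y) : ∃ T, M.IsNonExcessiveRoute y x T := by
  induction x using WellFoundedGT.induction with
  | ind x ih =>
    rcases hxy.eq_or_lt with rfl | hlt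
    · exact ⟨[], .nil⟩
    · obtain ⟨L, x₁, h₁, hle⟩ := hC.stepSystem.exists_step hlt
      have hbdd : BddAbove {l | ∃ z, M.Shift x L l z ∧ z ≤ y} := by
        refine ⟨hC.count y L, ?_⟩
        rintro l ⟨z, hz, hzy⟩
        have h1 := hC.count_shift hz
        have h2 : hC.count z L ≤ hC.count y L := hC.stepSystem.count_mono hzy L
        omega
      have hne : {l | ∃ z, M.Shift x L l z ∧ z ≤ y}.Nonempty := ⟨1, x₁, h₁.shift, hle⟩
      obtain ⟨z, hz, hzy⟩ := Nat.sSup_mem hne hbdd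
      obtain ⟨T, hT⟩ := ih z (hC.lt_of_shift hz) hzy
      exact ⟨_, .cons x z L _ T hz (fun m v hv hvy => le_csSup hbdd ⟨v, hv, hvy⟩) hT⟩

/-- A non-excessive route to an element at which each rotation is used completely or not at all
can be continued to a full route. -/
theorem route_append (hz : ∀ L, 0 < hC.count z L → hC.count z L = hC.count ⊤ L)
    (h : M.IsNonExcessiveRoute z x T) {T' : List (Cycle (E × E) × ℕ)}
    (h' : M.IsNonExcessiveRoute ⊤ z T') : M.IsNonExcessiveRoute ⊤ x (T ++ T') := by
  induction h with
  | nil => exact h'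
  | cons x x' L l T hstep hmax hT ih =>
    refine .cons x x' L l _ hstep (fun m v hv _ => ?_) ih
    have h1 := hC.count_eq_of_maximal hstep (hC.le_of_route hT) hmax
    have h2 := hC.count_shift hstep
    have h3 := hC.count_shift hv
    have h4 : hC.count v L ≤ hC.count ⊤ L := hC.stepSystem.count_mono le_top L
    have h5 := hstep.2.1.1
    have h6 := hz L (by omega)
    omega

/-- If `L'` can be used for the first time only after a use of `L`, then `L` occurs before `L'`
in each route. -/
theorem sublist_route {L' : Cycle (E × E)}
    (hLL : ∀ z : M.Stable, (∃ z', M.UnitStep z L' z') → hC.count z L' = 0 → 0 < hC.count z L)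
    (h : M.IsNonExcessiveRoute y x T) (hT : L' ∈ T.map Prod.fst) (h0 : hC.count x L' = 0)
    (h1 : hC.count x L = 0) : List.Sublist [L, L'] (T.map Prod.fst) := by
  induction h with
  | nil => simp at hT
  | cons x x' K k T hstep _ _ ih =>
    have hK : K ≠ L' := by
      rintro rfl
      exact (hLL x (exists_unitStep_iff.2 hstep.1) h0).ne' h1
    have hT' : L' ∈ T.map Prod.fst := by
      rw [List.map_cons, List.mem_cons] at hT
      exact hT.resolve_left hK.symm
    rw [List.map_cons]
    by_cases hKL : K = L
    · subst hKL
      exact (List.singleton_sublist.2 hT').cons_cons K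
    · exact (ih hT' ((hC.count_shift_of_ne hstep hK.symm).trans h0)
        ((hC.count_shift_of_ne hstep (Ne.symm hKL)).trans h1)).cons K

/-! ### The poset of rotations -/

theorem mem_rotations_iff : L ∈ M.rotations ↔ 0 < hC.count ⊤ L := by
  constructor
  · rintro ⟨T, hT, l, hl⟩
    have := (hC.mem_route_iff (isFullRoute_iff.1 hT) L l).1 hl
    omega
  · intro h
    obtain ⟨T, hT⟩ := hC.exists_route (bot_le (a := (⊤ : M.Stable)))
    refine ⟨T, isFullRoute_iff.2 hT, hC.count ⊤ L, (hC.mem_route_iff hT L _).2 ⟨h, ?_⟩⟩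
    have : hC.count ⊥ L = 0 := hC.stepSystem.count_bot L
    omega

theorem mem_fullRoute_iff (hT : M.IsFullRoute T) (L : Cycle (E × E)) (l : ℕ) :
    (L, l) ∈ T ↔ 0 < l ∧ hC.count ⊤ L = l := by
  have : hC.count ⊥ L = 0 := hC.stepSystem.count_bot L
  rw [hC.mem_route_iff (isFullRoute_iff.1 hT), this, zero_add]

/-- The set of weights whose supremum defines `τ` is a singleton. -/
theorem tau_eq (hL : L ∈ M.rotations) : M.tau L = hC.count ⊤ L := by
  have hset : {l | ∃ T, M.IsFullRoute T ∧ (L, l) ∈ T} = {hC.count ⊤ L} := by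
    refine Set.eq_singleton_iff_unique_mem.2 ⟨?_, ?_⟩
    · obtain ⟨T, hT, l, hl⟩ := hL
      exact ⟨T, hT, ((hC.mem_fullRoute_iff hT L l).1 hl).2 ▸ hl⟩
    · rintro l ⟨T, hT, hl⟩
      exact ((hC.mem_fullRoute_iff hT L l).1 hl).2.symm
  rw [tau, hset, csSup_singleton]

theorem exists_fullRoute : ∃ T, M.IsFullRoute T :=
  (hC.exists_route bot_le).imp fun _ => isFullRoute_iff.2

end Gapless

end

end SGAM

theorem List.mem_or_pair_sublist {α : Type*} {a b : α} {l₁ l₂ : List α}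
    (h : [a, b].Sublist (l₁ ++ l₂)) : a ∈ l₁ ∨ [a, b].Sublist l₂ := by
  obtain ⟨s₁, s₂, hs, h₁, h₂⟩ := List.sublist_append_iff.1 h
  cases s₁ with
  | nil => exact Or.inr ((List.nil_append s₂ ▸ hs) ▸ h₂)
  | cons c s =>
    obtain rfl : a = c := (List.cons.inj hs).1
    exact Or.inl (h₁.subset List.mem_cons_self)

/-- In a list without repetitions, the relation "occurs before" is transitive. -/
theorem List.Nodup.pair_sublist_trans {α : Type*} {a b c : α} {l : List α} (hl : l.Nodup)
    (hab : [a, b].Sublist l) (hbc : [b, c].Sublist l) : [a, c].Sublist l := by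
  obtain ⟨l₁, l₂, rfl, ha, hb⟩ := List.cons_sublist_iff.1 hab
  rcases List.mem_or_pair_sublist hbc with h | h
  · exact absurd (List.singleton_sublist.1 hb) (List.disjoint_of_nodup_append hl h)
  · exact (List.singleton_sublist.2 ha).append
      (List.singleton_sublist.2 (h.subset (by simp)))

namespace SGAM

section

variable {W F E : Type*} [Fintype E] [DecidableEq W] [DecidableEq F] [DecidableEq E]
  {M : SGAM W F E} (hC : M.Gapless)
include hC

theorem Gapless.isStrictOrder_precedes : IsStrictOrder M.rotations M.Precedes where
  irrefl L h := by
    obtain ⟨T, hT⟩ := hC.exists_fullRoute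
    have := (h T hT).nodup (hC.nodup_route (isFullRoute_iff.1 hT))
    simp at this
  trans L L' L'' h h' T hT :=
    (hC.nodup_route (isFullRoute_iff.1 hT)).pair_sublist_trans (h T hT) (h' T hT)

/-- If `L'` were used at `x` and `L` only partly, then there would be a full route in which all of
`L'` precedes the first use of `L`. -/
theorem Gapless.isClosedFunction_count (x : M.Stable) :
    M.IsClosedFunction fun L => hC.count x L := by
  refine ⟨fun L => ?_, fun L L' hLL hpos => ?_⟩
  · rw [hC.tau_eq L.2]
    exact hC.stepSystem.count_mono le_top _
  · rw [hC.tau_eq L.2]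
    by_contra hne
    obtain ⟨z, hz, hzL, hzL'⟩ := hC.stepSystem.exists_saturated (L := L.1) (L' := L'.1)
      (fun h => hC.isStrictOrder_precedes.irrefl L (by rwa [← Subtype.ext h] at hLL)) hpos
      ((hC.stepSystem.count_mono le_top _).lt_of_ne hne)
    obtain ⟨T, hT⟩ := hC.exists_route (bot_le (a := z))
    obtain ⟨T', hT'⟩ := hC.exists_route (le_top (a := z))
    have hfull := hC.route_append hz hT hT'
    have hsub := hLL _ (isFullRoute_iff.2 hfull)
    have hnodup := hC.nodup_route hfull
    rw [List.map_append] at hsub hnodup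
    rcases List.mem_or_pair_sublist hsub with h | h
    · rw [hC.mem_map_fst_route_iff hT] at h
      exact (Nat.zero_le _).not_gt (h.trans_eq hzL)
    · refine List.disjoint_of_nodup_append hnodup ((hC.mem_map_fst_route_iff hT _).2 ?_)
        (h.subset (List.mem_cons_of_mem _ List.mem_cons_self))
      rw [show hC.count ⊥ L'.1 = 0 from hC.stepSystem.count_bot _]
      exact hzL'

theorem Gapless.exists_count_eq {ξ : M.rotations → ℕ} (hξ : M.IsClosedFunction ξ) :
    ∃ x : M.Stable, (fun L : M.rotations => hC.count x L) = ξ := by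
  classical
  have hU := hC.stepSystem
  obtain ⟨η, hη⟩ : ∃ η : Cycle (E × E) → ℕ,
      η = fun L => if h : L ∈ M.rotations then ξ ⟨L, h⟩ else 0 := ⟨_, rfl⟩
  have hη_mem : ∀ {L} (h : L ∈ M.rotations), η L = ξ ⟨L, h⟩ := fun h => by simp [hη, h]
  have hη_notMem : ∀ {L}, L ∉ M.rotations → η L = 0 := fun h => by simp [hη, h]
  have hle : η ≤ hC.count ⊤ := fun L => by
    by_cases h : L ∈ M.rotations
    · rw [hη_mem h, ← hC.tau_eq h]
      exact hξ.1 _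
    · rw [hη_notMem h]
      exact Nat.zero_le _
  obtain ⟨x, hx⟩ := hU.exists_count_eq hle fun L L' hLL hpos => by
    have hL' : L' ∈ M.rotations := by
      by_contra h
      exact hpos.ne' (hη_notMem h)
    have hpos' := hC.mem_rotations_iff.1 hL'
    obtain ⟨u, u', -, hu, -, hu0⟩ := hU.exists_first_use (bot_le (a := (⊤ : M.Stable))) (L := L')
      (by rwa [hU.count_bot])
    have hL : L ∈ M.rotations := hC.mem_rotations_iff.2
      ((hLL u ⟨u', hu⟩ (hu0.trans (hU.count_bot L'))).trans_le (hU.count_mono le_top L))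
    rw [hη_mem hL'] at hpos
    refine (hη_mem hL).trans (Eq.trans (hξ.2 ⟨L, hL⟩ ⟨L', hL'⟩ (fun T hT => ?_) hpos)
      (hC.tau_eq hL))
    refine hC.sublist_route hLL (isFullRoute_iff.1 hT) ?_ (hU.count_bot L') (hU.count_bot L)
    rwa [hC.mem_map_fst_route_iff (isFullRoute_iff.1 hT),
      show hC.count ⊥ L' = 0 from hU.count_bot L']
  exact ⟨x, funext fun L => (congrFun hx L).trans (hη_mem L.2)⟩

/-- The isomorphism `ω`, which sends `x` to the weights of the rotations used on the way from
`x^min` to `x`. -/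
noncomputable def Gapless.countIso : M.Stable ≃o M.closedFunctions :=
  RelIso.ofSurjective
    (OrderEmbedding.ofMapLEIff
      (fun x => (⟨fun L => hC.count x L, hC.isClosedFunction_count x⟩ : M.closedFunctions))
      fun x y => by
        rw [← hC.stepSystem.count_le_count_iff]
        refine ⟨fun h L => ?_, fun h L => h L⟩
        by_cases hL : L ∈ M.rotations
        · exact h ⟨L, hL⟩
        · have h1 : hC.count x L ≤ hC.count ⊤ L := hC.stepSystem.count_mono le_top L
          rw [hC.mem_rotations_iff] at hL
          exact h1.trans ((not_lt.1 hL).trans (Nat.zero_le _)))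
    fun ξ => (hC.exists_count_eq ξ.2).imp fun _ h => Subtype.ext h

theorem Gapless.records {x : M.Stable} {T : List (Cycle (E × E) × ℕ)}
    (hT : M.IsNonExcessiveRoute x ⊥ T) : M.Records T fun L => hC.count x L := by
  have h0 : ∀ L, hC.count ⊥ L = 0 := hC.stepSystem.count_bot
  have hmem : ∀ L l, (L, l) ∈ T ↔ 0 < l ∧ hC.count x L = l := fun L l => by
    rw [hC.mem_route_iff hT, h0, zero_add]
  refine ⟨hC.nodup_route hT, fun p hp => ?_, fun L => ⟨fun l hl => ?_, fun h => ?_⟩⟩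
  · have h1 := (hmem p.1 p.2).1 hp
    have h2 : hC.count x p.1 ≤ hC.count ⊤ p.1 := hC.stepSystem.count_mono le_top _
    exact hC.mem_rotations_iff.2 (by omega)
  · exact ((hmem L l).1 hl).2
  · by_contra hne
    exact h _ ((hmem L _).2 ⟨Nat.pos_of_ne_zero hne, rfl⟩)

end

end SGAM

theorem theorem5p2 {W F E : Type*} [Fintype E] [DecidableEq W] [DecidableEq F] [DecidableEq E]
    (M : SGAM W F E) (hC : M.Gapless) :
    -- full routes exist; all of them use each rotation of `ℛ` once, with weight `τ`
    (∃ T, M.IsFullRoute T) ∧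
    (∀ T, M.IsFullRoute T → (T.map Prod.fst).Nodup ∧
      ∀ L l, (L, l) ∈ T ↔ L ∈ M.rotations ∧ l = M.tau L) ∧
    -- `(ℛ, ◁)` is a poset
    IsStrictOrder M.rotations M.Precedes ∧
    -- `(𝒮, ⪯_F)` is a lattice, and `ω` is a lattice isomorphism onto the closed functions
    ∃ _latS : Lattice M.Stable, (∀ x y : M.Stable, x ≤ y ↔ M.leF x.val y.val) ∧
      ∃ ω : M.Stable ≃o M.closedFunctions,
        ∀ x₀ x : M.Stable, M.IsXMin x₀ →
          (∃ T, M.IsNonExcessiveRoute x x₀ T) ∧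
          ∀ T, M.IsNonExcessiveRoute x x₀ T → M.Records T (ω x : M.rotations → ℕ) := by
  refine ⟨hC.exists_fullRoute, fun T hT => ⟨hC.nodup_route (SGAM.isFullRoute_iff.1 hT),
    fun L l => ?_⟩, hC.isStrictOrder_precedes, inferInstance, fun _ _ => Iff.rfl, hC.countIso,
    fun x₀ x hx₀ => ?_⟩
  · rw [hC.mem_fullRoute_iff hT]
    constructor
    · rintro ⟨h1, h2⟩
      have hL : L ∈ M.rotations := hC.mem_rotations_iff.2 (h2 ▸ h1)
      exact ⟨hL, by rw [hC.tau_eq hL, h2]⟩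
    · rintro ⟨hL, rfl⟩
      rw [hC.tau_eq hL]
      exact ⟨hC.mem_rotations_iff.1 hL, rfl⟩
  · obtain rfl := SGAM.isXMin_iff.1 hx₀
    exact ⟨hC.exists_route bot_le, fun T hT => hC.records hT⟩
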